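/- **Setting.** Let $\mathcal G=(\mathcal V,\mathcal E)$ be an undirected graph with $N$ nodes, graph distance $d_{\mathcal G}$ and $\mathcal N^\kappa[i]=\{j: d_{\mathcal G}(i,j)\le\kappa\}$. Vectors and matrices are partitioned into blocks indexed by the nodes ($x[i]\in\mathbb R^{n_{x_i}}$, $u[i]\in\mathbb R^{n_{u_i}}$, $\theta[i]\in\mathbb R^{n_{\theta_i}}$), norms are Euclidean (operator) norms, and the $(i,\kappa)$-truncation $M^{(i,\kappa)}$ of a matrix or vector $M$ replaces all block rows $j\notin\mathcal N^\kappa[i]$ by $0$. The system is $$x_{t+1}=Ax_t+Bu_t+w_t(\theta_t^*),\qquad x_0 \text{ given},$$ where $A[i,j]=0$, $B[i,j]=0$ for $i\ne j$, $(i,j)\notin\mathcal E$, and the cost of a trajectory is $\sum_{t=0}^{T}f_t(x_t,\theta_t^*)+\sum_{t=0}^{T-1}c_{t+1}(u_t,\theta_t^*)$, with $f_t(x,\theta)=\sum_i f_t[i](x[i],\theta[i])$, $c_t(u,\theta)=\sum_i c_t[i](u[i],\theta[i])$, $w_t(\theta)=(w_t[i](\theta[i]))_i$. $OPT$ is the trajectory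 of least cost. Parameters lie in a given set of admissible parameters. At time $t$, forecasts $\theta_{t+n|t}$ of $\theta^*_{t+n}$ are available; $\phi_{t+n|t}:=\|\theta_{t+n|t}-\theta^*_{t+n}\|$ and $\Phi_n:=\sum_{t=0}^{T-n}\phi_{t+n|t}^2$. **Controller $uDTPC_k$.** At each time $t<T$ every agent $i$ solves, with $\ell=k$ and $g=F$ if $t<T-k$, and with $\ell=T-t$ and $g=f_T(\cdot,\theta_{T|t})$ if $t\ge T-k$, the problem of minimizing $$\sum_{\tau=0}^{\ell-1}\big(f_{t+\tau}(y_\tau,\theta_{t+\tau|t})+c_{t+\tau+1}(v_\tau,\theta_{t+\tau|t})\big)+g(y_\ell)$$ subject to $y_{\tau+1}=A^{(i,\kappa)}y_\tau+B^{(i,\kappa)}v_\tau+w_{t+\tau}(\theta_{t+\tau|t})^{(i,\kappa)}$, $y_0=x_t^{(i,\kappa)}$, and applies $u_t[i]=v_0[i]$. **Assumptions**, with constants $L>1$, $\gamma\in(0,1)$, $\mu,\sigma>0$, $D\ge0$, integers $d,\kappa_0\ge 0$, and a positive function $p$ on $\mathbb Z_+$ with $\lim_{e\to\infty}\log p(e)/e=0$: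 1. $\|A\|,\|B\|,\|B^\dagger\|\le L$; $\sigma_{\min}([B,AB,\dots,A^{d-1}B])\ge\sigma$ (least singular value, full row rank); $\kappa_0<\mathrm{diam}(\mathcal G)$, and for all $i$ and $\kappa\ge\kappa_0$ there is $K$ with $\|K\|\le L$ and $\|(A^{(i,\kappa)}-B^{(i,\kappa)}K)^t\|\le L\gamma^t$ for all $t\ge 0$. 2. For all $t$ and all admissible $\theta$, $f_t(\cdot,\theta)$ and $c_t(\cdot,\theta)$ are $\mu$-strongly convex, $L$-smooth, $C^2$, nonnegative and vanish at $0$; $F$ is $\mu$-strongly convex, $L$-smooth, $C^2$, and $F(x)=\beta(\|x\|)$ with $\beta$ strictly increasing, $\beta(0)=0$. 3. $|\{j:d_{\mathcal G}(i,j)=e\}|\le p(e)$ for all nodes $i$ and all $e\ge0$. 4. For all $t$ and all admissible $\theta$: $\|w_t(\theta)\|\le D$; $w_t$ and the Hessians $\nabla^2_{xx}f_t(x,\cdot)$, $\nabla^2_{uu}c_t(u,\cdot)$ are $L$-Lipschitz in $\theta$. **Constants.** $L_H=2L+1$, $\mu_J=\frac{(1-\gamma)^2}{L^2(1+L^2)}$,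 $\mu_H=\Big(\frac1\mu+\big(1+\frac{2L_H}{\mu}+\frac{L_H^2}{\mu^2}\big)\frac{L_H}{\mu_J}\Big)^{-1}$, $\rho=\Big(\frac{L_H^2-\mu_H^2}{L_H^2+\mu_H^2}\Big)^{1/2}$, $\alpha=\frac{L_H}{\mu_H^2\rho}$, $\delta_{\mathcal S}=\frac{1+\rho}2$, $\Gamma=\frac{4\alpha^2\delta_{\mathcal S}L}{(1-\delta_{\mathcal S})^2}\big(\sup_{e\ge0}(\rho/\delta_{\mathcal S})^ep(e)\big)^2p(1)$, $\Upsilon=\alpha L\big(1+\frac{2\alpha D}{1-\rho}\big)$. **Theorem.** There are constants $\Omega>0$ and $\delta_{\mathcal T}\in(0,1)$, depending only on $L,\gamma,\mu,\sigma,d$, for which the following holds. (a) Under Assumptions 1 and 2, for all horizons $\ell\ge d$, the optimal states $y_0,\dots,y_\ell$ of the problem of minimizing $\sum_{\tau=0}^{\ell}f_{t+\tau}(y_\tau)+\sum_{\tau=1}^{\ell}c_{t+\tau}(v_{\tau-1})$ (costs taken at any admissible parameters) subject to $y_{\tau+1}=Ay_\tau+Bv_\tau+\zeta_\tau$, $y_0=x$,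 $y_\ell=\bar x$, and those $y_m'$ for data $(x',\zeta',\bar x')$, satisfy $\|y_m-y_m'\|\le\Omega\big(\delta_{\mathcal T}^m\|x-x'\|+\delta_{\mathcal T}^{\ell-m}\|\bar x-\bar x'\|+\sum_{l=0}^{\ell-1}\delta_{\mathcal T}^{|m-l|}\|\zeta_l-\zeta_l'\|\big)$. (b) Let $C=\max(\Omega,\Gamma,\Upsilon)$, $\delta=\max(\delta_{\mathcal S},\delta_{\mathcal T})$, $\xi=1-\sqrt\delta$, and let Assumptions 1–4 hold. Let $k\le T$, let $D_k$ be such that $\sum_{\tau=0}^{k-1}\|w_{t+\tau}(\theta_{\tau})\|\le D_k$ for all $0\le t\le T-k$ and all admissible parameters $\theta_0,\dots,\theta_{k-1}$, and let $$\kappa\ge\max\left(\kappa_0,\frac{\log\frac{\sqrt\delta(1-\sqrt\delta)}{3C^2N}}{\log\delta}\right),\qquad k\ge\frac{2\log\frac{\delta(1-\delta)}{6C^3}}{\log\delta}.$$ Suppose that, with $\epsilon>0$ and $R\ge1$, for all $t<T$, $$\sum_{m=0}^{k-1}\sum_{n=0}^{k}\phi_{t-m+n|t-m}\,\delta^{2n+\frac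 m2}\le\frac{\sqrt\delta}{3LC^2}\qquad\text{and}\qquad \phi_{t+n|t}\le R(\delta+\epsilon)^{-n}\quad(0\le n\le k),$$ where only forecasts made at times $\ge0$ for times $\le T$ are taken into account. Then the trajectories of $uDTPC_k$ and of $OPT$ exist, and every trajectory of $uDTPC_k$ satisfies, for $0\le t\le T$, $$\|x_t\|\le\begin{cases}\frac C\xi(1-\xi)^{\max(0,t-k)}\|x_0\|+\frac W\xi,& t\le T-k,\\[2pt] \frac{C^2}{\xi^2}(1-\xi)^{T-2k}\delta^{t+k-T}\|x_0\|+\frac{2CW}{\xi^2},&\text{else},\end{cases}\qquad W=\frac{8LNC^2(\delta+\epsilon)R}{(1-\delta)^2\epsilon}D_k,$$ and $$\mathrm{cost}(uDTPC_k)-\mathrm{cost}(OPT)=O\left(\sqrt{T\sum_{n=0}^{k}\delta_{\mathcal T}^n\Phi_n+T^2\big(\delta_{\mathcal S}^{2\kappa}+\delta_{\mathcal T}^{2k}\big)}+\sum_{n=0}^{k}\delta_{\mathcal T}^n\Phi_n\right),$$ where the constant in $O(\cdot)$ depends only on $L,\gamma,\mu,\sigma,d,p,D,N,R,\epsilon$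 and on upper bounds for $D_k$ and $\|x_0\|$; in particular not on $T$, $k$, $\kappa$. -/

import Mathlib

open Filter Topology

noncomputable section

namespace NetCtrl

/-! ### Networked vectors, operators and truncations -/

/-- Vectors of the form `z = (z[i])` with `z[i] ∈ ℝ^{n i}`, one block for each of the `N` nodes,
with the Euclidean norm of the stacked vector. -/
abbrev Stack {N : ℕ} (n : Fin N → ℕ) : Type :=
  PiLp 2 (fun i : Fin N => EuclideanSpace ℝ (Fin (n i)))

/-- The `κ`-hop neighbourhood of `i`: all nodes at graph distance at most `κ` from `i`. -/
def hop {N : ℕ} (G : SimpleGraph (Fin N)) (κ : ℕ) (i : Fin N) : Set (Fin N) :=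
  {j | G.edist i j ≤ (κ : ℕ∞)}

open Classical in
/-- The `(i,κ)`-truncation of a vector: the blocks outside the `κ`-hop neighbourhood of `i` are
replaced by zero. For a matrix `M`, the truncation is `trunc G n κ i ∘L M` (block rows outside the
neighbourhood are replaced by zero). -/
def trunc {N : ℕ} (G : SimpleGraph (Fin N)) (n : Fin N → ℕ) (κ : ℕ) (i : Fin N) :
    Stack n →L[ℝ] Stack n :=
  LinearMap.toContinuousLinearMap
    { toFun := fun z => WithLp.toLp 2 (fun j => if j ∈ hop G κ i then z j else 0)
      map_add' := by
        intro y z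
        ext j : 1
        by_cases h : j ∈ hop G κ i <;> simp [h]
      map_smul' := by
        intro a z
        ext j : 1
        by_cases h : j ∈ hop G κ i <;> simp [h] }

/-- The block `M[i,j]` vanishes for distinct nodes `i`, `j` that are not joined by an edge. -/
def IsNetworked {N : ℕ} (G : SimpleGraph (Fin N)) {n m : Fin N → ℕ}
    (M : Stack m →L[ℝ] Stack n) : Prop :=
  ∀ i j : Fin N, i ≠ j → ¬ G.Adj i j →
    ∀ z : EuclideanSpace ℝ (Fin (m j)), M (PiLp.single 2 j z) i = 0

section LinearSystems

variable {X U : Type*} [NormedAddCommGroup X] [InnerProductSpace ℝ X] [CompleteSpace X]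
  [NormedAddCommGroup U] [InnerProductSpace ℝ U] [CompleteSpace U]

/-- `(L,γ)`-stabilizability of the pair `(A,B)`. -/
def Stabilizable (A : X →L[ℝ] X) (B : U →L[ℝ] X) (L γ : ℝ) : Prop :=
  ∃ K : X →L[ℝ] U, ‖K‖ ≤ L ∧ ∀ t : ℕ, ‖(A - B ∘L K) ^ t‖ ≤ L * γ ^ t

/-- `M` is the Moore-Penrose pseudo-inverse of `B` (the four Penrose equations). -/
def IsPseudoInverse (B : U →L[ℝ] X) (M : X →L[ℝ] U) : Prop :=
  B ∘L M ∘L B = B ∧ M ∘L B ∘L M = M ∧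
    ContinuousLinearMap.adjoint (B ∘L M) = B ∘L M ∧
    ContinuousLinearMap.adjoint (M ∘L B) = M ∘L B

/-- The reduced controllability matrix `[B, AB, …, A^{d-1}B]`, as a map
`(v_0,…,v_{d-1}) ↦ ∑ A^j B v_j`. -/
def ctrlMap (A : X →L[ℝ] X) (B : U →L[ℝ] X) (d : ℕ) :
    PiLp 2 (fun _ : Fin d => U) →L[ℝ] X :=
  ∑ j : Fin d, (A ^ (j : ℕ)) ∘L B ∘L PiLp.proj 2 (fun _ : Fin d => U) j

/-! ### Finite-horizon optimal control problems

Trajectories are sequences; for horizon `ℓ` only `y 0, …, y ℓ` and `v 0, …, v (ℓ-1)` matter. -/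

/-- `y_0 = x` and `y_{τ+1} = A y_τ + B v_τ + ζ_τ` for `τ = 0,…,ℓ-1`. -/
def IsTraj (A : X →L[ℝ] X) (B : U →L[ℝ] X) (ζ : ℕ → X) (x : X) (ℓ : ℕ)
    (y : ℕ → X) (v : ℕ → U) : Prop :=
  y 0 = x ∧ ∀ τ < ℓ, y (τ + 1) = A (y τ) + B (v τ) + ζ τ

/-- Total cost `∑_{τ<ℓ} (f_τ(y_τ) + c_τ(v_τ)) + g(y_ℓ)`; here `c τ` is the cost of the control
applied at stage `τ`. -/
def horizonCost (f : ℕ → X → ℝ) (c : ℕ → U → ℝ) (g : X → ℝ) (ℓ : ℕ)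
    (y : ℕ → X) (v : ℕ → U) : ℝ :=
  ∑ τ ∈ Finset.range ℓ, (f τ (y τ) + c τ (v τ)) + g (y ℓ)

/-- `(y,v)` minimizes the total cost over all trajectories starting from `x`. -/
def IsSolution (A : X →L[ℝ] X) (B : U →L[ℝ] X) (f : ℕ → X → ℝ) (c : ℕ → U → ℝ) (g : X → ℝ)
    (ζ : ℕ → X) (x : X) (ℓ : ℕ) (y : ℕ → X) (v : ℕ → U) : Prop :=
  IsTraj A B ζ x ℓ y v ∧
    ∀ y' v', IsTraj A B ζ x ℓ y' v' → horizonCost f c g ℓ y v ≤ horizonCost f c g ℓ y' v'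

/-- `(y,v)` minimizes the total cost over all trajectories from `x` to the prescribed terminal
state `xbar`. -/
def IsTerminalSolution (A : X →L[ℝ] X) (B : U →L[ℝ] X) (f : ℕ → X → ℝ) (c : ℕ → U → ℝ)
    (ζ : ℕ → X) (x xbar : X) (ℓ : ℕ) (y : ℕ → X) (v : ℕ → U) : Prop :=
  (IsTraj A B ζ x ℓ y v ∧ y ℓ = xbar) ∧
    ∀ y' v', IsTraj A B ζ x ℓ y' v' ∧ y' ℓ = xbar →
      horizonCost f c (f ℓ) ℓ y v ≤ horizonCost f c (f ℓ) ℓ y' v'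

/-- `f` is `μ`-strongly convex, `L`-smooth (its gradient is `L`-Lipschitz) and twice continuously
differentiable. The norm of a difference of Fréchet derivatives is the norm of the difference of
the gradients. -/
def WellConditioned (μ L : ℝ) (f : X → ℝ) : Prop :=
  StrongConvexOn Set.univ μ f ∧ ContDiff ℝ 2 f ∧
    ∀ x x' : X, ‖fderiv ℝ f x - fderiv ℝ f x'‖ ≤ L * ‖x - x'‖

end LinearSystems

/-! ### The networked control problem with parameterized costs and disturbances -/

/-- The data of a networked problem with `N` nodes: graph, block dimensions, dynamics, node costs
`f t i = f_t[i]`, `c t i = c_t[i]` and node disturbances `w t i = w_t[i]`, all depending on a node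
parameter, the terminal cost `F` and the set `Θ` of admissible (stacked) parameters. -/
structure NetProblem (N : ℕ) where
  G : SimpleGraph (Fin N)
  nx : Fin N → ℕ
  nu : Fin N → ℕ
  nθ : Fin N → ℕ
  A : Stack nx →L[ℝ] Stack nx
  B : Stack nu →L[ℝ] Stack nx
  f : ℕ → (i : Fin N) → EuclideanSpace ℝ (Fin (nx i)) → EuclideanSpace ℝ (Fin (nθ i)) → ℝ
  c : ℕ → (i : Fin N) → EuclideanSpace ℝ (Fin (nu i)) → EuclideanSpace ℝ (Fin (nθ i)) → ℝ
  w : ℕ → (i : Fin N) → EuclideanSpace ℝ (Fin (nθ i)) → EuclideanSpace ℝ (Fin (nx i))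
  F : Stack nx → ℝ
  Θ : Set (Stack nθ)

namespace NetProblem

variable {N : ℕ} (S : NetProblem N)

/-- States, controls and parameters of the whole network. -/
abbrev State : Type := Stack S.nx
abbrev Control : Type := Stack S.nu
abbrev Param : Type := Stack S.nθ

/-- `f_t(x,θ) = ∑_i f_t[i](x[i],θ[i])`. -/
def stateCost (t : ℕ) (θ : S.Param) (x : S.State) : ℝ := ∑ i, S.f t i (x i) (θ i)

/-- `c_t(u,θ) = ∑_i c_t[i](u[i],θ[i])`. -/
def ctrlCost (t : ℕ) (θ : S.Param) (u : S.Control) : ℝ := ∑ i, S.c t i (u i) (θ i)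

/-- `w_t(θ) = (w_t[i](θ[i]))_i`. -/
def dist (t : ℕ) (θ : S.Param) : S.State := WithLp.toLp 2 (fun i => S.w t i (θ i))

/-- `(y,v)` solves the horizon-`ℓ` problem of agent `i` at time `t` with terminal cost `g`, state
`x` and parameter forecasts `ϑ 0, ϑ 1, …` for the times `t, t+1, …`: dynamics, disturbances and
initial state are replaced by their `(i,κ)`-truncations. -/
def IsAgentSolution (κ : ℕ) (i : Fin N) (t ℓ : ℕ) (ϑ : ℕ → S.Param) (g : S.State → ℝ)
    (x : S.State) (y : ℕ → S.State) (v : ℕ → S.Control) : Prop :=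
  IsSolution (trunc S.G S.nx κ i ∘L S.A) (trunc S.G S.nx κ i ∘L S.B)
    (fun τ => S.stateCost (t + τ) (ϑ τ)) (fun τ => S.ctrlCost (t + τ + 1) (ϑ τ)) g
    (fun τ => trunc S.G S.nx κ i (S.dist (t + τ) (ϑ τ))) (trunc S.G S.nx κ i x) ℓ y v

/-- `(x,u)` is a closed-loop trajectory of the distributed truncated predictive controller with
uncertain forecasts, prediction horizon `k` and truncation radius `κ`, over the horizon `T`.
`θs t` is the true parameter at time `t` and `θh s t` the forecast of `θs s` made at time `t`.
At time `t < T - k` the agents plan `k` steps ahead with terminal cost `F`; later they plan up to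
time `T`, with the forecast of the true terminal cost. Agent `i` applies its own block of the first
control of its own plan. -/
structure IsUDTPC (T k κ : ℕ) (θs : ℕ → S.Param) (θh : ℕ → ℕ → S.Param) (x0 : S.State)
    (x : ℕ → S.State) (u : ℕ → S.Control) : Prop where
  traj : IsTraj S.A S.B (fun t => S.dist t (θs t)) x0 T x u
  early : ∀ t, t + k < T → ∀ i, ∃ y v,
    S.IsAgentSolution κ i t k (fun τ => θh (t + τ) t) S.F (x t) y v ∧ u t i = v 0 i
  late : ∀ t, t < T → T ≤ t + k → ∀ i, ∃ y v,
    S.IsAgentSolution κ i t (T - t) (fun τ => θh (t + τ) t) (S.stateCost T (θh T t)) (x t) y v ∧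
      u t i = v 0 i

/-- The true cost of a trajectory over the horizon `T`:
`∑_{t=0}^T f_t(x_t,θ_t) + ∑_{t=0}^{T-1} c_{t+1}(u_t,θ_t)`. -/
def cost (T : ℕ) (θs : ℕ → S.Param) (x : ℕ → S.State) (u : ℕ → S.Control) : ℝ :=
  horizonCost (fun t => S.stateCost t (θs t)) (fun t => S.ctrlCost (t + 1) (θs t))
    (S.stateCost T (θs T)) T x u

/-- `(x,u)` is an optimal offline trajectory from `x0`. -/
def IsOPT (T : ℕ) (θs : ℕ → S.Param) (x0 : S.State)
    (x : ℕ → S.State) (u : ℕ → S.Control) : Prop :=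
  IsTraj S.A S.B (fun t => S.dist t (θs t)) x0 T x u ∧
    ∀ x' u', IsTraj S.A S.B (fun t => S.dist t (θs t)) x0 T x' u' →
      S.cost T θs x u ≤ S.cost T θs x' u'

/-! ### Assumptions -/

/-- Assumptions on the system matrices. -/
structure SystemAssumption (L γ σ : ℝ) (d κ0 : ℕ) : Prop where
  networkedA : IsNetworked S.G S.A
  networkedB : IsNetworked S.G S.B
  normA : ‖S.A‖ ≤ L
  normB : ‖S.B‖ ≤ L
  normPinv : ∃ M, IsPseudoInverse S.B M ∧ ‖M‖ ≤ L
  /-- the least singular value of the reduced controllability matrix, which is of full row rank,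
  is at least `σ` -/
  controllable : ∀ z, σ * ‖z‖ ≤ ‖ContinuousLinearMap.adjoint (ctrlMap S.A S.B d) z‖
  diam : (κ0 : ℕ∞) < S.G.ediam
  stabilizable : ∀ κ ≥ κ0, ∀ i,
    Stabilizable (trunc S.G S.nx κ i ∘L S.A) (trunc S.G S.nx κ i ∘L S.B) L γ

/-- Assumptions on the costs, for all times and all admissible parameters. -/
structure CostAssumption (L μ : ℝ) : Prop where
  state : ∀ t, ∀ θ ∈ S.Θ, WellConditioned μ L (S.stateCost t θ)
  ctrl : ∀ t, ∀ θ ∈ S.Θ, WellConditioned μ L (S.ctrlCost t θ)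
  terminal : WellConditioned μ L S.F
  terminal_radial : ∃ β : ℝ → ℝ, StrictMonoOn β (Set.Ici 0) ∧ β 0 = 0 ∧ ∀ x, S.F x = β ‖x‖
  state_nonneg : ∀ t, ∀ θ ∈ S.Θ, ∀ x, 0 ≤ S.stateCost t θ x
  ctrl_nonneg : ∀ t, ∀ θ ∈ S.Θ, ∀ u, 0 ≤ S.ctrlCost t θ u
  state_zero : ∀ t, ∀ θ ∈ S.Θ, S.stateCost t θ 0 = 0
  ctrl_zero : ∀ t, ∀ θ ∈ S.Θ, S.ctrlCost t θ 0 = 0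

/-- At every node there are at most `p e` nodes at distance exactly `e`. -/
def BandAssumption (p : ℕ → ℝ) : Prop :=
  ∀ (i : Fin N) (e : ℕ), (({j | S.G.edist i j = (e : ℕ∞)} : Set (Fin N)).ncard : ℝ) ≤ p e

/-- Disturbances are bounded by `D` and `L`-Lipschitz in the parameter, and the Hessians of the
costs are `L`-Lipschitz in the parameter. -/
structure ParamAssumption (L D : ℝ) : Prop where
  dist_bound : ∀ t, ∀ θ ∈ S.Θ, ‖S.dist t θ‖ ≤ D
  dist_lipschitz : ∀ t, ∀ θ ∈ S.Θ, ∀ θ' ∈ S.Θ, ‖S.dist t θ - S.dist t θ'‖ ≤ L * ‖θ - θ'‖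
  hess_state : ∀ t, ∀ θ ∈ S.Θ, ∀ θ' ∈ S.Θ, ∀ x,
    ‖fderiv ℝ (fderiv ℝ (S.stateCost t θ)) x - fderiv ℝ (fderiv ℝ (S.stateCost t θ')) x‖
      ≤ L * ‖θ - θ'‖
  hess_ctrl : ∀ t, ∀ θ ∈ S.Θ, ∀ θ' ∈ S.Θ, ∀ u,
    ‖fderiv ℝ (fderiv ℝ (S.ctrlCost t θ)) u - fderiv ℝ (fderiv ℝ (S.ctrlCost t θ')) u‖
      ≤ L * ‖θ - θ'‖

/-- Temporal decay with constants `Ω`, `δT`: the states of the optimal trajectories between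
prescribed initial and terminal states, for horizons `ℓ ≥ d`, depend on these states and on the
disturbances in a Lipschitz way, with geometrically decaying weights. -/
def TemporalDecay (d : ℕ) (Ω δT : ℝ) : Prop :=
  ∀ (t ℓ : ℕ) (ϑ : ℕ → S.Param) (x x' xbar xbar' : S.State) (ζ ζ' : ℕ → S.State)
    (y y' : ℕ → S.State) (v v' : ℕ → S.Control),
    d ≤ ℓ → (∀ τ, ϑ τ ∈ S.Θ) →
    IsTerminalSolution S.A S.B (fun τ => S.stateCost (t + τ) (ϑ τ))
      (fun τ => S.ctrlCost (t + τ + 1) (ϑ τ)) ζ x xbar ℓ y v →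
    IsTerminalSolution S.A S.B (fun τ => S.stateCost (t + τ) (ϑ τ))
      (fun τ => S.ctrlCost (t + τ + 1) (ϑ τ)) ζ' x' xbar' ℓ y' v' →
    ∀ m ≤ ℓ, ‖y m - y' m‖ ≤
      Ω * (δT ^ m * ‖x - x'‖ + δT ^ (ℓ - m) * ‖xbar - xbar'‖ +
        ∑ l ∈ Finset.range ℓ, δT ^ ((m : ℤ) - (l : ℤ)).natAbs * ‖ζ l - ζ' l‖)

end NetProblem

/-! ### Constants -/

/-- `p` is positive and subexponential: `log (p e) / e → 0`. -/
def Subexponential (p : ℕ → ℝ) : Prop :=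
  (∀ e, 0 < p e) ∧ Tendsto (fun e : ℕ => Real.log (p e) / e) atTop (𝓝 0)

/-- Upper bound for the singular values of the KKT matrices. -/
def LH (L : ℝ) : ℝ := 2 * L + 1

/-- Lower bound for `J Jᵀ`, with `J` the Jacobian of the constraints. -/
def μJ (L γ : ℝ) : ℝ := (1 - γ) ^ 2 / (L ^ 2 * (1 + L ^ 2))

/-- Lower bound for the singular values of the KKT matrices. -/
def μH (L γ μ : ℝ) : ℝ :=
  (1 / μ + (1 + 2 * LH L / μ + LH L ^ 2 / μ ^ 2) * (LH L / μJ L γ))⁻¹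

/-- Decay rate of the inverses of the KKT matrices. -/
def ρ (L γ μ : ℝ) : ℝ :=
  √((LH L ^ 2 - μH L γ μ ^ 2) / (LH L ^ 2 + μH L γ μ ^ 2))

/-- Decay factor of the inverses of the KKT matrices. -/
def α (L γ μ : ℝ) : ℝ := LH L / (μH L γ μ ^ 2 * ρ L γ μ)

/-- Spatial decay rate. -/
def δS (L γ μ : ℝ) : ℝ := (ρ L γ μ + 1) / 2

/-- Spatial decay factor. -/
def Γ (L γ μ : ℝ) (p : ℕ → ℝ) : ℝ :=
  4 * α L γ μ ^ 2 * δS L γ μ * L / (1 - δS L γ μ) ^ 2 *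
    (⨆ e : ℕ, (ρ L γ μ / δS L γ μ) ^ e * p e) ^ 2 * p 1

/-- Factor in the sensitivity to the forecasts. -/
def Υ (L γ μ D : ℝ) : ℝ := α L γ μ * L * (1 + 2 * α L γ μ * D / (1 - ρ L γ μ))

end NetCtrl

end

open NetCtrl

namespace NetCtrl
noncomputable section
set_option linter.unusedSectionVars false

section

/-! ### Well-conditioned functions -/

section WellConditioned

variable {X : Type*} [NormedAddCommGroup X] [InnerProductSpace ℝ X] [CompleteSpace X]
  {μ L : ℝ} {f : X → ℝ}

/-! A minimizer of a finite-horizon problem satisfies an optimality system: the dynamics, a backward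
recursion for multipliers `p`, and stationarity in the controls. In the difference of two such
systems the gradients enter only through strong monotonicity and a Lipschitz bound. Pairing the
recursion for `p` with the states (`sum_inner_eq`) bounds states and controls by the data and a
small multiple of `p`. Conversely `p` is bounded by the gradients, because the adjoint of the
constraint operator is coercive uniformly in the horizon (`DualBound`): by stabilizability for the
truncated dynamics, by controllability for the full dynamics. The outcome is the ℓ² estimate
`kkt_energy_le`.

Exponential decay comes from the same estimate in weighted norms, as in the Combes–Thomas method.
Weights that vary slowly almost commute with the dynamics, and the commutators are absorbed
(`kkt_weighted_le`). Weights `γ ^ |τ - m|` in time give the sensitivity to initial states, terminal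
states and disturbances, hence part (a). Weights that decrease with the graph distance from a node
`i` give `trunc_compare`: the truncated plan of `i` solves the full system up to residuals that live
outside its neighbourhood.

The control applied at time `t` is compared with the first control of the true optimal trajectory
from the current state (`control_error_sq_le`). The error stems from truncation, terminal cost and
forecasts. The terminal cost `F` is not separable, but it is radial, so its gradient at any point is
`s` times that point with `s` between `μ` and `L`. Each plan therefore also solves an optimality
system with quadratic terminal cost. The coefficient `s` differs between agents; the first control
is Lipschitz in `s` with constant of order `γ ^ k`, and `sum_norm_block_curve_le` avoids a factor
`N`.

For the closed loop, `deviation_le` telescopes over the optimal trajectories from the visited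
states. A Gronwall argument then gives the state bound. Boundedness of geometric convolutions on ℓ²,
with smoothness of the costs, gives the regret.

The rate `decayRate` is produced by this method and is unrelated to `δS`, `Γ`, `Υ`. Since `Ω` and
`δT` may be chosen, they are taken so large that `C ≥ Ω` and `δ ≥ δT` turn the hypotheses on `κ`,
`k` and the forecasts into a small-gain condition. The rate `δS` in the regret costs a constant
depending on `N`: for `κ ≥ N` the truncation error vanishes, and only finitely many `κ` remain. -/

theorem WellConditioned.differentiable (hf : WellConditioned μ L f) : Differentiable ℝ f :=
  hf.2.1.differentiable (by norm_num)

theorem WellConditioned.hasGradientAt (hf : WellConditioned μ L f) (x : X) :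
    HasGradientAt f (gradient f x) x :=
  (hf.differentiable x).hasGradientAt

theorem inner_gradient {f : X → ℝ} {x : X} (h : X) :
    inner ℝ (gradient f x) h = fderiv ℝ f x h := by
  rw [← toDual_gradient, InnerProductSpace.toDual_apply_apply]

theorem norm_gradient_sub_eq (f g : X → ℝ) (x y : X) :
    ‖gradient f x - gradient g y‖ = ‖fderiv ℝ f x - fderiv ℝ g y‖ := by
  rw [← toDual_gradient, ← toDual_gradient, ← map_sub, LinearIsometryEquiv.norm_map]

theorem WellConditioned.norm_gradient_sub_le (hf : WellConditioned μ L f) (x y : X) :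
    ‖gradient f x - gradient f y‖ ≤ L * ‖x - y‖ := by
  rw [norm_gradient_sub_eq]; exact hf.2.2 x y

theorem hasDerivAt_comp_line {f : X → ℝ} {x : X} (hf : DifferentiableAt ℝ f x) (h : X) :
    HasDerivAt (fun t : ℝ => f (x + t • h)) (inner ℝ (gradient f x) h) 0 := by
  have h1 : HasDerivAt (fun t : ℝ => x + t • h) h 0 := by
    simpa using ((hasDerivAt_id (0 : ℝ)).smul_const h).const_add x
  have h2 : HasFDerivAt f (fderiv ℝ f x) (x + (0 : ℝ) • h) := by simpa using hf.hasFDerivAt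
  rw [inner_gradient]
  exact h2.comp_hasDerivAt (0 : ℝ) h1

/-- Strong convexity on the segment from `x` to `y`, divided by the parameter `t`, passes to the
limit `t → 0+`; the difference quotient becomes the directional derivative. -/
theorem WellConditioned.lower_bound (hf : WellConditioned μ L f) (x y : X) :
    f x + inner ℝ (gradient f x) (y - x) + μ / 2 * ‖y - x‖ ^ 2 ≤ f y := by
  have hd := hasDerivAt_comp_line (hf.differentiable x) (y - x)
  have h1 := hd.tendsto_slope_zero_right
  have h2 : Tendsto (fun t : ℝ => f y - f x - (1 - t) * (μ / 2 * ‖y - x‖ ^ 2)) (𝓝[>] 0)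
      (𝓝 (f y - f x - (1 - 0) * (μ / 2 * ‖y - x‖ ^ 2))) := by
    apply Tendsto.mono_left _ nhdsWithin_le_nhds
    exact Continuous.tendsto (by fun_prop) 0
  have h3 : ∀ᶠ t : ℝ in 𝓝[>] 0, t⁻¹ • (f (x + (0 + t) • (y - x)) - f (x + (0 : ℝ) • (y - x))) ≤
      f y - f x - (1 - t) * (μ / 2 * ‖y - x‖ ^ 2) := by
    filter_upwards [Ioo_mem_nhdsGT (show (0 : ℝ) < 1 by norm_num)] with t ht
    have h4 := hf.1.2 (Set.mem_univ x) (Set.mem_univ y) (sub_nonneg.2 ht.2.le) ht.1.le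
      (by ring)
    have h5 : (1 - t) • x + t • y = x + (0 + t) • (y - x) := by
      rw [zero_add, sub_smul, smul_sub, one_smul]; abel
    rw [h5, norm_sub_rev x y] at h4
    simp only [smul_eq_mul, zero_smul, add_zero] at h4 ⊢
    rw [inv_mul_le_iff₀ ht.1]
    nlinarith [h4]
  have h4 := le_of_tendsto_of_tendsto h1 h2 h3
  simp only [sub_zero, one_mul] at h4
  linarith

theorem WellConditioned.monotone_gradient (hf : WellConditioned μ L f) (x y : X) :
    μ * ‖x - y‖ ^ 2 ≤ inner ℝ (gradient f x - gradient f y) (x - y) := by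
  have h1 := hf.lower_bound x y
  have h2 := hf.lower_bound y x
  have h3 : inner ℝ (gradient f x) (y - x) = - inner ℝ (gradient f x) (x - y) := by
    rw [← inner_neg_right, neg_sub]
  rw [inner_sub_left]
  rw [norm_sub_rev y x, h3] at h1
  linarith

/-- The constant is `L` instead of `L / 2` because no integration along the segment is made:
convexity at `y` is combined with the Lipschitz bound for the gradient. -/
theorem WellConditioned.upper_bound (hf : WellConditioned μ L f) (hμ : 0 ≤ μ) (x y : X) :
    f y ≤ f x + inner ℝ (gradient f x) (y - x) + L * ‖y - x‖ ^ 2 := by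
  have h1 := hf.lower_bound y x
  have h2 : inner ℝ (gradient f y) (x - y) = - inner ℝ (gradient f x) (y - x)
      - inner ℝ (gradient f y - gradient f x) (y - x) := by
    rw [inner_sub_left, ← neg_sub y x, inner_neg_right]; ring
  have h3 := real_inner_le_norm (gradient f y - gradient f x) (y - x)
  have h4 := hf.norm_gradient_sub_le y x
  have h5 : ‖gradient f y - gradient f x‖ * ‖y - x‖ ≤ L * ‖y - x‖ * ‖y - x‖ := by gcongr
  have h6 : 0 ≤ μ / 2 * ‖x - y‖ ^ 2 := by positivity
  nlinarith

theorem gradient_eq_zero_of_forall_ge {f : X → ℝ} {x : X} (h : ∀ y, f x ≤ f y) :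
    gradient f x = 0 := by
  have : IsLocalMin f x := Filter.Eventually.of_forall h
  rw [gradient, this.fderiv_eq_zero, map_zero]

theorem WellConditioned.quadratic_le (hf : WellConditioned μ L f) (h0 : f 0 = 0)
    (hnn : ∀ x, 0 ≤ f x) (x : X) : μ / 2 * ‖x‖ ^ 2 ≤ f x := by
  have h1 := hf.lower_bound 0 x
  rw [gradient_eq_zero_of_forall_ge (fun y => by rw [h0]; exact hnn y)] at h1
  simpa [h0] using h1

/-- Both gradients vanish at `0`, so the mean value inequality from `0` to `x` applies to their
difference. This is how Lipschitz dependence of the Hessians on the parameter becomes an error of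
the gradients proportional to the state. -/
theorem norm_gradient_sub_gradient_le {f g : X → ℝ} {K : ℝ} (hf : ContDiff ℝ 2 f)
    (hg : ContDiff ℝ 2 g) (hf0 : gradient f 0 = 0) (hg0 : gradient g 0 = 0)
    (h : ∀ x, ‖fderiv ℝ (fderiv ℝ f) x - fderiv ℝ (fderiv ℝ g) x‖ ≤ K) (x : X) :
    ‖gradient f x - gradient g x‖ ≤ K * ‖x‖ := by
  rw [norm_gradient_sub_eq]
  have hdf : Differentiable ℝ (fderiv ℝ f) :=
    (hf.fderiv_right (m := 1) (by norm_num)).differentiable (by norm_num)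
  have hdg : Differentiable ℝ (fderiv ℝ g) :=
    (hg.fderiv_right (m := 1) (by norm_num)).differentiable (by norm_num)
  have e1 : fderiv ℝ f 0 = 0 := by rw [← toDual_gradient, hf0, map_zero]
  have e2 : fderiv ℝ g 0 = 0 := by rw [← toDual_gradient, hg0, map_zero]
  have := (convex_univ (𝕜 := ℝ) (E := X)).norm_image_sub_le_of_norm_fderiv_le (𝕜 := ℝ)
    (f := fun x => fderiv ℝ f x - fderiv ℝ g x) (C := K) (x := 0) (y := x)
    (fun y _ => (hdf y).sub (hdg y))
    (fun y _ => by
      rw [fderiv_fun_sub (hdf y) (hdg y)]; exact h y) (Set.mem_univ _) (Set.mem_univ _)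
  simpa [e1, e2] using this

/-- The gradient of a well-conditioned radial function is a multiple of its argument. -/
theorem WellConditioned.exists_gradient_eq_smul (hf : WellConditioned μ L f) (hμL : μ ≤ L)
    {β : ℝ → ℝ} (hβ : StrictMonoOn β (Set.Ici 0)) (hfβ : ∀ x, f x = β ‖x‖) (x : X) :
    ∃ s : ℝ, μ ≤ s ∧ s ≤ L ∧ gradient f x = s • x := by
  have hmin : ∀ y, f 0 ≤ f y := fun y => by
    rw [hfβ, hfβ, norm_zero]
    exact hβ.monotoneOn (Set.mem_Ici.2 le_rfl) (Set.mem_Ici.2 (norm_nonneg y)) (norm_nonneg y)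
  have h0 : gradient f 0 = 0 := gradient_eq_zero_of_forall_ge hmin
  by_cases hx : x = 0
  · exact ⟨μ, le_rfl, hμL, by rw [hx, h0, smul_zero]⟩
  have hxn : 0 < ‖x‖ := norm_pos_iff.2 hx
  -- Along a direction orthogonal to `x` the norm, hence `f`, is an even function of the parameter,
  -- so its derivative vanishes.
  have horth : ∀ h : X, inner ℝ x h = 0 → inner ℝ (gradient f x) h = 0 := by
    intro h hh
    have h1 := hasDerivAt_comp_line (hf.differentiable x) h
    have h2 : HasDerivAt (fun t : ℝ => f (x + (-t) • h)) (-inner ℝ (gradient f x) h) 0 := by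
      have := HasDerivAt.scomp (0 : ℝ) (h := fun t : ℝ => -t)
        (g₁ := fun t : ℝ => f (x + t • h)) (h' := -1) (g₁' := inner ℝ (gradient f x) h)
        (by simpa using h1) (hasDerivAt_neg (0 : ℝ))
      simpa [Function.comp_def] using this
    have h3 : (fun t : ℝ => f (x + (-t) • h)) = fun t : ℝ => f (x + t • h) := by
      funext t
      rw [hfβ, hfβ]
      congr 1
      rw [← sq_eq_sq₀ (norm_nonneg _) (norm_nonneg _), norm_add_sq_real, norm_add_sq_real,
        inner_smul_right, inner_smul_right, hh, norm_smul, norm_smul, norm_neg]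
      ring
    rw [h3] at h2
    have := h1.unique h2
    linarith
  set s : ℝ := inner ℝ (gradient f x) x / ‖x‖ ^ 2 with hs
  have hg : gradient f x = s • x := by
    have hperp : inner ℝ x (gradient f x - s • x) = 0 := by
      rw [inner_sub_right, inner_smul_right, real_inner_self_eq_norm_sq, hs,
        real_inner_comm (gradient f x) x]
      field_simp
      ring
    have h1 := horth _ hperp
    have h2 : inner ℝ (gradient f x - s • x) (gradient f x - s • x) = (0 : ℝ) := by
      rw [inner_sub_left, h1, inner_smul_left, hperp]; simp
    exact sub_eq_zero.1 (inner_self_eq_zero.1 h2)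
  have h1 := hf.monotone_gradient x 0
  have h2 := hf.norm_gradient_sub_le x 0
  rw [h0, sub_zero, sub_zero] at h1 h2
  refine ⟨s, ?_, ?_, hg⟩
  · rw [hs, le_div_iff₀ (by positivity)]; exact h1
  · rw [hg, norm_smul, Real.norm_eq_abs] at h2
    exact (le_abs_self s).trans (le_of_mul_le_mul_right h2 hxn)

end WellConditioned

/-! ### Finite sums -/

/-- Schur's test: Cauchy–Schwarz with the kernel split evenly between both factors, then an exchange
of the sums. -/
theorem schur_sum_sq_le {ι κ : Type*} (s : Finset ι) (t : Finset κ) (k : ι → κ → ℝ) (c : κ → ℝ)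
    {a b : ℝ} (hk : ∀ i j, 0 ≤ k i j) (ha : 0 ≤ a) (hrow : ∀ i ∈ s, ∑ j ∈ t, k i j ≤ a)
    (hcol : ∀ j ∈ t, ∑ i ∈ s, k i j ≤ b) :
    ∑ i ∈ s, (∑ j ∈ t, k i j * c j) ^ 2 ≤ a * b * ∑ j ∈ t, c j ^ 2 := by
  calc ∑ i ∈ s, (∑ j ∈ t, k i j * c j) ^ 2
      ≤ ∑ i ∈ s, a * ∑ j ∈ t, k i j * c j ^ 2 := by
        refine Finset.sum_le_sum fun i hi => ?_
        refine (Finset.sum_sq_le_sum_mul_sum_of_sq_le_mul t (fun j _ => hk i j)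
          (fun j _ => mul_nonneg (hk i j) (sq_nonneg (c j))) (fun j _ => le_of_eq (by ring))).trans ?_
        exact mul_le_mul_of_nonneg_right (hrow i hi)
          (Finset.sum_nonneg fun j _ => mul_nonneg (hk i j) (sq_nonneg (c j)))
    _ = a * ∑ j ∈ t, (∑ i ∈ s, k i j) * c j ^ 2 := by
        rw [← Finset.mul_sum, Finset.sum_comm]
        simp_rw [Finset.sum_mul]
    _ ≤ a * ∑ j ∈ t, b * c j ^ 2 := by
        refine mul_le_mul_of_nonneg_left (Finset.sum_le_sum fun j hj => ?_) ha
        exact mul_le_mul_of_nonneg_right (hcol j hj) (sq_nonneg _)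
    _ = a * b * ∑ j ∈ t, c j ^ 2 := by rw [← Finset.mul_sum, mul_assoc]

theorem sq_add_le_two_mul (a b : ℝ) : (a + b) ^ 2 ≤ 2 * (a ^ 2 + b ^ 2) := by
  nlinarith [sq_nonneg (a - b)]

theorem norm_add_sq_le_two_mul {E : Type*} [SeminormedAddCommGroup E] (a b : E) :
    ‖a + b‖ ^ 2 ≤ 2 * (‖a‖ ^ 2 + ‖b‖ ^ 2) :=
  (pow_le_pow_left₀ (norm_nonneg _) (norm_add_le a b) 2).trans (sq_add_le_two_mul _ _)

theorem sum_pow_le {γ : ℝ} (h0 : 0 ≤ γ) (h1 : γ < 1) (n : ℕ) :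
    ∑ j ∈ Finset.range n, γ ^ j ≤ (1 - γ)⁻¹ := by
  rw [← tsum_geometric_of_lt_one h0 h1]
  exact (summable_geometric_of_lt_one h0 h1).sum_le_tsum _ (fun i _ => pow_nonneg h0 i)

/-- Both tails of a two-sided geometric sum. -/
theorem sum_pow_natAbs_le {γ : ℝ} (h0 : 0 ≤ γ) (h1 : γ < 1) (m n : ℕ) :
    ∑ l ∈ Finset.range n, γ ^ ((m : ℤ) - (l : ℤ)).natAbs ≤ 2 * (1 - γ)⁻¹ := by
  have key : ∀ l : ℕ, γ ^ ((m : ℤ) - (l : ℤ)).natAbs ≤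
      (if l ≤ m then γ ^ (m - l) else 0) + (if m ≤ l then γ ^ (l - m) else 0) := by
    intro l
    rcases le_total l m with h | h
    · have : ((m : ℤ) - (l : ℤ)).natAbs = m - l := by omega
      rw [this, if_pos h]
      have : 0 ≤ (if m ≤ l then γ ^ (l - m) else 0) := by split_ifs <;> positivity
      linarith
    · have : ((m : ℤ) - (l : ℤ)).natAbs = l - m := by omega
      rw [this, if_pos h]
      have : 0 ≤ (if l ≤ m then γ ^ (m - l) else 0) := by split_ifs <;> positivity
      linarith
  refine (Finset.sum_le_sum fun l _ => key l).trans ?_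
  rw [Finset.sum_add_distrib, two_mul]
  refine add_le_add ?_ ?_
  · rw [← Finset.sum_filter]
    refine le_trans ?_ (sum_pow_le h0 h1 (m + 1))
    rw [← Finset.sum_range_reflect (fun j => γ ^ j)]
    refine (Finset.sum_le_sum_of_subset_of_nonneg (t := Finset.range (m + 1)) ?_ ?_).trans
      (le_of_eq (Finset.sum_congr rfl ?_))
    · intro l hl; simp only [Finset.mem_filter, Finset.mem_range] at hl ⊢; omega
    · intros; positivity
    · intro l hl; congr 1
  · rw [← Finset.sum_filter]
    refine le_trans ?_ (sum_pow_le h0 h1 n)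
    have : ∀ l ∈ (Finset.range n).filter (fun l => m ≤ l), γ ^ (l - m) = (fun j => γ ^ j) (l - m) :=
      fun _ _ => rfl
    rw [Finset.sum_congr rfl this, ← Finset.sum_image (g := fun l => l - m)
      (f := fun j => γ ^ j)]
    · refine Finset.sum_le_sum_of_subset_of_nonneg ?_ (fun _ _ _ => by positivity)
      intro j hj
      simp only [Finset.mem_image, Finset.mem_filter, Finset.mem_range] at hj ⊢
      obtain ⟨l, hl, rfl⟩ := hj; omega
    · intro a ha b hb hab
      simp only [Finset.coe_filter, Finset.mem_range, Set.mem_ofPred_eq] at ha hb hab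
      omega

end

section

/-! ### Coercivity of the adjoint of the constraint operator -/

section DualBounds

open ContinuousLinearMap (adjoint)

variable {X U : Type*} [NormedAddCommGroup X] [InnerProductSpace ℝ X] [CompleteSpace X]
  [NormedAddCommGroup U] [InnerProductSpace ℝ U] [CompleteSpace U]

/-- The multipliers of the dynamics are bounded by the residuals of the adjoint recursion. For
`χ = 1` the terminal multiplier counts as a residual, for `χ = 0` it does not. -/
def DualBound (A : X →L[ℝ] X) (B : U →L[ℝ] X) (χ M : ℝ) (ℓ : ℕ) : Prop :=
  ∀ p : ℕ → X, ∑ τ ∈ Finset.range (ℓ + 1), ‖p τ‖ ^ 2 ≤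
    M * (χ * ‖p ℓ‖ ^ 2 + ∑ τ ∈ Finset.range ℓ,
      (‖p τ - adjoint A (p (τ + 1))‖ ^ 2 + ‖adjoint B (p (τ + 1))‖ ^ 2))

theorem DualBound.mono {A : X →L[ℝ] X} {B : U →L[ℝ] X} {χ M M' : ℝ} {ℓ : ℕ}
    (h : DualBound A B χ M ℓ) (hχ : 0 ≤ χ) (hM : M ≤ M') : DualBound A B χ M' ℓ := fun p =>
  (h p).trans (mul_le_mul_of_nonneg_right hM
    (add_nonneg (mul_nonneg hχ (sq_nonneg _)) (Finset.sum_nonneg fun _ _ => by positivity)))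

theorem norm_adjoint_le {A : U →L[ℝ] X} {L : ℝ} (h : ‖A‖ ≤ L) (x : X) :
    ‖adjoint A x‖ ≤ L * ‖x‖ :=
  ((adjoint A).le_opNorm x).trans (by rw [LinearIsometryEquiv.norm_map]; gcongr)

theorem norm_adjoint_pow_le {A : X →L[ℝ] X} {c : ℝ} {n : ℕ} (h : ‖A ^ n‖ ≤ c) (x : X) :
    ‖(adjoint A ^ n) x‖ ≤ c * ‖x‖ := by
  have : adjoint A ^ n = adjoint (A ^ n) := by
    rw [← ContinuousLinearMap.star_eq_adjoint, ← ContinuousLinearMap.star_eq_adjoint, star_pow]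
  rw [this]; exact norm_adjoint_le h x

/-- Constant of the dual bound for stabilizable pairs. -/
def stabConst (L γ : ℝ) : ℝ := (L * (1 - γ)⁻¹) ^ 2 * (2 * (1 + L ^ 2))

/-- With `Q` the adjoint of `A - B K`, the multiplier `p τ` equals `Q (p (τ + 1))` plus a
combination of the two residuals at `τ`. Unrolling up to the terminal time bounds `p` by a
convolution of the residuals with the kernel `L * γ ^ j`, to which Schur's test applies. -/
theorem Stabilizable.dualBound {A : X →L[ℝ] X} {B : U →L[ℝ] X} {L γ : ℝ} (hL : 1 ≤ L)
    (hγ0 : 0 ≤ γ) (hγ1 : γ < 1) (h : Stabilizable A B L γ) (ℓ : ℕ) :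
    DualBound A B 1 (stabConst L γ) ℓ := by
  obtain ⟨K, hK, hAK⟩ := h
  intro p
  set a : ℕ → ℝ := fun τ => ‖p τ - adjoint A (p (τ + 1))‖ with ha
  set b : ℕ → ℝ := fun τ => ‖adjoint B (p (τ + 1))‖ with hb
  set c : ℕ → ℝ := fun τ => if τ < ℓ then a τ + L * b τ else ‖p ℓ‖ with hc
  have hc0 : ∀ τ, 0 ≤ c τ := fun τ => by
    simp only [hc]; split_ifs <;> positivity
  set Q := adjoint (A - B ∘L K) with hQ
  have hstep : ∀ τ, ‖p τ - Q (p (τ + 1))‖ ≤ a τ + L * b τ := by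
    intro τ
    have : p τ - Q (p (τ + 1)) = (p τ - adjoint A (p (τ + 1))) + adjoint K (adjoint B (p (τ + 1))) := by
      rw [hQ, map_sub, ContinuousLinearMap.adjoint_comp]; simp; abel
    rw [this]
    exact (norm_add_le _ _).trans (add_le_add le_rfl (norm_adjoint_le hK _))
  -- The induction carries an arbitrary power of `Q` in front. The bound `L * γ ^ m` is available
  -- only for powers as a whole; multiplying one-step bounds would accumulate factors `L`.
  have hpt : ∀ n τ, τ + n = ℓ → ∀ m, ‖(Q ^ m) (p τ)‖ ≤
      ∑ j ∈ Finset.range (n + 1), L * γ ^ (m + j) * c (τ + j) := by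
    intro n
    induction n with
    | zero =>
      intro τ hτ m
      obtain rfl : τ = ℓ := by simpa using hτ
      rw [Finset.sum_range_one]
      simp only [hc, add_zero, lt_irrefl, if_false]
      exact norm_adjoint_pow_le (hAK m) (p τ)
    | succ n ih =>
      intro τ hτ m
      have e : (Q ^ m) (p τ) = (Q ^ m) (p τ - Q (p (τ + 1))) + (Q ^ (m + 1)) (p (τ + 1)) := by
        rw [pow_succ, map_sub]; simp
      rw [e, Finset.sum_range_succ']
      refine (norm_add_le _ _).trans ?_
      rw [add_comm]
      refine add_le_add ?_ ?_
      · refine (ih (τ + 1) (by omega) (m + 1)).trans (le_of_eq (Finset.sum_congr rfl fun j _ => ?_))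
        rw [show m + 1 + j = m + (j + 1) by ring, show τ + 1 + j = τ + (j + 1) by ring]
      · refine (norm_adjoint_pow_le (hAK m) _).trans ?_
        have h0 : c (τ + 0) = a τ + L * b τ := by simp only [hc, add_zero]; rw [if_pos (by omega)]
        rw [h0, add_zero]
        exact mul_le_mul_of_nonneg_left (hstep τ) (by positivity)
  have hker : ∀ τ ∈ Finset.range (ℓ + 1), ‖p τ‖ ≤ ∑ n ∈ Finset.range (ℓ + 1),
      (if τ ≤ n then L * γ ^ (n - τ) else 0) * c n := by
    intro τ hτ
    rw [Finset.mem_range] at hτ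
    have h1 := hpt (ℓ - τ) τ (by omega) 0
    simp only [pow_zero, one_apply_eq_self, zero_add] at h1
    refine h1.trans ?_
    simp_rw [ite_mul, zero_mul]
    rw [← Finset.sum_filter]
    have : ∀ j ∈ Finset.range (ℓ - τ + 1), L * γ ^ j * c (τ + j) =
        (fun n => L * γ ^ (n - τ) * c n) (τ + j) := fun j _ => by simp
    rw [Finset.sum_congr rfl this, ← Finset.sum_image (g := fun j => τ + j)
      (f := fun n => L * γ ^ (n - τ) * c n) (fun _ _ _ _ h => by simpa using h)]
    refine Finset.sum_le_sum_of_subset_of_nonneg ?_ (fun n _ _ => ?_)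
    · intro n hn
      simp only [Finset.mem_image, Finset.mem_filter, Finset.mem_range] at hn ⊢
      obtain ⟨j, hj, rfl⟩ := hn; omega
    · have := hc0 n; positivity
  have hrow : ∀ τ ∈ Finset.range (ℓ + 1), ∑ n ∈ Finset.range (ℓ + 1),
      (if τ ≤ n then L * γ ^ (n - τ) else 0) ≤ L * (1 - γ)⁻¹ := by
    intro τ hτ
    rw [← Finset.sum_filter, ← Finset.mul_sum]
    refine mul_le_mul_of_nonneg_left ?_ (by linarith)
    refine le_trans ?_ (sum_pow_le hγ0 hγ1 (ℓ + 1))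
    rw [show ∑ i ∈ (Finset.range (ℓ + 1)).filter (fun n => τ ≤ n), γ ^ (i - τ) =
      ∑ j ∈ ((Finset.range (ℓ + 1)).filter (fun n => τ ≤ n)).image (fun n => n - τ), γ ^ j from ?_]
    · refine Finset.sum_le_sum_of_subset_of_nonneg ?_ (fun _ _ _ => by positivity)
      intro j hj
      simp only [Finset.mem_image, Finset.mem_filter, Finset.mem_range] at hj ⊢
      obtain ⟨n, hn, rfl⟩ := hj; omega
    · rw [Finset.sum_image]
      intro x hx y hy hxy
      simp only [Finset.coe_filter, Finset.mem_range, Set.mem_ofPred_eq] at hx hy hxy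
      omega
  have hcol : ∀ n ∈ Finset.range (ℓ + 1), ∑ τ ∈ Finset.range (ℓ + 1),
      (if τ ≤ n then L * γ ^ (n - τ) else 0) ≤ L * (1 - γ)⁻¹ := by
    intro n hn
    rw [← Finset.sum_filter, ← Finset.mul_sum]
    refine mul_le_mul_of_nonneg_left ?_ (by linarith)
    refine le_trans ?_ (sum_pow_le hγ0 hγ1 (ℓ + 1))
    rw [show ∑ i ∈ (Finset.range (ℓ + 1)).filter (fun τ => τ ≤ n), γ ^ (n - i) =
      ∑ j ∈ ((Finset.range (ℓ + 1)).filter (fun τ => τ ≤ n)).image (fun τ => n - τ), γ ^ j from ?_]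
    · refine Finset.sum_le_sum_of_subset_of_nonneg ?_ (fun _ _ _ => by positivity)
      intro j hj
      simp only [Finset.mem_image, Finset.mem_filter, Finset.mem_range] at hj hn ⊢
      obtain ⟨τ, hτ, rfl⟩ := hj; omega
    · rw [Finset.sum_image]
      intro x hx y hy hxy
      simp only [Finset.coe_filter, Finset.mem_range, Set.mem_ofPred_eq] at hx hy hxy
      omega
  have hγ' : 0 < (1 - γ)⁻¹ := inv_pos.2 (by linarith)
  calc ∑ τ ∈ Finset.range (ℓ + 1), ‖p τ‖ ^ 2
      ≤ ∑ τ ∈ Finset.range (ℓ + 1), (∑ n ∈ Finset.range (ℓ + 1),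
          (if τ ≤ n then L * γ ^ (n - τ) else 0) * c n) ^ 2 :=
        Finset.sum_le_sum fun τ hτ => pow_le_pow_left₀ (norm_nonneg _) (hker τ hτ) 2
    _ ≤ L * (1 - γ)⁻¹ * (L * (1 - γ)⁻¹) * ∑ n ∈ Finset.range (ℓ + 1), c n ^ 2 :=
        schur_sum_sq_le _ _ _ c (fun i j => by split_ifs <;> positivity) (by positivity) hrow hcol
    _ ≤ L * (1 - γ)⁻¹ * (L * (1 - γ)⁻¹) * ((2 * (1 + L ^ 2)) * (1 * ‖p ℓ‖ ^ 2 +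
          ∑ τ ∈ Finset.range ℓ, (a τ ^ 2 + b τ ^ 2))) := by
        refine mul_le_mul_of_nonneg_left ?_ (by positivity)
        rw [Finset.sum_range_succ, mul_add, add_comm, Finset.mul_sum]
        refine add_le_add ?_ (Finset.sum_le_sum fun τ hτ => ?_)
        · simp only [hc, lt_irrefl, if_false]
          nlinarith [sq_nonneg ‖p ℓ‖, sq_nonneg (L * ‖p ℓ‖)]
        · simp only [hc, if_pos (Finset.mem_range.1 hτ)]
          nlinarith [sq_add_le_two_mul (a τ) (L * b τ), sq_nonneg (L * a τ), sq_nonneg (b τ)]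
    _ = _ := by rw [stabConst]; ring

theorem adjoint_ctrlMap_apply (A : X →L[ℝ] X) (B : U →L[ℝ] X) (d : ℕ) (z : X) (j : Fin d) :
    adjoint (ctrlMap A B d) z j = adjoint B ((adjoint A ^ (j : ℕ)) z) := by
  classical
  refine ext_inner_left ℝ fun w => ?_
  have h1 : inner ℝ w (adjoint (ctrlMap A B d) z j) =
      inner ℝ (PiLp.single 2 j w : PiLp 2 (fun _ : Fin d => U)) (adjoint (ctrlMap A B d) z) := by
    rw [PiLp.inner_apply, Finset.sum_eq_single j]
    · simp
    · intro i _ hi; simp [hi]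
    · simp
  have h2 : ctrlMap A B d (PiLp.single 2 j w : PiLp 2 (fun _ : Fin d => U)) =
      (A ^ (j : ℕ)) (B w) := by
    simp only [ctrlMap, sum_apply, ContinuousLinearMap.comp_apply]
    rw [Finset.sum_eq_single j]
    · simp
    · intro i _ hi; simp [hi]
    · simp
  have h3 : adjoint A ^ (j : ℕ) = adjoint (A ^ (j : ℕ)) := by
    rw [← ContinuousLinearMap.star_eq_adjoint, ← ContinuousLinearMap.star_eq_adjoint, star_pow]
  rw [h1, ContinuousLinearMap.adjoint_inner_right, h2, ContinuousLinearMap.adjoint_inner_right, h3,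
    ContinuousLinearMap.adjoint_inner_right]

theorem norm_adjoint_ctrlMap_sq (A : X →L[ℝ] X) (B : U →L[ℝ] X) (d : ℕ) (z : X) :
    ‖adjoint (ctrlMap A B d) z‖ ^ 2 =
      ∑ j ∈ Finset.range d, ‖adjoint B ((adjoint A ^ j) z)‖ ^ 2 := by
  rw [PiLp.norm_sq_eq_of_L2, Finset.sum_range]
  exact Finset.sum_congr rfl fun j _ => by rw [adjoint_ctrlMap_apply]

/-- Pointwise constant of the dual bound for controllable pairs. -/
def ctrlPointConst (L σ : ℝ) (d : ℕ) : ℝ := L ^ d * (d * L ^ (d + 1) / σ) + L ^ d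

/-- Constant of the dual bounds for controllable pairs. -/
def ctrlConst (L σ : ℝ) (d : ℕ) : ℝ :=
  ctrlPointConst L σ d ^ 2 * (d * (2 * d + 1)) * 2

/-- A telescoping sum of one-step residuals; since `1 ≤ L`, all powers of `A` that occur are bounded
by `L ^ n`. -/
theorem norm_sub_adjoint_pow_le {A : X →L[ℝ] X} {L : ℝ} (hL : 1 ≤ L) (hA : ‖A‖ ≤ L) (p : ℕ → X)
    (n s : ℕ) : ‖p s - (adjoint A ^ n) (p (s + n))‖ ≤
      L ^ n * ∑ i ∈ Finset.range n, ‖p (s + i) - adjoint A (p (s + i + 1))‖ := by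
  induction n with
  | zero => simp
  | succ n ih =>
    have e : p s - (adjoint A ^ (n + 1)) (p (s + (n + 1))) = (p s - (adjoint A ^ n) (p (s + n)))
        + (adjoint A ^ n) (p (s + n) - adjoint A (p (s + n + 1))) := by
      rw [pow_succ, map_sub, ← add_assoc s n 1]; simp
    have hAn : ‖A ^ n‖ ≤ L ^ n := by
      cases n with
      | zero => rw [pow_zero, pow_zero]; exact ContinuousLinearMap.norm_id_le
      | succ n => exact (norm_pow_le' A (Nat.succ_pos n)).trans (pow_le_pow_left₀ (norm_nonneg _) hA _)
    rw [e, Finset.sum_range_succ]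
    refine (norm_add_le _ _).trans ?_
    have h2 := norm_adjoint_pow_le hAn (p (s + n) - adjoint A (p (s + n + 1)))
    have h3 : L ^ n ≤ L ^ (n + 1) := pow_le_pow_right₀ hL (Nat.le_succ n)
    rw [mul_add]
    refine add_le_add (ih.trans ?_) (h2.trans ?_)
    · exact mul_le_mul_of_nonneg_right h3 (Finset.sum_nonneg fun _ _ => norm_nonneg _)
    · exact mul_le_mul_of_nonneg_right h3 (norm_nonneg _)

/-- Controllability bounds `p e` by the vectors `B* (A*)^j (p e)` with `j < d`. Here `(A*)^j (p e)`
differs from `p (e - j)` by residuals of the recursion, and `B* (p (e - j))` is itself a residual.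
So `p e` is controlled by a window of `d` residuals, without any information on the terminal
multiplier. -/
theorem dualBound_zero_of_controllable {A : X →L[ℝ] X} {B : U →L[ℝ] X} {L σ : ℝ} {d : ℕ}
    (hL : 1 ≤ L) (hσ : 0 < σ) (hA : ‖A‖ ≤ L) (hB : ‖B‖ ≤ L)
    (hC : ∀ z, σ * ‖z‖ ≤ ‖adjoint (ctrlMap A B d) z‖) {ℓ : ℕ} (hℓ : d ≤ ℓ) :
    DualBound A B 0 (ctrlConst L σ d) ℓ := by
  intro p
  have hL0 : 0 < L := by linarith
  set a : ℕ → ℝ := fun τ => ‖p τ - adjoint A (p (τ + 1))‖ with ha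
  set b : ℕ → ℝ := fun τ => ‖adjoint B (p (τ + 1))‖ with hb
  have ha0 : ∀ τ, 0 ≤ a τ := fun τ => norm_nonneg _
  have hb0 : ∀ τ, 0 ≤ b τ := fun τ => norm_nonneg _
  have hcol : ∀ e, d ≤ e → ‖p e‖ ≤ (d * L ^ (d + 1) / σ) *
      ∑ i ∈ Finset.range d, (a (e - d + i) + b (e - d + i)) := by
    intro e he
    set S := ∑ i ∈ Finset.range d, (a (e - d + i) + b (e - d + i)) with hS
    have hS0 : 0 ≤ S := Finset.sum_nonneg fun i _ => add_nonneg (ha0 _) (hb0 _)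
    have hj : ∀ j ∈ Finset.range d, ‖adjoint B ((adjoint A ^ j) (p e))‖ ≤ L ^ (d + 1) * S := by
      intro j hj
      rw [Finset.mem_range] at hj
      have h1 := norm_sub_adjoint_pow_le hL hA p j (e - j)
      rw [Nat.sub_add_cancel (by omega)] at h1
      have h2 : adjoint B ((adjoint A ^ j) (p e)) =
          adjoint B (p (e - j)) - adjoint B (p (e - j) - (adjoint A ^ j) (p e)) := by
        rw [map_sub]; abel
      have h3 : ‖adjoint B (p (e - j))‖ = b (e - d + (d - j - 1)) := by
        simp only [hb]; congr 3; omega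
      have h4 := norm_adjoint_le hB (p (e - j) - (adjoint A ^ j) (p e))
      have h5 : ∑ i ∈ Finset.range j, ‖p (e - j + i) - adjoint A (p (e - j + i + 1))‖ ≤
          ∑ i ∈ Finset.range d, a (e - d + i) := by
        have : ∀ i ∈ Finset.range j, ‖p (e - j + i) - adjoint A (p (e - j + i + 1))‖ =
            (fun i => a (e - d + i)) (d - j + i) := by
          intro i _; simp only [ha]; rw [show e - d + (d - j + i) = e - j + i by omega]
        rw [Finset.sum_congr rfl this, ← Finset.sum_image (g := fun i => d - j + i)
          (f := fun i => a (e - d + i)) (fun _ _ _ _ h => by simpa using h)]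
        refine Finset.sum_le_sum_of_subset_of_nonneg ?_ (fun _ _ _ => ha0 _)
        intro i hi
        simp only [Finset.mem_image, Finset.mem_range] at hi ⊢
        obtain ⟨i', h', rfl⟩ := hi; omega
      have h6 : b (e - d + (d - j - 1)) ≤ ∑ i ∈ Finset.range d, b (e - d + i) :=
        Finset.single_le_sum (f := fun i => b (e - d + i)) (fun _ _ => hb0 _)
          (Finset.mem_range.2 (by omega))
      have h7 : L ^ j ≤ L ^ d := pow_le_pow_right₀ hL hj.le
      have h8 : 0 ≤ ∑ i ∈ Finset.range d, a (e - d + i) := Finset.sum_nonneg fun _ _ => ha0 _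
      have h9 : 0 ≤ ∑ i ∈ Finset.range d, b (e - d + i) := Finset.sum_nonneg fun _ _ => hb0 _
      have h10 : (1 : ℝ) ≤ L ^ (d + 1) := one_le_pow₀ hL
      rw [h2]
      refine (norm_sub_le _ _).trans ?_
      rw [h3, hS, Finset.sum_add_distrib, mul_add, add_comm]
      refine add_le_add (h4.trans ?_) ?_
      · calc L * ‖p (e - j) - (adjoint A ^ j) (p e)‖
            ≤ L * (L ^ d * ∑ i ∈ Finset.range d, a (e - d + i)) :=
              mul_le_mul_of_nonneg_left (h1.trans (mul_le_mul h7 h5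
                (Finset.sum_nonneg fun _ _ => norm_nonneg _) (by positivity))) hL0.le
          _ = _ := by ring
      · nlinarith
    have h1 : ‖adjoint (ctrlMap A B d) (p e)‖ ≤ d * (L ^ (d + 1) * S) := by
      refine abs_le_of_sq_le_sq' ?_ (by positivity) |>.2
      rw [norm_adjoint_ctrlMap_sq]
      calc ∑ j ∈ Finset.range d, ‖adjoint B ((adjoint A ^ j) (p e))‖ ^ 2
          ≤ ∑ j ∈ Finset.range d, (L ^ (d + 1) * S) ^ 2 :=
            Finset.sum_le_sum fun j hj' => pow_le_pow_left₀ (norm_nonneg _) (hj j hj') 2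
        _ = d * (L ^ (d + 1) * S) ^ 2 := by simp
        _ ≤ (d : ℝ) ^ 2 * (L ^ (d + 1) * S) ^ 2 := by
            refine mul_le_mul_of_nonneg_right ?_ (sq_nonneg _)
            exact_mod_cast Nat.le_self_pow (by norm_num) d
        _ = _ := by ring
    have h2 := (hC (p e)).trans h1
    rw [div_mul_eq_mul_div, le_div_iff₀ hσ]
    linarith
  -- For `τ < d` there is no full window to the left of `τ`. There `p τ` is compared with `p d`
  -- through `d - τ` steps of the recursion, and the first window is used; hence `max τ d`.
  have hpt : ∀ τ ∈ Finset.range (ℓ + 1), ‖p τ‖ ≤ ctrlPointConst L σ d *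
      ∑ i ∈ Finset.range d, (a (max τ d - d + i) + b (max τ d - d + i)) := by
    intro τ hτ
    have hc := hcol (max τ d) (le_max_right _ _)
    set S := ∑ i ∈ Finset.range d, (a (max τ d - d + i) + b (max τ d - d + i)) with hS
    have hS0 : 0 ≤ S := Finset.sum_nonneg fun i _ => add_nonneg (ha0 _) (hb0 _)
    have hLd : (1 : ℝ) ≤ L ^ d := one_le_pow₀ hL
    have hk0 : 0 ≤ d * L ^ (d + 1) / σ * S := by positivity
    rcases le_total d τ with h | h
    · rw [max_eq_left h] at hc
      rw [ctrlPointConst]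
      nlinarith
    · rw [max_eq_right h] at hc
      have h1 := norm_sub_adjoint_pow_le hL hA p (d - τ) τ
      rw [Nat.add_sub_cancel' h] at h1
      have hAn : ‖A ^ (d - τ)‖ ≤ L ^ d := by
        refine le_trans ?_ (pow_le_pow_right₀ hL (Nat.sub_le d τ))
        rcases Nat.eq_zero_or_pos (d - τ) with h0 | h0
        · rw [h0, pow_zero, pow_zero]; exact ContinuousLinearMap.norm_id_le
        · exact (norm_pow_le' A h0).trans (pow_le_pow_left₀ (norm_nonneg _) hA _)
      have h2 := norm_adjoint_pow_le hAn (p d)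
      have h3 : ‖p τ‖ ≤ ‖p τ - (adjoint A ^ (d - τ)) (p d)‖ + ‖(adjoint A ^ (d - τ)) (p d)‖ := by
        simpa using norm_add_le (p τ - (adjoint A ^ (d - τ)) (p d)) ((adjoint A ^ (d - τ)) (p d))
      have h4 : ∑ i ∈ Finset.range (d - τ), ‖p (τ + i) - adjoint A (p (τ + i + 1))‖ ≤ S := by
        have : ∀ i ∈ Finset.range (d - τ), ‖p (τ + i) - adjoint A (p (τ + i + 1))‖ =
            a (τ + i) := fun i _ => rfl
        rw [Finset.sum_congr rfl this, ← Finset.sum_image (g := fun i => τ + i)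
          (f := a) (fun _ _ _ _ h => by simpa using h)]
        refine (Finset.sum_le_sum_of_subset_of_nonneg (t := Finset.range d) ?_
          (fun _ _ _ => ha0 _)).trans (Finset.sum_le_sum fun i _ => ?_)
        · intro i hi
          simp only [Finset.mem_image, Finset.mem_range] at hi ⊢
          obtain ⟨i', h', rfl⟩ := hi; omega
        · rw [max_eq_right h, Nat.sub_self, zero_add]; linarith [hb0 i]
      have h5 : L ^ (d - τ) * ∑ i ∈ Finset.range (d - τ), ‖p (τ + i) - adjoint A (p (τ + i + 1))‖ ≤
          L ^ d * S := mul_le_mul (pow_le_pow_right₀ hL (Nat.sub_le d τ)) h4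
        (Finset.sum_nonneg fun _ _ => norm_nonneg _) (by positivity)
      have h6 : L ^ d * ‖p d‖ ≤ L ^ d * (d * L ^ (d + 1) / σ * S) :=
        mul_le_mul_of_nonneg_left hc (by positivity)
      rw [ctrlPointConst]
      linarith
  set c : ℕ → ℝ := fun i => a i + b i with hcdef
  have hker : ∀ τ ∈ Finset.range (ℓ + 1), ‖p τ‖ ≤ ∑ n ∈ Finset.range ℓ,
      (if max τ d - d ≤ n ∧ n < max τ d then ctrlPointConst L σ d else 0) * c n := by
    intro τ hτ
    refine (hpt τ hτ).trans (le_of_eq ?_)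
    simp_rw [ite_mul, zero_mul]
    rw [← Finset.sum_filter, ← Finset.mul_sum]
    congr 1
    have : ∀ i ∈ Finset.range d, a (max τ d - d + i) + b (max τ d - d + i) =
      c (max τ d - d + i) := fun _ _ => rfl
    rw [Finset.sum_congr rfl this, ← Finset.sum_image (g := fun i => max τ d - d + i)
          (f := c) (fun _ _ _ _ h => by simpa using h)]
    refine Finset.sum_congr ?_ fun _ _ => rfl
    rw [Finset.mem_range] at hτ
    ext n
    simp only [Finset.mem_image, Finset.mem_filter, Finset.mem_range]
    constructor
    · rintro ⟨i, hi, rfl⟩; omega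
    · rintro ⟨h1, h2, h3⟩; exact ⟨n - (max τ d - d), by omega, by omega⟩
  have hk0 : 0 ≤ ctrlPointConst L σ d := by rw [ctrlPointConst]; positivity
  have hrow : ∀ τ ∈ Finset.range (ℓ + 1), ∑ n ∈ Finset.range ℓ,
      (if max τ d - d ≤ n ∧ n < max τ d then ctrlPointConst L σ d else 0) ≤
        ctrlPointConst L σ d * d := by
    intro τ _
    rw [← Finset.sum_filter, Finset.sum_const, nsmul_eq_mul, mul_comm]
    refine mul_le_mul_of_nonneg_left ?_ hk0
    have : ((Finset.range ℓ).filter fun n => max τ d - d ≤ n ∧ n < max τ d) ⊆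
        Finset.Ico (max τ d - d) (max τ d) := by
      intro n; simp only [Finset.mem_filter, Finset.mem_Ico]; tauto
    have h := Finset.card_le_card this
    rw [Nat.card_Ico, Nat.sub_sub_self (le_max_right _ _)] at h
    exact_mod_cast h
  have hcol' : ∀ n ∈ Finset.range ℓ, ∑ τ ∈ Finset.range (ℓ + 1),
      (if max τ d - d ≤ n ∧ n < max τ d then ctrlPointConst L σ d else 0) ≤
        ctrlPointConst L σ d * (2 * d + 1) := by
    intro n _
    rw [← Finset.sum_filter, Finset.sum_const, nsmul_eq_mul, mul_comm]
    refine mul_le_mul_of_nonneg_left ?_ hk0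
    -- The index `n` lies in the windows of the `τ` with `n < τ ≤ n + d` and, if `n < d`, also in
    -- the window shared by all `τ < d`.
    have : ((Finset.range (ℓ + 1)).filter fun τ => max τ d - d ≤ n ∧ n < max τ d) ⊆
        Finset.Icc (n - d) (n + d) := by
      intro τ; simp only [Finset.mem_filter, Finset.mem_Icc]; omega
    have h := Finset.card_le_card this
    rw [Nat.card_Icc] at h
    have h2 : n + d + 1 - (n - d) ≤ 2 * d + 1 := by omega
    exact_mod_cast h.trans h2
  calc ∑ τ ∈ Finset.range (ℓ + 1), ‖p τ‖ ^ 2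
      ≤ ∑ τ ∈ Finset.range (ℓ + 1), (∑ n ∈ Finset.range ℓ,
          (if max τ d - d ≤ n ∧ n < max τ d then ctrlPointConst L σ d else 0) * c n) ^ 2 :=
        Finset.sum_le_sum fun τ hτ => pow_le_pow_left₀ (norm_nonneg _) (hker τ hτ) 2
    _ ≤ ctrlPointConst L σ d * d * (ctrlPointConst L σ d * (2 * d + 1)) *
          ∑ n ∈ Finset.range ℓ, c n ^ 2 :=
        schur_sum_sq_le _ _ _ c (fun i j => by split_ifs <;> positivity) (by positivity) hrow hcol'
    _ ≤ ctrlPointConst L σ d * d * (ctrlPointConst L σ d * (2 * d + 1)) * (2 * (0 * ‖p ℓ‖ ^ 2 +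
          ∑ τ ∈ Finset.range ℓ, (a τ ^ 2 + b τ ^ 2))) := by
        refine mul_le_mul_of_nonneg_left ?_ (by positivity)
        rw [zero_mul, zero_add, Finset.mul_sum]
        exact Finset.sum_le_sum fun τ hτ => sq_add_le_two_mul _ _
    _ = _ := by rw [ctrlConst]; ring

/-- Continue the multipliers by zero beyond `ℓ`. The only new residual is `p ℓ` itself, at time `ℓ`.
The additional steps make the horizon at least `d`, so that no lower bound on `ℓ` is needed for `χ =
1`. -/
theorem dualBound_one_of_zero {A : X →L[ℝ] X} {B : U →L[ℝ] X} {M : ℝ} {d ℓ : ℕ}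
    (h : DualBound A B 0 M (ℓ + 1 + d)) : DualBound A B 1 M ℓ := by
  intro p
  have h1 := h (fun τ => if τ ≤ ℓ then p τ else 0)
  rw [show ℓ + 1 + d + 1 = (ℓ + 1) + (d + 1) by ring, Finset.sum_range_add _ (ℓ + 1) (d + 1),
    Finset.sum_range_add _ (ℓ + 1) d] at h1
  have e1 : ∀ x ∈ Finset.range ℓ, ‖(if x ≤ ℓ then p x else 0) -
      adjoint A (if x + 1 ≤ ℓ then p (x + 1) else 0)‖ ^ 2 +
      ‖adjoint B (if x + 1 ≤ ℓ then p (x + 1) else 0)‖ ^ 2 =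
      ‖p x - adjoint A (p (x + 1))‖ ^ 2 + ‖adjoint B (p (x + 1))‖ ^ 2 := by
    intro x hx
    rw [Finset.mem_range] at hx
    rw [if_pos hx.le, if_pos (by omega)]
  have e2 : ∀ x ∈ Finset.range (ℓ + 1), ‖(if x ≤ ℓ then p x else 0)‖ ^ 2 = ‖p x‖ ^ 2 := by
    intro x hx
    rw [Finset.mem_range] at hx
    rw [if_pos (by omega)]
  rw [Finset.sum_congr rfl e2] at h1
  generalize ∑ x ∈ Finset.range (ℓ + 1), ‖p x‖ ^ 2 = S at h1 ⊢
  rw [Finset.sum_range_succ _ ℓ, Finset.sum_congr rfl e1] at h1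
  simpa [add_comm, add_left_comm] using h1

end DualBounds

end

section

/-! ### Energy estimates for linear-monotone optimality systems -/

section Energy

open ContinuousLinearMap (adjoint)

variable {X U : Type*} [NormedAddCommGroup X] [InnerProductSpace ℝ X] [CompleteSpace X]
  [NormedAddCommGroup U] [InnerProductSpace ℝ U] [CompleteSpace U]

/-- Bound for the primal energy. -/
def primalConst (μ L M : ℝ) : ℝ := 8 * M * L ^ 2 / μ ^ 2 + 2 / μ ^ 2 + 1 / (2 * L ^ 2)

/-- Bound for the primal and dual energy. -/
def kktConst (μ L M : ℝ) : ℝ := primalConst μ L M + 2 * M * L ^ 2 * primalConst μ L M + 2 * M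

theorem primalConst_pos {μ L M : ℝ} (hμ : 0 < μ) (hL : 0 < L) (hM : 0 < M) :
    0 < primalConst μ L M := by rw [primalConst]; positivity

theorem kktConst_pos {μ L M : ℝ} (hμ : 0 < μ) (hL : 0 < L) (hM : 0 < M) :
    0 < kktConst μ L M := by
  have := primalConst_pos hμ hL hM
  rw [kktConst]; positivity

/-- `E` stands for the primal energy, `P` for the dual one, `R` and `Q` for the data. The factor `μ
/ (8 * M * L ^ 2)` is such that inserting `hP` turns the term in `P` into `μ / 4 * E` plus data;
together with the other `μ / 4 * E`, half of `μ * E` is left. -/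
theorem energy_le_of_le {μ L M E P R Q : ℝ} (hμ : 0 < μ) (hL : 0 < L) (hM : 0 < M)
    (hR : 0 ≤ R) (hQ : 0 ≤ Q) (hP : P ≤ 2 * M * (L ^ 2 * E + Q))
    (hE : μ * E ≤ μ / (8 * M * L ^ 2) * P + 4 * M * L ^ 2 / μ * R + μ / 4 * E + Q / μ) :
    E + P ≤ kktConst μ L M * (R + Q) := by
  have h1 : μ / (8 * M * L ^ 2) * P ≤ μ / 4 * E + μ / (4 * L ^ 2) * Q := by
    calc μ / (8 * M * L ^ 2) * P ≤ μ / (8 * M * L ^ 2) * (2 * M * (L ^ 2 * E + Q)) := by gcongr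
      _ = _ := by field_simp; ring
  have h2 : μ / 2 * E ≤ 4 * M * L ^ 2 / μ * R + (1 / μ + μ / (4 * L ^ 2)) * Q := by
    have : Q / μ = 1 / μ * Q := by ring
    linarith
  have h3 : E ≤ 8 * M * L ^ 2 / μ ^ 2 * R + (2 / μ ^ 2 + 1 / (2 * L ^ 2)) * Q := by
    have : E = 2 / μ * (μ / 2 * E) := by field_simp
    rw [this]
    calc 2 / μ * (μ / 2 * E) ≤ 2 / μ * (4 * M * L ^ 2 / μ * R + (1 / μ + μ / (4 * L ^ 2)) * Q) := by
          gcongr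
      _ = _ := by field_simp; ring
  have h4 : E ≤ primalConst μ L M * (R + Q) := by
    have a1 : 0 ≤ 8 * M * L ^ 2 / μ ^ 2 * Q := by positivity
    have a2 : 0 ≤ (2 / μ ^ 2 + 1 / (2 * L ^ 2)) * R := by positivity
    rw [primalConst]; linarith
  have h5 : P ≤ 2 * M * L ^ 2 * (primalConst μ L M * (R + Q)) + 2 * M * (R + Q) := by
    have a1 : 2 * M * L ^ 2 * E ≤ 2 * M * L ^ 2 * (primalConst μ L M * (R + Q)) := by gcongr
    have a2 : 0 ≤ 2 * M * R := by positivity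
    linarith
  rw [kktConst]; linarith

theorem inner_le_amgm {a : ℝ} (ha : 0 < a) {E : Type*} [NormedAddCommGroup E]
    [InnerProductSpace ℝ E] (x y : E) :
    inner ℝ x y ≤ a / 2 * ‖x‖ ^ 2 + 1 / (2 * a) * ‖y‖ ^ 2 := by
  have h := real_inner_le_norm x y
  have h2 : ‖x‖ * ‖y‖ ≤ a / 2 * ‖x‖ ^ 2 + 1 / (2 * a) * ‖y‖ ^ 2 := by
    have : a / 2 * ‖x‖ ^ 2 + 1 / (2 * a) * ‖y‖ ^ 2 - ‖x‖ * ‖y‖ =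
        1 / (2 * a) * (a * ‖x‖ - ‖y‖) ^ 2 := by field_simp; ring
    have h3 : 0 ≤ 1 / (2 * a) * (a * ‖x‖ - ‖y‖) ^ 2 := by positivity
    linarith
  exact h.trans h2

/-- Summation by parts: the operators `A` and `B` cancel between the dynamics and the adjoint
equations, and the pairings of `p` with `y` telescope. -/
theorem sum_inner_eq (A : X →L[ℝ] X) (B : U →L[ℝ] X) {ℓ : ℕ} {y a r p : ℕ → X} {v b : ℕ → U}
    (hy : ∀ τ < ℓ, y (τ + 1) = A (y τ) + B (v τ) + r τ)
    (hp : ∀ τ < ℓ, p τ = adjoint A (p (τ + 1)) + a τ)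
    (hv : ∀ τ < ℓ, adjoint B (p (τ + 1)) + b τ = 0) :
    ∑ τ ∈ Finset.range ℓ, (inner ℝ (a τ) (y τ) + inner ℝ (b τ) (v τ)) =
      inner ℝ (p 0) (y 0) - inner ℝ (p ℓ) (y ℓ) + ∑ τ ∈ Finset.range ℓ, inner ℝ (p (τ + 1)) (r τ) := by
  rw [← Finset.sum_range_sub' (fun τ => inner ℝ (p τ) (y τ)), ← Finset.sum_add_distrib]
  refine Finset.sum_congr rfl fun τ hτ => ?_
  rw [Finset.mem_range] at hτ
  have h1 : a τ = p τ - adjoint A (p (τ + 1)) := by rw [hp τ hτ]; abel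
  have h2 : b τ = - adjoint B (p (τ + 1)) := (neg_eq_of_add_eq_zero_right (hv τ hτ)).symm
  rw [h1, h2, hy τ hτ, inner_sub_left, inner_neg_left, ContinuousLinearMap.adjoint_inner_left,
    ContinuousLinearMap.adjoint_inner_left, inner_add_right, inner_add_right]
  ring

/-- `g` and `h` play the role of differences of gradients; `r`, `q`, `s` are perturbations of the
dynamics, of the adjoint recursion and of stationarity. The terminal condition enters only through
`hend`, which covers both a given terminal gradient and a given terminal state. -/
theorem kkt_energy_le {A : X →L[ℝ] X} {B : U →L[ℝ] X} {μ L M b : ℝ} {ℓ : ℕ}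
    {y g q r p : ℕ → X} {v h s : ℕ → U} (hμ : 0 < μ) (hL : 0 < L) (hM : 0 < M)
    (hy : ∀ τ < ℓ, y (τ + 1) = A (y τ) + B (v τ) + r τ)
    (hp : ∀ τ < ℓ, p τ = adjoint A (p (τ + 1)) + (g τ + q τ))
    (hv : ∀ τ < ℓ, adjoint B (p (τ + 1)) + (h τ + s τ) = 0)
    (hg : ∀ τ ≤ ℓ, μ * ‖y τ‖ ^ 2 ≤ inner ℝ (g τ) (y τ)) (hgL : ∀ τ ≤ ℓ, ‖g τ‖ ≤ L * ‖y τ‖)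
    (hh : ∀ τ < ℓ, μ * ‖v τ‖ ^ 2 ≤ inner ℝ (h τ) (v τ)) (hhL : ∀ τ < ℓ, ‖h τ‖ ≤ L * ‖v τ‖)
    (hP : ∑ τ ∈ Finset.range (ℓ + 1), ‖p τ‖ ^ 2 ≤ M * (∑ τ ∈ Finset.range (ℓ + 1), ‖g τ + q τ‖ ^ 2 +
      ∑ τ ∈ Finset.range ℓ, ‖h τ + s τ‖ ^ 2))
    (hend : - inner ℝ (p ℓ - (g ℓ + q ℓ)) (y ℓ) ≤ ‖p ℓ‖ * b) :
    ∑ τ ∈ Finset.range (ℓ + 1), ‖y τ‖ ^ 2 + ∑ τ ∈ Finset.range ℓ, ‖v τ‖ ^ 2 +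
        ∑ τ ∈ Finset.range (ℓ + 1), ‖p τ‖ ^ 2 ≤
      kktConst μ L M * ((‖y 0‖ ^ 2 + b ^ 2 + ∑ τ ∈ Finset.range ℓ, ‖r τ‖ ^ 2) +
        (∑ τ ∈ Finset.range (ℓ + 1), ‖q τ‖ ^ 2 + ∑ τ ∈ Finset.range ℓ, ‖s τ‖ ^ 2)) := by
  set P := ∑ τ ∈ Finset.range (ℓ + 1), ‖p τ‖ ^ 2 with hPdef
  have hid := sum_inner_eq A B hy hp hv
  refine energy_le_of_le hμ hL hM (by positivity) (by positivity) ?_ ?_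
  · refine hP.trans ?_
    rw [mul_comm 2 M, mul_assoc]
    refine mul_le_mul_of_nonneg_left ?_ hM.le
    have h1 : ∑ τ ∈ Finset.range (ℓ + 1), ‖g τ + q τ‖ ^ 2 ≤
        2 * (L ^ 2 * ∑ τ ∈ Finset.range (ℓ + 1), ‖y τ‖ ^ 2 + ∑ τ ∈ Finset.range (ℓ + 1), ‖q τ‖ ^ 2) := by
      rw [Finset.mul_sum, ← Finset.sum_add_distrib, Finset.mul_sum]
      refine Finset.sum_le_sum fun τ hτ => (norm_add_sq_le_two_mul _ _).trans ?_
      have := pow_le_pow_left₀ (norm_nonneg _) (hgL τ (Nat.lt_succ_iff.1 (Finset.mem_range.1 hτ))) 2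
      rw [mul_pow] at this
      linarith
    have h2 : ∑ τ ∈ Finset.range ℓ, ‖h τ + s τ‖ ^ 2 ≤
        2 * (L ^ 2 * ∑ τ ∈ Finset.range ℓ, ‖v τ‖ ^ 2 + ∑ τ ∈ Finset.range ℓ, ‖s τ‖ ^ 2) := by
      rw [Finset.mul_sum, ← Finset.sum_add_distrib, Finset.mul_sum]
      refine Finset.sum_le_sum fun τ hτ => (norm_add_sq_le_two_mul _ _).trans ?_
      have := pow_le_pow_left₀ (norm_nonneg _) (hhL τ (Finset.mem_range.1 hτ)) 2
      rw [mul_pow] at this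
      linarith
    linarith
  · set a : ℝ := μ / (8 * M * L ^ 2) with ha
    have ha0 : 0 < a := by positivity
    have haR : 4 * M * L ^ 2 / μ = 1 / (2 * a) := by rw [ha]; field_simp; ring
    have h1 : μ * (∑ τ ∈ Finset.range (ℓ + 1), ‖y τ‖ ^ 2 + ∑ τ ∈ Finset.range ℓ, ‖v τ‖ ^ 2) ≤
        ∑ τ ∈ Finset.range (ℓ + 1), inner ℝ (g τ) (y τ) +
          ∑ τ ∈ Finset.range ℓ, inner ℝ (h τ) (v τ) := by
      rw [mul_add, Finset.mul_sum, Finset.mul_sum]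
      exact add_le_add
        (Finset.sum_le_sum fun τ hτ => hg τ (Nat.lt_succ_iff.1 (Finset.mem_range.1 hτ)))
        (Finset.sum_le_sum fun τ hτ => hh τ (Finset.mem_range.1 hτ))
    have h2 : ∑ τ ∈ Finset.range (ℓ + 1), inner ℝ (g τ) (y τ) +
          ∑ τ ∈ Finset.range ℓ, inner ℝ (h τ) (v τ) =
        inner ℝ (p 0) (y 0) + ∑ τ ∈ Finset.range ℓ, inner ℝ (p (τ + 1)) (r τ)
          - inner ℝ (p ℓ - (g ℓ + q ℓ)) (y ℓ) +
          (∑ τ ∈ Finset.range (ℓ + 1), inner ℝ (-q τ) (y τ)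
          + ∑ τ ∈ Finset.range ℓ, inner ℝ (-s τ) (v τ)) := by
      simp only [inner_add_left, Finset.sum_add_distrib] at hid
      simp only [inner_add_left, inner_sub_left, inner_neg_left, Finset.sum_neg_distrib,
        Finset.sum_range_succ]
      linarith
    have h3 : inner ℝ (p 0) (y 0) + ∑ τ ∈ Finset.range ℓ, inner ℝ (p (τ + 1)) (r τ) ≤
        a / 2 * P + 1 / (2 * a) * (‖y 0‖ ^ 2 + ∑ τ ∈ Finset.range ℓ, ‖r τ‖ ^ 2) := by
      rw [hPdef, Finset.sum_range_succ', mul_add, mul_add, Finset.mul_sum, Finset.mul_sum]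
      have e1 := inner_le_amgm ha0 (p 0) (y 0)
      have e2 : ∑ τ ∈ Finset.range ℓ, inner ℝ (p (τ + 1)) (r τ) ≤
          ∑ τ ∈ Finset.range ℓ, (a / 2 * ‖p (τ + 1)‖ ^ 2 + 1 / (2 * a) * ‖r τ‖ ^ 2) :=
        Finset.sum_le_sum fun τ _ => inner_le_amgm ha0 _ _
      rw [Finset.sum_add_distrib] at e2
      linarith
    have h4 : ‖p ℓ‖ * b ≤ a / 2 * P + 1 / (2 * a) * b ^ 2 := by
      have e1 : ‖p ℓ‖ ^ 2 ≤ P :=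
        Finset.single_le_sum (f := fun τ => ‖p τ‖ ^ 2) (fun _ _ => sq_nonneg _)
          (Finset.self_mem_range_succ ℓ)
      have e2 := inner_le_amgm ha0 ‖p ℓ‖ b
      simp only [Real.norm_eq_abs, sq_abs] at e2
      have e3 : inner ℝ ‖p ℓ‖ b = ‖p ℓ‖ * b := by simp [mul_comm]
      rw [e3] at e2
      nlinarith
    have hb2 : (0 : ℝ) < μ / 2 := by positivity
    have hμ2 : 1 / (2 * (μ / 2)) = 1 / μ := by field_simp
    have h5 : ∑ τ ∈ Finset.range (ℓ + 1), inner ℝ (-q τ) (y τ) ≤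
        1 / μ * ∑ τ ∈ Finset.range (ℓ + 1), ‖q τ‖ ^ 2 + μ / 4 * ∑ τ ∈ Finset.range (ℓ + 1), ‖y τ‖ ^ 2 := by
      rw [Finset.mul_sum, Finset.mul_sum, ← Finset.sum_add_distrib]
      refine Finset.sum_le_sum fun τ _ => ?_
      have := inner_le_amgm hb2 (y τ) (-q τ)
      rw [real_inner_comm, norm_neg, hμ2] at this
      linarith
    have h6 : ∑ τ ∈ Finset.range ℓ, inner ℝ (-s τ) (v τ) ≤
        1 / μ * ∑ τ ∈ Finset.range ℓ, ‖s τ‖ ^ 2 + μ / 4 * ∑ τ ∈ Finset.range ℓ, ‖v τ‖ ^ 2 := by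
      rw [Finset.mul_sum, Finset.mul_sum, ← Finset.sum_add_distrib]
      refine Finset.sum_le_sum fun τ _ => ?_
      have := inner_le_amgm hb2 (v τ) (-s τ)
      rw [real_inner_comm, norm_neg, hμ2] at this
      linarith
    rw [haR]
    have h7 : ∀ z : ℝ, z / μ = 1 / μ * z := fun z => by ring
    rw [h7]
    linarith

/-- The energy estimate in weighted norms: the weights `D τ`, `E τ` almost commute with the
dynamics. The terminal condition is either `p ℓ = g ℓ + q ℓ`, or `y ℓ` is regarded as a datum. -/
theorem kkt_weighted_le {A : X →L[ℝ] X} {B : U →L[ℝ] X} {μ L M ε b χ : ℝ} {ℓ : ℕ}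
    {D : ℕ → X →L[ℝ] X} {E : ℕ → U →L[ℝ] U}
    {y g q r p : ℕ → X} {v h s : ℕ → U} (hμ : 0 < μ) (hL : 0 < L) (hM : 0 < M)
    (hAB : DualBound A B χ M ℓ) (hε : 8 * kktConst μ L M * ε ^ 2 ≤ 1)
    (hDA : ∀ τ < ℓ, ∀ x u, ‖D (τ + 1) (A x + B u) - (A (D τ x) + B (E τ u))‖ ^ 2 ≤
      ε ^ 2 * (‖D τ x‖ ^ 2 + ‖E τ u‖ ^ 2))
    (hDp : ∀ τ < ℓ, ∀ x, ‖D τ (adjoint A x) - adjoint A (D (τ + 1) x)‖ ^ 2 ≤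
      ε ^ 2 * ‖D (τ + 1) x‖ ^ 2)
    (hEp : ∀ τ < ℓ, ∀ x, ‖E τ (adjoint B x) - adjoint B (D (τ + 1) x)‖ ^ 2 ≤
      ε ^ 2 * ‖D (τ + 1) x‖ ^ 2)
    (hy : ∀ τ < ℓ, y (τ + 1) = A (y τ) + B (v τ) + r τ)
    (hp : ∀ τ < ℓ, p τ = adjoint A (p (τ + 1)) + (g τ + q τ))
    (hv : ∀ τ < ℓ, adjoint B (p (τ + 1)) + (h τ + s τ) = 0)
    (hg : ∀ τ ≤ ℓ, μ * ‖D τ (y τ)‖ ^ 2 ≤ inner ℝ (D τ (g τ)) (D τ (y τ)))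
    (hgL : ∀ τ ≤ ℓ, ‖D τ (g τ)‖ ≤ L * ‖D τ (y τ)‖)
    (hh : ∀ τ < ℓ, μ * ‖E τ (v τ)‖ ^ 2 ≤ inner ℝ (E τ (h τ)) (E τ (v τ)))
    (hhL : ∀ τ < ℓ, ‖E τ (h τ)‖ ≤ L * ‖E τ (v τ)‖)
    (hend : (χ = 1 ∧ p ℓ = g ℓ + q ℓ ∧ b = 0) ∨ (χ = 0 ∧ g ℓ + q ℓ = 0 ∧ b = ‖D ℓ (y ℓ)‖)) :
    ∑ τ ∈ Finset.range (ℓ + 1), ‖D τ (y τ)‖ ^ 2 + ∑ τ ∈ Finset.range ℓ, ‖E τ (v τ)‖ ^ 2 +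
        ∑ τ ∈ Finset.range (ℓ + 1), ‖D τ (p τ)‖ ^ 2 ≤
      4 * kktConst μ L M * ((‖D 0 (y 0)‖ ^ 2 + b ^ 2 + ∑ τ ∈ Finset.range ℓ, ‖D (τ + 1) (r τ)‖ ^ 2) +
        (∑ τ ∈ Finset.range (ℓ + 1), ‖D τ (q τ)‖ ^ 2 + ∑ τ ∈ Finset.range ℓ, ‖E τ (s τ)‖ ^ 2)) := by
  have hK := kktConst_pos hμ hL hM
  -- The weighted quantities solve the unweighted system, with the commutators added to the
  -- perturbations. At time `ℓ` the recursion has ended, so `q'` contains no commutator there.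
  set r' : ℕ → X := fun τ => D (τ + 1) (r τ) +
    (D (τ + 1) (A (y τ) + B (v τ)) - (A (D τ (y τ)) + B (E τ (v τ)))) with hr'
  set q' : ℕ → X := fun τ => D τ (q τ) + if τ < ℓ then
    (D τ (adjoint A (p (τ + 1))) - adjoint A (D (τ + 1) (p (τ + 1)))) else 0 with hq'
  set s' : ℕ → U := fun τ => E τ (s τ) +
    (E τ (adjoint B (p (τ + 1))) - adjoint B (D (τ + 1) (p (τ + 1)))) with hs'
  have hq'ℓ : q' ℓ = D ℓ (q ℓ) := by simp [hq']
  have hp' : ∀ τ < ℓ, D τ (p τ) = adjoint A (D (τ + 1) (p (τ + 1))) + (D τ (g τ) + q' τ) := by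
    intro τ hτ
    simp only [hq', if_pos hτ]
    conv_lhs => rw [hp τ hτ]
    simp only [map_add]; abel
  have hv' : ∀ τ < ℓ, adjoint B (D (τ + 1) (p (τ + 1))) + (E τ (h τ) + s' τ) = 0 := by
    intro τ hτ
    have := congrArg (E τ) (hv τ hτ)
    simp only [map_add, map_zero] at this
    simp only [hs']
    rw [← this]; abel
  have key := kkt_energy_le (A := A) (B := B) (M := M) (b := b) (ℓ := ℓ)
    (y := fun τ => D τ (y τ)) (g := fun τ => D τ (g τ)) (q := q') (r := r')
    (p := fun τ => D τ (p τ)) (v := fun τ => E τ (v τ)) (h := fun τ => E τ (h τ)) (s := s')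
    hμ hL hM
    (fun τ hτ => by
      simp only [hr']
      conv_lhs => rw [hy τ hτ]
      simp only [map_add]; abel) hp' hv' hg hgL hh hhL ?_ ?_
  · set SY := ∑ τ ∈ Finset.range (ℓ + 1), ‖D τ (y τ)‖ ^ 2
    set SV := ∑ τ ∈ Finset.range ℓ, ‖E τ (v τ)‖ ^ 2
    set SP := ∑ τ ∈ Finset.range (ℓ + 1), ‖D τ (p τ)‖ ^ 2 with hSP
    have hSP' : ∑ τ ∈ Finset.range ℓ, ‖D (τ + 1) (p (τ + 1))‖ ^ 2 ≤ SP := by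
      rw [hSP, Finset.sum_range_succ']
      exact le_add_of_nonneg_right (sq_nonneg _)
    have hSY' : ∑ τ ∈ Finset.range ℓ, ‖D τ (y τ)‖ ^ 2 ≤ SY := by
      simp only [SY]
      rw [Finset.sum_range_succ]
      exact le_add_of_nonneg_right (sq_nonneg _)
    have hrb : ∑ τ ∈ Finset.range ℓ, ‖r' τ‖ ^ 2 ≤
        2 * ∑ τ ∈ Finset.range ℓ, ‖D (τ + 1) (r τ)‖ ^ 2 + 2 * ε ^ 2 * (SY + SV) := by
      calc ∑ τ ∈ Finset.range ℓ, ‖r' τ‖ ^ 2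
          ≤ ∑ τ ∈ Finset.range ℓ, (2 * ‖D (τ + 1) (r τ)‖ ^ 2 +
              2 * ε ^ 2 * (‖D τ (y τ)‖ ^ 2 + ‖E τ (v τ)‖ ^ 2)) := by
            refine Finset.sum_le_sum fun τ hτ => (norm_add_sq_le_two_mul _ _).trans ?_
            have := hDA τ (Finset.mem_range.1 hτ) (y τ) (v τ)
            linarith
        _ = 2 * ∑ τ ∈ Finset.range ℓ, ‖D (τ + 1) (r τ)‖ ^ 2 +
              2 * ε ^ 2 * (∑ τ ∈ Finset.range ℓ, ‖D τ (y τ)‖ ^ 2 + SV) := by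
            rw [Finset.sum_add_distrib, ← Finset.mul_sum, ← Finset.mul_sum, Finset.sum_add_distrib]
        _ ≤ _ := by gcongr
    have hqb : ∑ τ ∈ Finset.range (ℓ + 1), ‖q' τ‖ ^ 2 ≤
        2 * ∑ τ ∈ Finset.range (ℓ + 1), ‖D τ (q τ)‖ ^ 2 + 2 * ε ^ 2 * SP := by
      rw [Finset.sum_range_succ, hq'ℓ, Finset.sum_range_succ _ ℓ, mul_add]
      have : ∑ τ ∈ Finset.range ℓ, ‖q' τ‖ ^ 2 ≤ 2 * ∑ τ ∈ Finset.range ℓ, ‖D τ (q τ)‖ ^ 2 +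
          2 * ε ^ 2 * ∑ τ ∈ Finset.range ℓ, ‖D (τ + 1) (p (τ + 1))‖ ^ 2 := by
        rw [Finset.mul_sum, Finset.mul_sum, ← Finset.sum_add_distrib]
        refine Finset.sum_le_sum fun τ hτ => (norm_add_sq_le_two_mul _ _).trans ?_
        have := hDp τ (Finset.mem_range.1 hτ) (p (τ + 1))
        rw [if_pos (Finset.mem_range.1 hτ)]
        linarith
      have h2 : 2 * ε ^ 2 * ∑ τ ∈ Finset.range ℓ, ‖D (τ + 1) (p (τ + 1))‖ ^ 2 ≤ 2 * ε ^ 2 * SP := by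
        gcongr
      linarith [sq_nonneg ‖D ℓ (q ℓ)‖]
    have hsb : ∑ τ ∈ Finset.range ℓ, ‖s' τ‖ ^ 2 ≤
        2 * ∑ τ ∈ Finset.range ℓ, ‖E τ (s τ)‖ ^ 2 + 2 * ε ^ 2 * SP := by
      have : ∑ τ ∈ Finset.range ℓ, ‖s' τ‖ ^ 2 ≤ 2 * ∑ τ ∈ Finset.range ℓ, ‖E τ (s τ)‖ ^ 2 +
          2 * ε ^ 2 * ∑ τ ∈ Finset.range ℓ, ‖D (τ + 1) (p (τ + 1))‖ ^ 2 := by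
        rw [Finset.mul_sum, Finset.mul_sum, ← Finset.sum_add_distrib]
        refine Finset.sum_le_sum fun τ hτ => (norm_add_sq_le_two_mul _ _).trans ?_
        have := hEp τ (Finset.mem_range.1 hτ) (p (τ + 1))
        linarith
      have h2 : 2 * ε ^ 2 * ∑ τ ∈ Finset.range ℓ, ‖D (τ + 1) (p (τ + 1))‖ ^ 2 ≤ 2 * ε ^ 2 * SP := by
        gcongr
      linarith
    set SR := ∑ τ ∈ Finset.range ℓ, ‖D (τ + 1) (r τ)‖ ^ 2
    set SQ := ∑ τ ∈ Finset.range (ℓ + 1), ‖D τ (q τ)‖ ^ 2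
    set SS := ∑ τ ∈ Finset.range ℓ, ‖E τ (s τ)‖ ^ 2
    have hSY0 : 0 ≤ SY := Finset.sum_nonneg fun _ _ => sq_nonneg _
    have hSV0 : 0 ≤ SV := Finset.sum_nonneg fun _ _ => sq_nonneg _
    have hSP0 : 0 ≤ SP := Finset.sum_nonneg fun _ _ => sq_nonneg _
    have h1 : SY + SV + SP ≤ kktConst μ L M *
        (2 * ((‖D 0 (y 0)‖ ^ 2 + b ^ 2 + SR) + (SQ + SS)) + 4 * ε ^ 2 * (SY + SV + SP)) := by
      refine key.trans (mul_le_mul_of_nonneg_left ?_ hK.le)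
      have : 0 ≤ ε ^ 2 * (SY + SV) := by positivity
      nlinarith [sq_nonneg ‖D 0 (y 0)‖, sq_nonneg b]
    -- The smallness of `ε` makes the commutator terms at most half of the left-hand side, where
    -- they are absorbed.
    have h2 : kktConst μ L M * (4 * ε ^ 2 * (SY + SV + SP)) ≤ 1 / 2 * (SY + SV + SP) := by
      have : kktConst μ L M * (4 * ε ^ 2) ≤ 1 / 2 := by linarith
      calc _ = kktConst μ L M * (4 * ε ^ 2) * (SY + SV + SP) := by ring
        _ ≤ _ := mul_le_mul_of_nonneg_right this (by positivity)
    linarith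
  · refine (hAB fun τ => D τ (p τ)).trans (mul_le_mul_of_nonneg_left ?_ hM.le)
    rw [Finset.sum_add_distrib, Finset.sum_range_succ, hq'ℓ]
    have e1 : ∑ τ ∈ Finset.range ℓ, ‖D τ (p τ) - adjoint A (D (τ + 1) (p (τ + 1)))‖ ^ 2 =
        ∑ τ ∈ Finset.range ℓ, ‖D τ (g τ) + q' τ‖ ^ 2 :=
      Finset.sum_congr rfl fun τ hτ => by
        rw [sub_eq_of_eq_add' (hp' τ (Finset.mem_range.1 hτ))]
    have e2 : ∑ τ ∈ Finset.range ℓ, ‖adjoint B (D (τ + 1) (p (τ + 1)))‖ ^ 2 =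
        ∑ τ ∈ Finset.range ℓ, ‖E τ (h τ) + s' τ‖ ^ 2 :=
      Finset.sum_congr rfl fun τ hτ => by
        rw [eq_neg_of_add_eq_zero_left (hv' τ (Finset.mem_range.1 hτ)), norm_neg]
    rw [e1, e2]
    rcases hend with ⟨h1, h2, _⟩ | ⟨h1, h2, _⟩
    · rw [h1, h2, ← map_add]; linarith
    · rw [h1, ← map_add, h2, map_zero]; simp
  · rw [hq'ℓ]
    rcases hend with ⟨_, h2, h3⟩ | ⟨_, h2, h3⟩
    · rw [← map_add, ← h2, h3]; simp
    · rw [← map_add, h2, h3, map_zero, sub_zero, ← inner_neg_left]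
      exact (real_inner_le_norm _ _).trans (by rw [norm_neg])

end Energy

end

section

/-! ### Optimality systems and existence of optimal trajectories -/

section Optimality

open ContinuousLinearMap (adjoint)

variable {X U : Type*} [NormedAddCommGroup X] [InnerProductSpace ℝ X] [CompleteSpace X]
  [NormedAddCommGroup U] [InnerProductSpace ℝ U] [CompleteSpace U]

/-- The optimality system of a control problem with gradients `g`, `h` of the running costs, apart
from the terminal condition for the multiplier. -/
structure IsKKT (A : X →L[ℝ] X) (B : U →L[ℝ] X) (g : ℕ → X → X) (h : ℕ → U → U) (ζ : ℕ → X)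
    (x : X) (ℓ : ℕ) (y : ℕ → X) (v : ℕ → U) (p : ℕ → X) : Prop where
  traj : IsTraj A B ζ x ℓ y v
  adj : ∀ τ < ℓ, p τ = adjoint A (p (τ + 1)) + g τ (y τ)
  stat : ∀ τ < ℓ, adjoint B (p (τ + 1)) + h τ (v τ) = 0

/-- The trajectory generated by a control sequence. -/
def trajOf (A : X →L[ℝ] X) (B : U →L[ℝ] X) (ζ : ℕ → X) (x : X) (v : ℕ → U) : ℕ → X
  | 0 => x
  | n + 1 => A (trajOf A B ζ x v n) + B (v n) + ζ n

theorem isTraj_trajOf (A : X →L[ℝ] X) (B : U →L[ℝ] X) (ζ : ℕ → X) (x : X) (v : ℕ → U) (ℓ : ℕ) :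
    IsTraj A B ζ x ℓ (trajOf A B ζ x v) v := ⟨rfl, fun _ _ => rfl⟩

theorem IsTraj.eq_of_eq {A : X →L[ℝ] X} {B : U →L[ℝ] X} {ζ : ℕ → X} {x : X} {ℓ : ℕ}
    {y y' : ℕ → X} {v v' : ℕ → U} (h : IsTraj A B ζ x ℓ y v) (h' : IsTraj A B ζ x ℓ y' v')
    (hv : ∀ τ < ℓ, v τ = v' τ) : ∀ τ ≤ ℓ, y τ = y' τ := by
  intro τ
  induction τ with
  | zero => intro _; rw [h.1, h'.1]
  | succ n ih =>
    intro hn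
    rw [h.2 n hn, h'.2 n hn, ih (Nat.le_of_lt hn), hv n hn]

theorem exists_adjoint (A : X →L[ℝ] X) (a : ℕ → X) (z : X) (ℓ : ℕ) :
    ∃ p : ℕ → X, p ℓ = z ∧ ∀ τ < ℓ, p τ = adjoint A (p (τ + 1)) + a τ := by
  -- The backward recursion is run forwards in the time to go, `ℓ - τ`.
  let q : ℕ → X := fun n => Nat.rec z (fun m x => adjoint A x + a (ℓ - 1 - m)) n
  refine ⟨fun τ => q (ℓ - τ), by simp [q], fun τ hτ => ?_⟩
  have h1 : ℓ - τ = (ℓ - (τ + 1)) + 1 := by omega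
  have h2 : ℓ - 1 - (ℓ - (τ + 1)) = τ := by omega
  simp only [h1]
  change adjoint A (q (ℓ - (τ + 1))) + a (ℓ - 1 - (ℓ - (τ + 1))) = _
  rw [h2]

theorem first_variation {f : ℕ → X → ℝ} {c : ℕ → U → ℝ} {g : X → ℝ} {ℓ : ℕ}
    {y δy : ℕ → X} {v δv : ℕ → U} (hf : ∀ τ < ℓ, Differentiable ℝ (f τ))
    (hc : ∀ τ < ℓ, Differentiable ℝ (c τ)) (hg : Differentiable ℝ g)
    (hmin : ∀ ε : ℝ, horizonCost f c g ℓ y v ≤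
      horizonCost f c g ℓ (fun τ => y τ + ε • δy τ) (fun τ => v τ + ε • δv τ)) :
    ∑ τ ∈ Finset.range ℓ, (inner ℝ (gradient (f τ) (y τ)) (δy τ) +
      inner ℝ (gradient (c τ) (v τ)) (δv τ)) + inner ℝ (gradient g (y ℓ)) (δy ℓ) = 0 := by
  have hd : HasDerivAt (fun ε : ℝ => horizonCost f c g ℓ (fun τ => y τ + ε • δy τ)
      (fun τ => v τ + ε • δv τ)) (∑ τ ∈ Finset.range ℓ, (inner ℝ (gradient (f τ) (y τ)) (δy τ) +
      inner ℝ (gradient (c τ) (v τ)) (δv τ)) + inner ℝ (gradient g (y ℓ)) (δy ℓ)) 0 := by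
    unfold horizonCost
    refine HasDerivAt.add ?_ (hasDerivAt_comp_line (hg _) _)
    refine HasDerivAt.fun_sum fun τ hτ => ?_
    rw [Finset.mem_range] at hτ
    exact (hasDerivAt_comp_line (hf τ hτ _) _).add (hasDerivAt_comp_line (hc τ hτ _) _)
  refine IsLocalMin.hasDerivAt_eq_zero ?_ hd
  refine Filter.Eventually.of_forall fun ε => ?_
  simpa using hmin ε

theorem IsTraj.add_smul {A : X →L[ℝ] X} {B : U →L[ℝ] X} {ζ : ℕ → X} {x : X} {ℓ : ℕ}
    {y δy : ℕ → X} {v δv : ℕ → U} (h : IsTraj A B ζ x ℓ y v)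
    (hδ : IsTraj A B (fun _ => 0) 0 ℓ δy δv) (ε : ℝ) :
    IsTraj A B ζ x ℓ (fun τ => y τ + ε • δy τ) (fun τ => v τ + ε • δv τ) := by
  refine ⟨by simp [h.1, hδ.1], fun τ hτ => ?_⟩
  simp only
  rw [h.2 τ hτ, hδ.2 τ hτ]
  simp only [map_add, map_smul, smul_add, smul_zero]
  abel

/-- The first variation in terms of the multipliers. -/
theorem first_variation_adjoint {A : X →L[ℝ] X} {B : U →L[ℝ] X} {ℓ : ℕ} {a p δy : ℕ → X}
    {b δv : ℕ → U} (hδ : IsTraj A B (fun _ => 0) 0 ℓ δy δv)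
    (hp : ∀ τ < ℓ, p τ = adjoint A (p (τ + 1)) + a τ) :
    ∑ τ ∈ Finset.range ℓ, (inner ℝ (a τ) (δy τ) + inner ℝ (b τ) (δv τ)) =
      ∑ τ ∈ Finset.range ℓ, inner ℝ (adjoint B (p (τ + 1)) + b τ) (δv τ) -
        inner ℝ (p ℓ) (δy ℓ) := by
  have h := sum_inner_eq A B (y := δy) (a := a) (r := fun _ => 0) (p := p) (v := δv)
    (b := fun τ => - adjoint B (p (τ + 1))) hδ.2 hp (fun τ _ => by simp)
  simp only [inner_neg_left, inner_zero_right, Finset.sum_const_zero, hδ.1, add_zero] at h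
  simp only [inner_add_left, Finset.sum_add_distrib, Finset.sum_neg_distrib] at h ⊢
  linarith

/-- The multipliers are defined by the adjoint recursion from the terminal gradient. The first
variation is then the pairing of the stationarity residual with the variation of the controls;
choosing that variation equal to the residual forces the residual to vanish. -/
theorem IsSolution.exists_kkt {A : X →L[ℝ] X} {B : U →L[ℝ] X} {f : ℕ → X → ℝ} {c : ℕ → U → ℝ}
    {g : X → ℝ} {ζ : ℕ → X} {x : X} {ℓ : ℕ} {y : ℕ → X} {v : ℕ → U}
    (h : IsSolution A B f c g ζ x ℓ y v) (hf : ∀ τ < ℓ, Differentiable ℝ (f τ))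
    (hc : ∀ τ < ℓ, Differentiable ℝ (c τ)) (hg : Differentiable ℝ g) :
    ∃ p, IsKKT A B (fun τ => gradient (f τ)) (fun τ => gradient (c τ)) ζ x ℓ y v p ∧
      p ℓ = gradient g (y ℓ) := by
  obtain ⟨p, hpℓ, hp⟩ := exists_adjoint A (fun τ => gradient (f τ) (y τ)) (gradient g (y ℓ)) ℓ
  refine ⟨p, ⟨h.1, hp, ?_⟩, hpℓ⟩
  set m : ℕ → U := fun τ => adjoint B (p (τ + 1)) + gradient (c τ) (v τ) with hm
  have hδ := isTraj_trajOf A B (fun _ => 0) 0 m ℓ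
  have h1 := first_variation hf hc hg (fun ε => h.2 _ _ (h.1.add_smul hδ ε))
  rw [first_variation_adjoint hδ hp, hpℓ, sub_add_cancel] at h1
  have h2 := (Finset.sum_eq_zero_iff_of_nonneg (fun τ _ => real_inner_self_nonneg)).1 h1
  exact fun τ hτ => inner_self_eq_zero.1 (h2 τ (Finset.mem_range.2 hτ))

theorem IsTraj.eq_sum {A : X →L[ℝ] X} {B : U →L[ℝ] X} {ℓ : ℕ} {y : ℕ → X} {v : ℕ → U}
    (h : IsTraj A B (fun _ => 0) 0 ℓ y v) :
    y ℓ = ∑ j ∈ Finset.range ℓ, (A ^ j) (B (v (ℓ - 1 - j))) := by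
  induction ℓ with
  | zero => simp [h.1]
  | succ n ih =>
    have ih' := ih ⟨h.1, fun τ hτ => h.2 τ (by omega)⟩
    rw [h.2 n (Nat.lt_succ_self n), ih', Finset.sum_range_succ', map_sum, add_zero]
    congr 1
    · refine Finset.sum_congr rfl fun j hj => ?_
      rw [pow_succ', show n + 1 - 1 - (j + 1) = n - 1 - j by omega]
      rfl

/-- Multipliers of problems with prescribed terminal state. -/
theorem IsTerminalSolution.exists_kkt [FiniteDimensional ℝ X] {A : X →L[ℝ] X} {B : U →L[ℝ] X}
    {f : ℕ → X → ℝ} {c : ℕ → U → ℝ} {ζ : ℕ → X} {x xbar : X} {ℓ : ℕ} {y : ℕ → X} {v : ℕ → U}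
    {σ : ℝ} {d : ℕ} (hσ : 0 < σ) (hC : ∀ z, σ * ‖z‖ ≤ ‖adjoint (ctrlMap A B d) z‖) (hℓ : d ≤ ℓ)
    (h : IsTerminalSolution A B f c ζ x xbar ℓ y v) (hf : ∀ τ ≤ ℓ, Differentiable ℝ (f τ))
    (hc : ∀ τ < ℓ, Differentiable ℝ (c τ)) :
    ∃ p, IsKKT A B (fun τ => gradient (f τ)) (fun τ => gradient (c τ)) ζ x ℓ y v p := by
  obtain ⟨p₀, hp₀ℓ, hp₀⟩ := exists_adjoint A (fun τ => gradient (f τ) (y τ)) 0 ℓ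
  set m₀ : ℕ → U := fun τ => adjoint B (p₀ (τ + 1)) + gradient (c τ) (v τ) with hm₀
  -- The controllability Gramian over `ℓ` steps; it is injective because `ℓ ≥ d`, hence surjective.
  let W : X →ₗ[ℝ] X := ∑ j ∈ Finset.range ℓ,
    (((A ^ j) ∘L B ∘L adjoint B ∘L (adjoint A ^ j) : X →L[ℝ] X) : X →ₗ[ℝ] X)
  have hWapp : ∀ ν, W ν = ∑ j ∈ Finset.range ℓ, (A ^ j) (B (adjoint B ((adjoint A ^ j) ν))) := by
    intro ν; simp only [W, LinearMap.sum_apply]; rfl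
  have hW : ∀ ν, inner ℝ (W ν) ν = ∑ j ∈ Finset.range ℓ, ‖adjoint B ((adjoint A ^ j) ν)‖ ^ 2 := by
    intro ν
    rw [hWapp, sum_inner]
    refine Finset.sum_congr rfl fun j _ => ?_
    have h3 : adjoint A ^ j = adjoint (A ^ j) := by
      rw [← ContinuousLinearMap.star_eq_adjoint, ← ContinuousLinearMap.star_eq_adjoint, star_pow]
    rw [h3, ← ContinuousLinearMap.adjoint_inner_right, ← ContinuousLinearMap.adjoint_inner_right,
      real_inner_self_eq_norm_sq]
  have hinj : Function.Injective W := by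
    rw [← LinearMap.ker_eq_bot, LinearMap.ker_eq_bot']
    intro ν hν
    have h1 := hW ν
    rw [hν, inner_zero_left, eq_comm] at h1
    have h2 : ‖adjoint (ctrlMap A B d) ν‖ ^ 2 ≤ 0 := by
      rw [norm_adjoint_ctrlMap_sq, ← h1]
      exact Finset.sum_le_sum_of_subset_of_nonneg (Finset.range_subset_range.2 hℓ)
        (fun _ _ _ => sq_nonneg _)
    have h3 : ‖adjoint (ctrlMap A B d) ν‖ = 0 := by
      have := sq_nonneg ‖adjoint (ctrlMap A B d) ν‖
      exact pow_eq_zero_iff (two_ne_zero) |>.1 (le_antisymm h2 this)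
    have h4 := hC ν
    rw [h3] at h4
    have h5 : ‖ν‖ ≤ 0 := by
      by_contra hne
      push Not at hne
      have : 0 < σ * ‖ν‖ := by positivity
      linarith
    exact norm_le_zero_iff.1 h5
  -- The terminal multiplier `ν` is chosen so that the stationarity residual, used as a variation of
  -- the controls, steers the origin back to the origin. The variation then respects the prescribed
  -- terminal state.
  obtain ⟨ν, hν⟩ := (LinearMap.injective_iff_surjective.1 hinj)
    (-∑ j ∈ Finset.range ℓ, (A ^ j) (B (m₀ (ℓ - 1 - j))))
  set p : ℕ → X := fun τ => p₀ τ + (adjoint A ^ (ℓ - τ)) ν with hp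
  have hpadj : ∀ τ < ℓ, p τ = adjoint A (p (τ + 1)) + gradient (f τ) (y τ) := by
    intro τ hτ
    simp only [hp]
    rw [hp₀ τ hτ, show ℓ - τ = (ℓ - (τ + 1)) + 1 by omega, pow_succ', map_add]
    change _ + adjoint A ((adjoint A ^ (ℓ - (τ + 1))) ν) = _
    abel
  refine ⟨p, h.1.1, hpadj, ?_⟩
  set m : ℕ → U := fun τ => adjoint B (p (τ + 1)) + gradient (c τ) (v τ) with hm
  have hδ := isTraj_trajOf A B (fun _ => 0) 0 m ℓ
  have hend : trajOf A B (fun _ => 0) 0 m ℓ = 0 := by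
    rw [hδ.eq_sum]
    have e : ∀ j ∈ Finset.range ℓ, (A ^ j) (B (m (ℓ - 1 - j))) = (A ^ j) (B (m₀ (ℓ - 1 - j))) +
        (A ^ j) (B (adjoint B ((adjoint A ^ j) ν))) := by
      intro j hj
      rw [Finset.mem_range] at hj
      simp only [hm, hm₀, hp]
      rw [show ℓ - (ℓ - 1 - j + 1) = j by omega]
      simp only [map_add]
      abel
    rw [Finset.sum_congr rfl e, Finset.sum_add_distrib, ← hWapp, hν, add_neg_cancel]
  have h1 := first_variation (fun τ hτ => hf τ (le_of_lt hτ)) hc (hf ℓ le_rfl)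
    (fun ε => h.2 _ _ ⟨h.1.1.add_smul hδ ε, by simp [hend, h.1.2]⟩)
  rw [first_variation_adjoint hδ hpadj, hend, inner_zero_right, inner_zero_right, sub_zero,
    add_zero] at h1
  have h2 := (Finset.sum_eq_zero_iff_of_nonneg (fun τ _ => real_inner_self_nonneg)).1 h1
  exact fun τ hτ => inner_self_eq_zero.1 (h2 τ (Finset.mem_range.2 hτ))

theorem horizonCost_congr {f : ℕ → X → ℝ} {c : ℕ → U → ℝ} {g : X → ℝ} {ℓ : ℕ}
    {y y' : ℕ → X} {v v' : ℕ → U} (hy : ∀ τ ≤ ℓ, y τ = y' τ) (hv : ∀ τ < ℓ, v τ = v' τ) :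
    horizonCost f c g ℓ y v = horizonCost f c g ℓ y' v' := by
  unfold horizonCost
  rw [hy ℓ le_rfl]
  congr 1
  refine Finset.sum_congr rfl fun τ hτ => ?_
  rw [Finset.mem_range] at hτ
  rw [hy τ hτ.le, hv τ hτ]

/-- The direct method: the cost is a continuous function of the finitely many controls, and the
quadratic lower bound on the control costs makes it coercive. -/
theorem exists_isSolution [FiniteDimensional ℝ U] (A : X →L[ℝ] X) (B : U →L[ℝ] X)
    {f : ℕ → X → ℝ} {c : ℕ → U → ℝ} {g : X → ℝ} (ζ : ℕ → X) (x : X) {ℓ : ℕ} {μ : ℝ} (hμ : 0 < μ)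
    (hf : ∀ τ < ℓ, Continuous (f τ)) (hc : ∀ τ < ℓ, Continuous (c τ)) (hg : Continuous g)
    (hf0 : ∀ τ < ℓ, ∀ y, 0 ≤ f τ y) (hc0 : ∀ τ < ℓ, ∀ u, μ / 2 * ‖u‖ ^ 2 ≤ c τ u)
    (hg0 : ∀ y, 0 ≤ g y) :
    ∃ y v, IsSolution A B f c g ζ x ℓ y v := by
  let ext : (Fin ℓ → U) → ℕ → U := fun v τ => if h : τ < ℓ then v ⟨τ, h⟩ else 0
  have hext : ∀ τ, Continuous fun v => ext v τ := by
    intro τ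
    by_cases h : τ < ℓ
    · simp only [ext, dif_pos h]; fun_prop
    · simp only [ext, dif_neg h]; fun_prop
  have htr : ∀ τ, Continuous fun v => trajOf A B ζ x (ext v) τ := by
    intro τ
    induction τ with
    | zero => exact continuous_const
    | succ n ih =>
      have := hext n
      change Continuous fun v => A (trajOf A B ζ x (ext v) n) + B (ext v n) + ζ n
      fun_prop
  let J : (Fin ℓ → U) → ℝ := fun v => horizonCost f c g ℓ (trajOf A B ζ x (ext v)) (ext v)
  have hJ : Continuous J := by
    simp only [J, horizonCost]
    refine Continuous.add (continuous_finsetSum _ fun τ hτ => ?_) (hg.comp (htr ℓ))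
    rw [Finset.mem_range] at hτ
    exact ((hf τ hτ).comp (htr τ)).add ((hc τ hτ).comp (hext τ))
  have hlow : ∀ v, μ / 2 * ‖v‖ ^ 2 ≤ J v := by
    intro v
    have hsum : ∀ τ < ℓ, μ / 2 * ‖ext v τ‖ ^ 2 ≤ J v := by
      intro τ hτ
      simp only [J, horizonCost]
      have h1 : μ / 2 * ‖ext v τ‖ ^ 2 ≤
          f τ (trajOf A B ζ x (ext v) τ) + c τ (ext v τ) := by
        linarith [hf0 τ hτ (trajOf A B ζ x (ext v) τ), hc0 τ hτ (ext v τ)]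
      have h2 := Finset.single_le_sum
        (f := fun τ => f τ (trajOf A B ζ x (ext v) τ) + c τ (ext v τ)) (s := Finset.range ℓ)
        (fun τ hτ => by
          rw [Finset.mem_range] at hτ
          exact add_nonneg (hf0 τ hτ _)
            ((mul_nonneg (half_pos hμ).le (sq_nonneg _)).trans (hc0 τ hτ _))) (Finset.mem_range.2 hτ)
      have h3 := hg0 (trajOf A B ζ x (ext v) ℓ)
      linarith
    have hJ0 : 0 ≤ J v := by
      simp only [J, horizonCost]
      refine add_nonneg (Finset.sum_nonneg fun τ hτ => ?_) (hg0 _)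
      rw [Finset.mem_range] at hτ
      exact add_nonneg (hf0 τ hτ _)
        ((mul_nonneg (half_pos hμ).le (sq_nonneg _)).trans (hc0 τ hτ _))
    have hn : ‖v‖ ≤ √(J v / (μ / 2)) := by
      refine (pi_norm_le_iff_of_nonneg (Real.sqrt_nonneg _)).2 fun i => ?_
      refine Real.le_sqrt_of_sq_le ?_
      rw [le_div_iff₀ (by positivity)]
      have := hsum i i.2
      simp only [ext, dif_pos i.2, Fin.eta] at this
      linarith
    have := Real.sq_sqrt (show 0 ≤ J v / (μ / 2) by positivity)
    have h2 : ‖v‖ ^ 2 ≤ J v / (μ / 2) := by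
      rw [← this]; exact pow_le_pow_left₀ (norm_nonneg _) hn 2
    rw [le_div_iff₀ (by positivity)] at h2
    linarith
  have hlim : Tendsto J (cocompact (Fin ℓ → U)) atTop := by
    refine tendsto_atTop_mono hlow ?_
    refine Tendsto.const_mul_atTop (by positivity) ?_
    exact (tendsto_pow_atTop two_ne_zero).comp tendsto_norm_cocompact_atTop
  obtain ⟨v, hv⟩ := hJ.exists_forall_le hlim
  refine ⟨_, ext v, isTraj_trajOf A B ζ x (ext v) ℓ, fun y' v' h' => ?_⟩
  have h1 := hv fun i => v' i
  refine h1.trans (le_of_eq ?_)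
  have h2 : ∀ τ < ℓ, ext (fun i : Fin ℓ => v' i) τ = v' τ := fun τ hτ => by simp [ext, hτ]
  exact horizonCost_congr ((isTraj_trajOf A B ζ x _ ℓ).eq_of_eq h' h2) h2

end Optimality

end

section

/-! ### Comparison of solutions of optimality systems -/

section Comparison

open ContinuousLinearMap (adjoint)

variable {X U : Type*} [NormedAddCommGroup X] [InnerProductSpace ℝ X] [CompleteSpace X]
  [NormedAddCommGroup U] [InnerProductSpace ℝ U] [CompleteSpace U]

/-- `g` is `μ`-strongly monotone and `L`-Lipschitz with respect to the seminorm `‖D ·‖`. -/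
def WMono (μ L : ℝ) (D : X →L[ℝ] X) (g : X → X) : Prop :=
  ∀ y y', μ * ‖D (y - y')‖ ^ 2 ≤ inner ℝ (D (g y - g y')) (D (y - y')) ∧
    ‖D (g y - g y')‖ ≤ L * ‖D (y - y')‖

theorem WMono.smul {μ L : ℝ} {g : X → X} (h : WMono μ L (ContinuousLinearMap.id ℝ X) g) {a : ℝ} :
    WMono μ L (a • ContinuousLinearMap.id ℝ X) g := by
  intro y y'
  obtain ⟨h1, h2⟩ := h y y'
  simp only [ContinuousLinearMap.id_apply, smul_apply, norm_smul,
    real_inner_smul_left, real_inner_smul_right] at h1 h2 ⊢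
  constructor
  · have := mul_le_mul_of_nonneg_left h1 (sq_nonneg a)
    rw [mul_pow, Real.norm_eq_abs, sq_abs]
    linarith
  · have := mul_le_mul_of_nonneg_left h2 (norm_nonneg a)
    linarith

theorem WellConditioned.wMono {μ L : ℝ} {f : X → ℝ} (h : WellConditioned μ L f) :
    WMono μ L (ContinuousLinearMap.id ℝ X) (gradient f) := fun y y' =>
  ⟨h.monotone_gradient y y', h.norm_gradient_sub_le y y'⟩

theorem wMono_smul {μ L s : ℝ} (hμ : 0 < μ) (h1 : μ ≤ s) (h2 : s ≤ L) (D : X →L[ℝ] X) :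
    WMono μ L D (fun y => s • y) := by
  intro y y'
  simp only [← smul_sub, map_smul, real_inner_smul_left, real_inner_self_eq_norm_sq, norm_smul,
    Real.norm_eq_abs, abs_of_pos (hμ.trans_le h1)]
  exact ⟨mul_le_mul_of_nonneg_right h1 (sq_nonneg _), mul_le_mul_of_nonneg_right h2 (norm_nonneg _)⟩

/-- The weights `D τ`, `E τ` commute with the dynamics up to errors of relative size `ε`. -/
structure AlmostCommute (A : X →L[ℝ] X) (B : U →L[ℝ] X) (ε : ℝ) (D : ℕ → X →L[ℝ] X)
    (E : ℕ → U →L[ℝ] U) : Prop where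
  dyn : ∀ τ x u, ‖D (τ + 1) (A x + B u) - (A (D τ x) + B (E τ u))‖ ^ 2 ≤
      ε ^ 2 * (‖D τ x‖ ^ 2 + ‖E τ u‖ ^ 2)
  adjA : ∀ τ x, ‖D τ (adjoint A x) - adjoint A (D (τ + 1) x)‖ ^ 2 ≤ ε ^ 2 * ‖D (τ + 1) x‖ ^ 2
  adjB : ∀ τ x, ‖E τ (adjoint B x) - adjoint B (D (τ + 1) x)‖ ^ 2 ≤ ε ^ 2 * ‖D (τ + 1) x‖ ^ 2

/-- Only the gradients of the first system have to be monotone. The second solution enters through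
the residuals that it leaves in the first system, all evaluated along `y'` and `v'`; its terminal
multiplier is free. So the second solution may be zero, or a piece of an optimal trajectory with a
longer horizon. -/
theorem kkt_compare {A : X →L[ℝ] X} {B : U →L[ℝ] X} {μ L M ε : ℝ} {ℓ : ℕ}
    {D : ℕ → X →L[ℝ] X} {E : ℕ → U →L[ℝ] U} {g g' : ℕ → X → X} {h h' : ℕ → U → U} {gT : X → X}
    {ζ ζ' y y' p p' : ℕ → X} {v v' : ℕ → U} {x x' : X} (hμ : 0 < μ) (hL : 0 < L) (hM : 0 < M)
    (hAB : DualBound A B 1 M ℓ) (hε : 8 * kktConst μ L M * ε ^ 2 ≤ 1)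
    (hDE : AlmostCommute A B ε D E)
    (hg : ∀ τ < ℓ, WMono μ L (D τ) (g τ)) (hgT : WMono μ L (D ℓ) gT)
    (hh : ∀ τ < ℓ, WMono μ L (E τ) (h τ))
    (hk : IsKKT A B g h ζ x ℓ y v p) (hpℓ : p ℓ = gT (y ℓ))
    (hk' : IsKKT A B g' h' ζ' x' ℓ y' v' p') :
    ∑ τ ∈ Finset.range (ℓ + 1), ‖D τ (y τ - y' τ)‖ ^ 2 +
        ∑ τ ∈ Finset.range ℓ, ‖E τ (v τ - v' τ)‖ ^ 2 +
        ∑ τ ∈ Finset.range (ℓ + 1), ‖D τ (p τ - p' τ)‖ ^ 2 ≤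
      4 * kktConst μ L M * (‖D 0 (x - x')‖ ^ 2 +
        ∑ τ ∈ Finset.range ℓ, ‖D (τ + 1) (ζ τ - ζ' τ)‖ ^ 2 +
        ∑ τ ∈ Finset.range ℓ, ‖D τ (g τ (y' τ) - g' τ (y' τ))‖ ^ 2 +
        ‖D ℓ (gT (y' ℓ) - p' ℓ)‖ ^ 2 +
        ∑ τ ∈ Finset.range ℓ, ‖E τ (h τ (v' τ) - h' τ (v' τ))‖ ^ 2) := by
  have key := kkt_weighted_le (A := A) (B := B) (M := M) (b := 0) (χ := 1) (ℓ := ℓ) (D := D) (E := E)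
    (y := fun τ => y τ - y' τ)
    (g := fun τ => if τ < ℓ then g τ (y τ) - g τ (y' τ) else gT (y ℓ) - gT (y' ℓ))
    (q := fun τ => if τ < ℓ then g τ (y' τ) - g' τ (y' τ) else gT (y' ℓ) - p' ℓ)
    (r := fun τ => ζ τ - ζ' τ) (p := fun τ => p τ - p' τ) (v := fun τ => v τ - v' τ)
    (h := fun τ => h τ (v τ) - h τ (v' τ)) (s := fun τ => h τ (v' τ) - h' τ (v' τ))
    hμ hL hM hAB hε (fun τ _ => hDE.dyn τ) (fun τ _ => hDE.adjA τ) (fun τ _ => hDE.adjB τ)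
    (fun τ hτ => by rw [hk.traj.2 τ hτ, hk'.traj.2 τ hτ]; simp only [map_sub]; abel)
    (fun τ hτ => by rw [if_pos hτ, if_pos hτ, hk.adj τ hτ, hk'.adj τ hτ, map_sub]; abel)
    (fun τ hτ => by
      have h1 := hk.stat τ hτ
      have h2 := hk'.stat τ hτ
      rw [map_sub, eq_neg_of_add_eq_zero_left h1, eq_neg_of_add_eq_zero_left h2]; abel)
    (fun τ hτ => by
      rcases hτ.lt_or_eq with hτ | rfl
      · simp only [if_pos hτ]; exact (hg τ hτ _ _).1
      · simp only [lt_irrefl, if_false]; exact (hgT _ _).1)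
    (fun τ hτ => by
      rcases hτ.lt_or_eq with hτ | rfl
      · simp only [if_pos hτ]; exact (hg τ hτ _ _).2
      · simp only [lt_irrefl, if_false]; exact (hgT _ _).2)
    (fun τ hτ => (hh τ hτ _ _).1) (fun τ hτ => (hh τ hτ _ _).2)
    (Or.inl ⟨rfl, by simp only [lt_irrefl, if_false]; rw [hpℓ]; abel, rfl⟩)
  refine key.trans (le_of_eq ?_)
  rw [Finset.sum_range_succ _ ℓ]
  simp only [lt_irrefl, if_false, hk.traj.1, hk'.traj.1]
  have e : ∑ τ ∈ Finset.range ℓ, ‖D τ (if τ < ℓ then g τ (y' τ) - g' τ (y' τ) else gT (y' ℓ) - p' ℓ)‖ ^ 2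
      = ∑ τ ∈ Finset.range ℓ, ‖D τ (g τ (y' τ) - g' τ (y' τ))‖ ^ 2 :=
    Finset.sum_congr rfl fun τ hτ => by rw [if_pos (Finset.mem_range.1 hτ)]
  rw [e]; ring

/-- Admissible relative size of the commutators with the weights. -/
def kktEps (μ L M : ℝ) : ℝ := (√(8 * kktConst μ L M))⁻¹

/-- Rate of exponential decay, in time and in space, of perturbations of optimal trajectories. -/
def decayRate (μ L M : ℝ) : ℝ := (1 + kktEps μ L M / (4 * L))⁻¹

section rate

variable {μ L M : ℝ}

theorem kktEps_pos (hμ : 0 < μ) (hL : 0 < L) (hM : 0 < M) : 0 < kktEps μ L M := by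
  have := kktConst_pos hμ hL hM
  rw [kktEps]; positivity

theorem kktEps_le (hμ : 0 < μ) (hL : 0 < L) (hM : 0 < M) :
    8 * kktConst μ L M * kktEps μ L M ^ 2 ≤ 1 := by
  have := kktConst_pos hμ hL hM
  rw [kktEps, inv_pow, Real.sq_sqrt (by positivity)]
  exact le_of_eq (mul_inv_cancel₀ (by positivity))

theorem decayRate_pos (hμ : 0 < μ) (hL : 0 < L) (hM : 0 < M) : 0 < decayRate μ L M := by
  have := kktEps_pos hμ hL hM
  rw [decayRate]; positivity

theorem decayRate_lt_one (hμ : 0 < μ) (hL : 0 < L) (hM : 0 < M) : decayRate μ L M < 1 := by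
  have := kktEps_pos hμ hL hM
  have h : 0 < kktEps μ L M / (4 * L) := by positivity
  rw [decayRate]; exact inv_lt_one_of_one_lt₀ (by linarith)

theorem inv_decayRate_sub_one : (decayRate μ L M)⁻¹ - 1 = kktEps μ L M / (4 * L) := by
  rw [decayRate, inv_inv]; ring

end rate

theorem abs_pow_sub_pow_le {γ : ℝ} (h0 : 0 < γ) (h1 : γ < 1) {a b : ℕ} (hab : a ≤ b + 1)
    (hba : b ≤ a + 1) : |γ ^ a - γ ^ b| ≤ (γ⁻¹ - 1) * γ ^ b := by
  have h2 : 1 < γ⁻¹ := (one_lt_inv₀ h0).2 h1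
  have hb : 0 < γ ^ b := by positivity
  rcases (by omega : a = b ∨ a = b + 1 ∨ b = a + 1) with rfl | rfl | rfl
  · rw [sub_self, abs_zero]; nlinarith
  · rw [pow_succ, abs_le]
    have h3 : 1 - γ ≤ γ⁻¹ - 1 := by
      have : γ⁻¹ - 1 - (1 - γ) = (1 - γ) ^ 2 * γ⁻¹ := by field_simp
      have h4 : 0 ≤ (1 - γ) ^ 2 * γ⁻¹ := by positivity
      linarith
    constructor <;> nlinarith
  · have h3 : γ ^ a = γ⁻¹ * γ ^ (a + 1) := by rw [pow_succ]; field_simp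
    rw [h3, show γ⁻¹ * γ ^ (a + 1) - γ ^ (a + 1) = (γ⁻¹ - 1) * γ ^ (a + 1) by ring, abs_of_nonneg]
    nlinarith

theorem norm_add_apply_sq_le {A : X →L[ℝ] X} {B : U →L[ℝ] X} {L : ℝ} (hA : ‖A‖ ≤ L) (hB : ‖B‖ ≤ L)
    (x : X) (u : U) : ‖A x + B u‖ ^ 2 ≤ 2 * L ^ 2 * (‖x‖ ^ 2 + ‖u‖ ^ 2) := by
  refine (norm_add_sq_le_two_mul _ _).trans ?_
  have h1 := pow_le_pow_left₀ (norm_nonneg _) (A.le_of_opNorm_le hA x) 2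
  have h2 := pow_le_pow_left₀ (norm_nonneg _) (B.le_of_opNorm_le hB u) 2
  rw [mul_pow] at h1 h2
  linarith

theorem norm_smul_adjoint_sub_sq_le {T : U →L[ℝ] X} {L c ε a b : ℝ} (hT : ‖T‖ ≤ L)
    (hsq : c ^ 2 * (2 * L ^ 2) ≤ ε ^ 2) (hab : (a - b) ^ 2 ≤ c ^ 2 * b ^ 2) (x : X) :
    ‖a • adjoint T x - adjoint T (b • x)‖ ^ 2 ≤ ε ^ 2 * ‖b • x‖ ^ 2 := by
  have h3 := pow_le_pow_left₀ (norm_nonneg _) (norm_adjoint_le hT x) 2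
  rw [map_smul, ← sub_smul, norm_smul, norm_smul, mul_pow, mul_pow, Real.norm_eq_abs, sq_abs,
    Real.norm_eq_abs, sq_abs]
  rw [mul_pow] at h3
  calc _ ≤ c ^ 2 * b ^ 2 * (L ^ 2 * ‖x‖ ^ 2) := mul_le_mul hab h3 (by positivity) (by positivity)
    _ = c ^ 2 * L ^ 2 * (b ^ 2 * ‖x‖ ^ 2) := by ring
    _ ≤ ε ^ 2 * (b ^ 2 * ‖x‖ ^ 2) := by
        refine mul_le_mul_of_nonneg_right (le_trans ?_ hsq) (by positivity)
        have : 0 ≤ c ^ 2 * L ^ 2 := by positivity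
        linarith

theorem almostCommute_one (A : X →L[ℝ] X) (B : U →L[ℝ] X) :
    AlmostCommute A B 0 (fun _ => ContinuousLinearMap.id ℝ X)
      (fun _ => ContinuousLinearMap.id ℝ U) where
  dyn τ x u := by simp
  adjA τ x := by simp
  adjB τ x := by simp

/-- At a fixed time the scalar weights commute with `A` and `B`. Commutators arise only from the
shift by one step, which changes a weight by a relative amount of at most `γ⁻¹ - 1`, that is `ε / (4
* L)`. -/
theorem almostCommute_time {A : X →L[ℝ] X} {B : U →L[ℝ] X} {μ L M : ℝ} (hμ : 0 < μ) (hL : 0 < L)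
    (hM : 0 < M) (hA : ‖A‖ ≤ L) (hB : ‖B‖ ≤ L) (m : ℕ) :
    AlmostCommute A B (kktEps μ L M)
      (fun τ => decayRate μ L M ^ ((τ : ℤ) - (m : ℤ)).natAbs • ContinuousLinearMap.id ℝ X)
      (fun τ => decayRate μ L M ^ ((τ : ℤ) - (m : ℤ)).natAbs • ContinuousLinearMap.id ℝ U) := by
  have hε := kktEps_pos hμ hL hM
  have hc : (decayRate μ L M)⁻¹ - 1 = kktEps μ L M / (4 * L) := inv_decayRate_sub_one
  set γ := decayRate μ L M with hγ
  have h0 : 0 < γ := decayRate_pos hμ hL hM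
  have h1 : γ < 1 := decayRate_lt_one hμ hL hM
  set ε := kktEps μ L M with hεd
  set n : ℕ → ℕ := fun τ => ((τ : ℤ) - (m : ℤ)).natAbs with hn
  have hn1 : ∀ τ, n (τ + 1) ≤ n τ + 1 := fun τ => by simp only [hn]; omega
  have hn2 : ∀ τ, n τ ≤ n (τ + 1) + 1 := fun τ => by simp only [hn]; omega
  have hsq : (ε / (4 * L)) ^ 2 * (2 * L ^ 2) ≤ ε ^ 2 := by
    have : (ε / (4 * L)) ^ 2 * (2 * L ^ 2) = ε ^ 2 / 8 := by field_simp; norm_num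
    rw [this]; linarith [sq_nonneg ε]
  have hw1 : ∀ τ, (γ ^ n (τ + 1) - γ ^ n τ) ^ 2 ≤ (ε / (4 * L)) ^ 2 * (γ ^ n τ) ^ 2 := by
    intro τ
    rw [← sq_abs, ← mul_pow, ← hc]
    exact pow_le_pow_left₀ (abs_nonneg _) (abs_pow_sub_pow_le h0 h1 (hn1 τ) (hn2 τ)) 2
  have hw2 : ∀ τ, (γ ^ n τ - γ ^ n (τ + 1)) ^ 2 ≤ (ε / (4 * L)) ^ 2 * (γ ^ n (τ + 1)) ^ 2 := by
    intro τ
    rw [← sq_abs, ← mul_pow, ← hc]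
    exact pow_le_pow_left₀ (abs_nonneg _) (abs_pow_sub_pow_le h0 h1 (hn2 τ) (hn1 τ)) 2
  refine ⟨fun τ x u => ?_, fun τ x => ?_, fun τ x => ?_⟩
  · simp only [smul_apply, ContinuousLinearMap.id_apply, map_smul]
    rw [← smul_add, ← sub_smul, norm_smul, norm_smul, norm_smul, mul_pow, mul_pow, mul_pow,
      Real.norm_eq_abs, sq_abs, Real.norm_eq_abs, sq_abs]
    calc _ ≤ (ε / (4 * L)) ^ 2 * (γ ^ n τ) ^ 2 * (2 * L ^ 2 * (‖x‖ ^ 2 + ‖u‖ ^ 2)) :=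
          mul_le_mul (hw1 τ) (norm_add_apply_sq_le hA hB x u) (by positivity) (by positivity)
      _ = (ε / (4 * L)) ^ 2 * (2 * L ^ 2) * ((γ ^ n τ) ^ 2 * (‖x‖ ^ 2 + ‖u‖ ^ 2)) := by ring
      _ ≤ ε ^ 2 * ((γ ^ n τ) ^ 2 * (‖x‖ ^ 2 + ‖u‖ ^ 2)) :=
          mul_le_mul_of_nonneg_right hsq (by positivity)
      _ = _ := by ring
  · exact norm_smul_adjoint_sub_sq_le hA hsq (hw2 τ) x
  · exact norm_smul_adjoint_sub_sq_le hB hsq (hw2 τ) x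

/-- The weight equals `1` at time `m`, so differences at `m` can be read off without loss, while
data at other times are damped. -/
theorem kkt_compare_time {A : X →L[ℝ] X} {B : U →L[ℝ] X} {μ L M : ℝ} {ℓ : ℕ}
    {g g' : ℕ → X → X} {h h' : ℕ → U → U} {gT : X → X}
    {ζ ζ' y y' p p' : ℕ → X} {v v' : ℕ → U} {x x' : X} (hμ : 0 < μ) (hL : 0 < L) (hM : 0 < M)
    (hA : ‖A‖ ≤ L) (hB : ‖B‖ ≤ L) (hAB : DualBound A B 1 M ℓ)
    (hg : ∀ τ < ℓ, WMono μ L (ContinuousLinearMap.id ℝ X) (g τ))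
    (hgT : WMono μ L (ContinuousLinearMap.id ℝ X) gT)
    (hh : ∀ τ < ℓ, WMono μ L (ContinuousLinearMap.id ℝ U) (h τ))
    (hk : IsKKT A B g h ζ x ℓ y v p) (hpℓ : p ℓ = gT (y ℓ))
    (hk' : IsKKT A B g' h' ζ' x' ℓ y' v' p') (m : ℕ) {ω : ℕ → ℝ}
    (hω : ω = fun τ : ℕ => decayRate μ L M ^ ((τ : ℤ) - (m : ℤ)).natAbs) :
    ∑ τ ∈ Finset.range (ℓ + 1), (ω τ * ‖y τ - y' τ‖) ^ 2 +
        ∑ τ ∈ Finset.range ℓ, (ω τ * ‖v τ - v' τ‖) ^ 2 +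
        ∑ τ ∈ Finset.range (ℓ + 1), (ω τ * ‖p τ - p' τ‖) ^ 2 ≤
      4 * kktConst μ L M * ((ω 0 * ‖x - x'‖) ^ 2 +
        ∑ τ ∈ Finset.range ℓ, (ω (τ + 1) * ‖ζ τ - ζ' τ‖) ^ 2 +
        ∑ τ ∈ Finset.range ℓ, (ω τ * ‖g τ (y' τ) - g' τ (y' τ)‖) ^ 2 +
        (ω ℓ * ‖gT (y' ℓ) - p' ℓ‖) ^ 2 +
        ∑ τ ∈ Finset.range ℓ, (ω τ * ‖h τ (v' τ) - h' τ (v' τ)‖) ^ 2) := by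
  have h0 : 0 < decayRate μ L M := decayRate_pos hμ hL hM
  have key := kkt_compare hμ hL hM hAB (kktEps_le hμ hL hM) (almostCommute_time hμ hL hM hA hB m)
    (fun τ hτ => (hg τ hτ).smul) hgT.smul (fun τ hτ => (hh τ hτ).smul) hk hpℓ hk'
  have hωn : ∀ τ : ℕ, decayRate μ L M ^ ((τ : ℤ) - (m : ℤ)).natAbs = ω τ := fun τ => by rw [hω]
  have hω0 : ∀ τ, 0 ≤ ω τ := fun τ => by rw [← hωn]; positivity
  simp only [hωn, smul_apply, ContinuousLinearMap.id_apply, norm_smul, Real.norm_eq_abs,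
    abs_of_nonneg (hω0 _)] at key
  exact key

theorem kkt_compare_terminal_time {A : X →L[ℝ] X} {B : U →L[ℝ] X} {μ L M : ℝ} {ℓ : ℕ}
    {g : ℕ → X → X} {h : ℕ → U → U}
    {ζ ζ' y y' p p' : ℕ → X} {v v' : ℕ → U} {x x' : X} (hμ : 0 < μ) (hL : 0 < L) (hM : 0 < M)
    (hA : ‖A‖ ≤ L) (hB : ‖B‖ ≤ L) (hAB : DualBound A B 0 M ℓ)
    (hg : ∀ τ ≤ ℓ, WMono μ L (ContinuousLinearMap.id ℝ X) (g τ))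
    (hh : ∀ τ < ℓ, WMono μ L (ContinuousLinearMap.id ℝ U) (h τ))
    (hk : IsKKT A B g h ζ x ℓ y v p) (hk' : IsKKT A B g h ζ' x' ℓ y' v' p') (m : ℕ) {ω : ℕ → ℝ}
    (hω : ω = fun τ : ℕ => decayRate μ L M ^ ((τ : ℤ) - (m : ℤ)).natAbs) :
    ∑ τ ∈ Finset.range (ℓ + 1), (ω τ * ‖y τ - y' τ‖) ^ 2 ≤
      4 * kktConst μ L M * ((ω 0 * ‖x - x'‖) ^ 2 + (1 + L ^ 2) * (ω ℓ * ‖y ℓ - y' ℓ‖) ^ 2 +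
        ∑ τ ∈ Finset.range ℓ, (ω (τ + 1) * ‖ζ τ - ζ' τ‖) ^ 2) := by
  have h0 : 0 < decayRate μ L M := decayRate_pos hμ hL hM
  have hac := almostCommute_time (M := M) hμ hL hM hA hB m
  have key := kkt_weighted_le (A := A) (B := B) (M := M) (χ := 0) (ℓ := ℓ)
    (y := fun τ => y τ - y' τ) (g := fun τ => g τ (y τ) - g τ (y' τ))
    -- With a prescribed terminal state the multiplier satisfies no terminal condition. The terminal
    -- gradient is cancelled by a fictitious perturbation, which costs `L ^ 2` times the squared
    -- difference of the terminal states.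
    (q := fun τ => if τ < ℓ then 0 else - (g τ (y τ) - g τ (y' τ)))
    (r := fun τ => ζ τ - ζ' τ) (p := fun τ => p τ - p' τ) (v := fun τ => v τ - v' τ)
    (h := fun τ => h τ (v τ) - h τ (v' τ)) (s := fun τ => 0)
    hμ hL hM hAB (kktEps_le hμ hL hM) (fun τ _ => hac.dyn τ) (fun τ _ => hac.adjA τ)
    (fun τ _ => hac.adjB τ)
    (fun τ hτ => by rw [hk.traj.2 τ hτ, hk'.traj.2 τ hτ]; simp only [map_sub]; abel)
    (fun τ hτ => by rw [if_pos hτ, hk.adj τ hτ, hk'.adj τ hτ, map_sub]; abel)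
    (fun τ hτ => by
      have h1 := hk.stat τ hτ
      have h2 := hk'.stat τ hτ
      rw [map_sub, eq_neg_of_add_eq_zero_left h1, eq_neg_of_add_eq_zero_left h2]; abel)
    (fun τ hτ => ((hg τ hτ).smul _ _).1) (fun τ hτ => ((hg τ hτ).smul _ _).2)
    (fun τ hτ => ((hh τ hτ).smul _ _).1) (fun τ hτ => ((hh τ hτ).smul _ _).2)
    (Or.inr ⟨rfl, by simp, rfl⟩)
  have hωn : ∀ τ : ℕ, decayRate μ L M ^ ((τ : ℤ) - (m : ℤ)).natAbs = ω τ := fun τ => by rw [hω]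
  have hω0 : ∀ τ, 0 ≤ ω τ := fun τ => by rw [← hωn]; positivity
  simp only [hωn, smul_apply, ContinuousLinearMap.id_apply, norm_smul, Real.norm_eq_abs,
    abs_of_nonneg (hω0 _), hk.traj.1, hk'.traj.1, norm_zero, mul_zero, Finset.sum_const_zero,
    ne_eq, OfNat.ofNat_ne_zero, not_false_eq_true, zero_pow, add_zero] at key
  have hK := kktConst_pos hμ hL hM
  have hq : ∑ τ ∈ Finset.range (ℓ + 1),
      (ω τ * ‖if τ < ℓ then (0 : X) else - (g τ (y τ) - g τ (y' τ))‖) ^ 2 ≤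
      L ^ 2 * (ω ℓ * ‖y ℓ - y' ℓ‖) ^ 2 := by
    rw [Finset.sum_range_succ, Finset.sum_eq_zero (fun τ hτ => by
      rw [if_pos (Finset.mem_range.1 hτ)]; simp), zero_add, if_neg (lt_irrefl _), norm_neg,
      ← mul_pow]
    refine pow_le_pow_left₀ (mul_nonneg (hω0 _) (norm_nonneg _)) ?_ 2
    have := ((hg ℓ le_rfl) (y ℓ) (y' ℓ)).2
    simp only [ContinuousLinearMap.id_apply] at this
    calc _ ≤ ω ℓ * (L * ‖y ℓ - y' ℓ‖) := mul_le_mul_of_nonneg_left this (hω0 _)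
      _ = _ := by ring
  have h1 : 0 ≤ ∑ τ ∈ Finset.range ℓ, (ω τ * ‖v τ - v' τ‖) ^ 2 :=
    Finset.sum_nonneg fun _ _ => sq_nonneg _
  have h2 : 0 ≤ ∑ τ ∈ Finset.range (ℓ + 1), (ω τ * ‖p τ - p' τ‖) ^ 2 :=
    Finset.sum_nonneg fun _ _ => sq_nonneg _
  have h3 := mul_le_mul_of_nonneg_left hq (show 0 ≤ 4 * kktConst μ L M by positivity)
  linarith

end Comparison

theorem sum_sq_le_sq_sum {ι : Type*} (s : Finset ι) {c : ι → ℝ} (hc : ∀ i ∈ s, 0 ≤ c i) :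
    ∑ i ∈ s, c i ^ 2 ≤ (∑ i ∈ s, c i) ^ 2 := by
  rw [sq, Finset.sum_mul]
  refine Finset.sum_le_sum fun i hi => ?_
  rw [sq]
  exact mul_le_mul_of_nonneg_left (Finset.single_le_sum hc hi) (hc i hi)

theorem weighted_sum_le_sq {a b c s K L i : ℝ} (ha : 0 ≤ a) (hb : 0 ≤ b) (hc : 0 ≤ c) (hi : 1 ≤ i)
    (hs : s ≤ (i * c) ^ 2) (hK : 0 ≤ K) :
    4 * K * (a ^ 2 + (1 + L ^ 2) * b ^ 2 + s) ≤ (√(4 * K * (1 + L ^ 2)) * i * (a + b + c)) ^ 2 := by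
  have hex : (√(4 * K * (1 + L ^ 2)) * i * (a + b + c)) ^ 2 =
      4 * K * ((1 + L ^ 2) * (i ^ 2 * (a + b + c) ^ 2)) := by
    rw [mul_pow, mul_pow, Real.sq_sqrt (by positivity)]; ring
  rw [hex]
  refine mul_le_mul_of_nonneg_left ?_ (by positivity)
  have h4 : 1 ≤ i ^ 2 := one_le_pow₀ hi
  have h5 : a ^ 2 + b ^ 2 + c ^ 2 ≤ (a + b + c) ^ 2 := by
    have h1 := mul_nonneg ha hb
    have h2 := mul_nonneg ha hc
    have h3 := mul_nonneg hb hc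
    linarith [show (a + b + c) ^ 2 = a ^ 2 + b ^ 2 + c ^ 2 + 2 * (a * b) + 2 * (a * c) + 2 * (b * c)
      by ring]
  calc a ^ 2 + (1 + L ^ 2) * b ^ 2 + s
      ≤ (1 + L ^ 2) * a ^ 2 + (1 + L ^ 2) * b ^ 2 + (1 + L ^ 2) * (i * c) ^ 2 := by
        have h6 : 0 ≤ L ^ 2 * a ^ 2 := by positivity
        have h7 : 0 ≤ L ^ 2 * (i * c) ^ 2 := by positivity
        linarith
    _ ≤ (1 + L ^ 2) * (i ^ 2 * a ^ 2) + (1 + L ^ 2) * (i ^ 2 * b ^ 2) +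
        (1 + L ^ 2) * (i ^ 2 * c ^ 2) := by
        rw [mul_pow]
        gcongr
        · exact le_mul_of_one_le_left (sq_nonneg a) h4
        · exact le_mul_of_one_le_left (sq_nonneg b) h4
    _ = (1 + L ^ 2) * (i ^ 2 * (a ^ 2 + b ^ 2 + c ^ 2)) := by ring
    _ ≤ _ := by gcongr

/-! ### Temporal decay with prescribed terminal states -/

namespace NetProblem

variable {N : ℕ} {S : NetProblem N} {L γ σ μ : ℝ} {d κ0 : ℕ}

/-- The weighted comparison of two optimality systems centred at time `m`; the multipliers exist
because controllability is available for `ℓ ≥ d`. -/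
theorem temporalDecay_decayRate (hL : 1 ≤ L) (hμ : 0 < μ) (hσ : 0 < σ) {M : ℝ} (hM0 : 0 < M)
    (hM : ctrlConst L σ d ≤ M) (hS : S.SystemAssumption L γ σ d κ0) (hC : S.CostAssumption L μ) :
    S.TemporalDecay d (√(4 * kktConst μ L M * (1 + L ^ 2)) * (decayRate μ L M)⁻¹)
      (decayRate μ L M) := by
  intro t ℓ ϑ x x' xbar xbar' ζ ζ' y y' v v' hℓ hϑ hsol hsol' m hm
  have hL0 : 0 < L := by linarith
  have hdf : ∀ τ ≤ ℓ, Differentiable ℝ (S.stateCost (t + τ) (ϑ τ)) := fun τ _ =>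
    (hC.state _ _ (hϑ τ)).differentiable
  have hdc : ∀ τ < ℓ, Differentiable ℝ (S.ctrlCost (t + τ + 1) (ϑ τ)) := fun τ _ =>
    (hC.ctrl _ _ (hϑ τ)).differentiable
  obtain ⟨p, hp⟩ := hsol.exists_kkt hσ hS.controllable hℓ hdf hdc
  obtain ⟨p', hp'⟩ := hsol'.exists_kkt hσ hS.controllable hℓ hdf hdc
  have hdb := (dualBound_zero_of_controllable hL hσ hS.normA hS.normB hS.controllable hℓ).mono
    le_rfl hM
  have key := kkt_compare_terminal_time hμ hL0 hM0 hS.normA hS.normB hdb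
    (fun τ _ => (hC.state _ _ (hϑ τ)).wMono) (fun τ _ => (hC.ctrl _ _ (hϑ τ)).wMono) hp hp' m rfl
  have h0 := decayRate_pos hμ hL0 hM0
  have h1 := decayRate_lt_one hμ hL0 hM0
  have hK := kktConst_pos hμ hL0 hM0
  rw [hsol.1.2, hsol'.1.2] at key
  set K := kktConst μ L M
  set δ := decayRate μ L M
  have hm' := Finset.single_le_sum
    (f := fun τ : ℕ => (δ ^ ((τ : ℤ) - (m : ℤ)).natAbs * ‖y τ - y' τ‖) ^ 2)
    (fun _ _ => sq_nonneg _) (Finset.mem_range.2 (Nat.lt_succ_of_le hm))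
  simp only [sub_self, Int.natAbs_zero, pow_zero, one_mul] at hm'
  set a := δ ^ m * ‖x - x'‖ with ha
  set b := δ ^ (ℓ - m) * ‖xbar - xbar'‖ with hb
  set c := ∑ l ∈ Finset.range ℓ, δ ^ ((m : ℤ) - (l : ℤ)).natAbs * ‖ζ l - ζ' l‖ with hc
  have ha0 : 0 ≤ a := by positivity
  have hb0 : 0 ≤ b := by positivity
  have hc0 : 0 ≤ c := Finset.sum_nonneg fun _ _ => by positivity
  have hδ1 : 1 ≤ δ⁻¹ := (one_le_inv₀ h0).2 h1.le
  have e1 : δ ^ (((0 : ℕ) : ℤ) - (m : ℤ)).natAbs * ‖x - x'‖ = a := by simp [ha]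
  have e2 : δ ^ ((ℓ : ℤ) - (m : ℤ)).natAbs * ‖xbar - xbar'‖ = b := by
    rw [hb, show ((ℓ : ℤ) - (m : ℤ)).natAbs = ℓ - m by omega]
  -- The energy estimate weights the disturbance `ζ τ` at the time `τ + 1` at which it acts.
  -- Returning to `τ` costs the factor `δ⁻¹` that appears in the decay constant.
  have e3 : ∑ τ ∈ Finset.range ℓ, (δ ^ (((τ + 1 : ℕ) : ℤ) - (m : ℤ)).natAbs * ‖ζ τ - ζ' τ‖) ^ 2 ≤
      (δ⁻¹ * c) ^ 2 := by
    rw [hc, Finset.mul_sum]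
    refine le_trans (Finset.sum_le_sum fun τ _ => ?_)
      (sum_sq_le_sq_sum _ fun _ _ => by positivity)
    refine pow_le_pow_left₀ (by positivity) ?_ 2
    rw [← mul_assoc]
    refine mul_le_mul_of_nonneg_right ?_ (norm_nonneg _)
    rw [inv_mul_eq_div, le_div_iff₀ h0, ← pow_succ]
    exact pow_le_pow_of_le_one h0.le h1.le (by omega)
  rw [e1, e2] at key
  have hfin : ‖y m - y' m‖ ^ 2 ≤ (√(4 * K * (1 + L ^ 2)) * δ⁻¹ * (a + b + c)) ^ 2 := by
    exact (hm'.trans key).trans (weighted_sum_le_sq ha0 hb0 hc0 hδ1 e3 hK.le)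
  exact abs_le_of_sq_le_sq' hfin (by positivity) |>.2

theorem TemporalDecay.mono {Ω Ω' δ δ' : ℝ} (h : S.TemporalDecay d Ω δ) (hΩ : Ω ≤ Ω')
    (hΩ0 : 0 ≤ Ω) (hδ0 : 0 ≤ δ) (hδ : δ ≤ δ') : S.TemporalDecay d Ω' δ' := by
  intro t ℓ ϑ x x' xbar xbar' ζ ζ' y y' v v' hℓ hϑ hsol hsol' m hm
  refine (h t ℓ ϑ x x' xbar xbar' ζ ζ' y y' v v' hℓ hϑ hsol hsol' m hm).trans ?_
  have hδ' : 0 ≤ δ' := hδ0.trans hδ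
  refine mul_le_mul hΩ ?_ ?_ (hΩ0.trans hΩ)
  · gcongr
  · have : 0 ≤ ∑ l ∈ Finset.range ℓ, δ ^ ((m : ℤ) - (l : ℤ)).natAbs * ‖ζ l - ζ' l‖ :=
      Finset.sum_nonneg fun _ _ => by positivity
    positivity

end NetProblem

end

section

/-! ### Node-wise scalings, separable costs and truncations -/

section Nodes

open ContinuousLinearMap (adjoint)

variable {N : ℕ} {n m : Fin N → ℕ} {G : SimpleGraph (Fin N)}

/-- Multiplication of the blocks by scalars. -/
def nodeScale (n : Fin N → ℕ) (a : Fin N → ℝ) : Stack n →L[ℝ] Stack n :=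
  LinearMap.toContinuousLinearMap
    { toFun := fun z => WithLp.toLp 2 (fun j => a j • z j)
      map_add' := by intro y z; ext j : 1; simp
      map_smul' := by
        intro b z
        ext j : 1
        exact smul_comm (a j) b (z j) }

@[simp] theorem nodeScale_apply (a : Fin N → ℝ) (z : Stack n) (j : Fin N) :
    nodeScale n a z j = a j • z j := rfl

open Classical in
theorem trunc_eq_nodeScale (κ : ℕ) (i : Fin N) :
    trunc G n κ i = nodeScale n (fun j => if j ∈ hop G κ i then 1 else 0) := by
  ext z j : 2
  simp [trunc]

theorem stack_inner (x y : Stack n) : inner ℝ x y = ∑ j, inner ℝ (x j) (y j) :=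
  PiLp.inner_apply x y

theorem stack_norm_sq (x : Stack n) : ‖x‖ ^ 2 = ∑ j, ‖x j‖ ^ 2 := PiLp.norm_sq_eq_of_L2 _ x

theorem norm_block_le (x : Stack n) (j : Fin N) : ‖x j‖ ≤ ‖x‖ := PiLp.norm_apply_le x j

theorem adjoint_nodeScale (a : Fin N → ℝ) : adjoint (nodeScale n a) = nodeScale n a := by
  symm
  rw [ContinuousLinearMap.eq_adjoint_iff]
  intro x y
  simp only [stack_inner, nodeScale_apply, real_inner_smul_left, real_inner_smul_right]

theorem norm_nodeScale_le {a : Fin N → ℝ} {c : ℝ} (hc : 0 ≤ c) (ha : ∀ j, |a j| ≤ c) (z : Stack n) :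
    ‖nodeScale n a z‖ ≤ c * ‖z‖ := by
  refine abs_le_of_sq_le_sq' ?_ (by positivity) |>.2
  rw [mul_pow, stack_norm_sq, stack_norm_sq, Finset.mul_sum]
  refine Finset.sum_le_sum fun j _ => ?_
  rw [nodeScale_apply, norm_smul, mul_pow]
  exact mul_le_mul_of_nonneg_right (pow_le_pow_left₀ (norm_nonneg _) (ha j) 2) (sq_nonneg _)

theorem adjoint_trunc (κ : ℕ) (i : Fin N) : adjoint (trunc G n κ i) = trunc G n κ i := by
  rw [trunc_eq_nodeScale, adjoint_nodeScale]

theorem trunc_trunc (κ : ℕ) (i : Fin N) (z : Stack n) :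
    trunc G n κ i (trunc G n κ i z) = trunc G n κ i z := by
  rw [trunc_eq_nodeScale]
  ext j : 1
  by_cases h : j ∈ hop G κ i <;> simp [h]

theorem norm_trunc_le (κ : ℕ) (i : Fin N) (z : Stack n) : ‖trunc G n κ i z‖ ≤ ‖z‖ := by
  rw [trunc_eq_nodeScale]
  refine (norm_nodeScale_le zero_le_one (fun j => ?_) z).trans (by rw [one_mul])
  split_ifs <;> simp

/-- Block-wise strong monotonicity and Lipschitz continuity. -/
def NodeMono (μ L : ℝ) (g : Stack n → Stack n) : Prop :=
  ∀ y y' j, μ * ‖y j - y' j‖ ^ 2 ≤ inner ℝ (g y j - g y' j) (y j - y' j) ∧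
    ‖g y j - g y' j‖ ≤ L * ‖y j - y' j‖

theorem NodeMono.wMono {μ L : ℝ} {g : Stack n → Stack n} (hL : 0 ≤ L) (h : NodeMono μ L g)
    (a : Fin N → ℝ) : WMono μ L (nodeScale n a) g := by
  intro y y'
  constructor
  · rw [stack_norm_sq, stack_inner, Finset.mul_sum]
    refine Finset.sum_le_sum fun j _ => ?_
    simp only [nodeScale_apply, norm_smul, mul_pow, real_inner_smul_left, real_inner_smul_right,
      Real.norm_eq_abs, sq_abs, PiLp.sub_apply]
    have := mul_le_mul_of_nonneg_left (h y y' j).1 (sq_nonneg (a j))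
    linarith
  · refine abs_le_of_sq_le_sq' ?_ (by positivity) |>.2
    rw [mul_pow, stack_norm_sq, stack_norm_sq, Finset.mul_sum]
    refine Finset.sum_le_sum fun j _ => ?_
    simp only [nodeScale_apply, norm_smul, mul_pow, PiLp.sub_apply]
    have h2 := pow_le_pow_left₀ (norm_nonneg _) (h y y' j).2 2
    rw [mul_pow] at h2
    have := mul_le_mul_of_nonneg_left h2 (sq_nonneg ‖a j‖)
    linarith

theorem nodeScale_one : nodeScale n (fun _ => 1) = ContinuousLinearMap.id ℝ (Stack n) := by
  ext z j : 2; simp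

theorem NodeMono.wMono_id {μ L : ℝ} {g : Stack n → Stack n} (hL : 0 ≤ L) (h : NodeMono μ L g) :
    WMono μ L (ContinuousLinearMap.id ℝ (Stack n)) g := by
  rw [← nodeScale_one]; exact h.wMono hL _

theorem nodeMono_smul {μ L s : ℝ} (hμ : 0 < μ) (h1 : μ ≤ s) (h2 : s ≤ L) :
    NodeMono μ L (fun y : Stack n => s • y) := by
  intro y y' j
  simp only [PiLp.smul_apply, ← smul_sub, real_inner_smul_left, real_inner_self_eq_norm_sq,
    norm_smul, Real.norm_eq_abs, abs_of_pos (hμ.trans_le h1)]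
  exact ⟨mul_le_mul_of_nonneg_right h1 (sq_nonneg _), mul_le_mul_of_nonneg_right h2 (norm_nonneg _)⟩

/-- Block-wise Lipschitz continuity and `g 0 = 0` make the blocks of `g y` vanish wherever those of
`y` do. The gradients of separable costs therefore preserve truncated states. -/
theorem NodeMono.trunc_eq {μ L : ℝ} {g : Stack n → Stack n} (h : NodeMono μ L g) (h0 : g 0 = 0)
    {κ : ℕ} {i : Fin N} {y : Stack n} (hy : trunc G n κ i y = y) :
    trunc G n κ i (g y) = g y := by
  rw [trunc_eq_nodeScale] at hy ⊢
  ext j : 1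
  rw [nodeScale_apply]
  by_cases hj : j ∈ hop G κ i
  · simp [hj]
  · have h1 : y j = 0 := by rw [← hy, nodeScale_apply]; simp [hj]
    have h2 := (h y 0 j).2
    rw [h0, h1] at h2
    simp only [PiLp.zero_apply, sub_zero, norm_zero, mul_zero] at h2
    rw [norm_le_zero_iff.1 h2, smul_zero]

theorem inner_single_right (j : Fin N) (w : EuclideanSpace ℝ (Fin (n j))) (z : Stack n) :
    inner ℝ z (PiLp.single 2 j w : Stack n) = inner ℝ (z j) w := by
  rw [stack_inner, Finset.sum_eq_single j]
  · simp
  · intro i _ hi; simp [hi]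
  · simp

/-- For a separable function, block `j` of the gradient depends on block `j` of the argument only.
The inequalities for one block thus follow from those for the whole function, applied to two points
that differ in this block alone. -/
theorem nodeMono_gradient {μ L : ℝ} {f : Stack n → ℝ}
    {φ : ∀ i : Fin N, EuclideanSpace ℝ (Fin (n i)) → ℝ} (hfφ : ∀ x, f x = ∑ i, φ i (x i))
    (hf : WellConditioned μ L f) : NodeMono μ L (gradient f) := by
  have hloc : ∀ (y z : Stack n) (j : Fin N), y j = z j → gradient f y j = gradient f z j := by
    intro y z j hj
    refine ext_inner_right ℝ fun w => ?_
    rw [← inner_single_right, ← inner_single_right]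
    have h1 := hasDerivAt_comp_line (hf.differentiable y) (PiLp.single 2 j w : Stack n)
    have h2 := hasDerivAt_comp_line (hf.differentiable z) (PiLp.single 2 j w : Stack n)
    have e : (fun t : ℝ => f (y + t • (PiLp.single 2 j w : Stack n))) =
        fun t : ℝ => f (z + t • (PiLp.single 2 j w : Stack n)) + (f y - f z) := by
      funext t
      simp only [hfφ]
      rw [← Finset.sum_sub_distrib, ← Finset.sum_add_distrib]
      refine Finset.sum_congr rfl fun i _ => ?_
      by_cases hi : i = j
      · subst hi; simp [hj]
      · simp [hi]
    rw [e] at h1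
    exact h1.unique (h2.add_const _)
  intro y y' j
  set z : Stack n := y' + PiLp.single 2 j (y j - y' j) with hz
  have hzj : y j = z j := by simp [hz]
  have hzs : z - y' = PiLp.single 2 j (y j - y' j) := by rw [hz]; abel
  have hnorm : ‖z - y'‖ = ‖y j - y' j‖ := by rw [hzs, PiLp.norm_single]
  rw [hloc y z j hzj]
  constructor
  · have h1 := hf.monotone_gradient z y'
    rw [hnorm, hzs, inner_single_right] at h1
    exact h1
  · have h1 := hf.norm_gradient_sub_le z y'
    rw [hnorm] at h1
    exact (norm_block_le (gradient f z - gradient f y') j).trans h1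

theorem IsNetworked.adjoint {M : Stack m →L[ℝ] Stack n} (h : IsNetworked G M) :
    IsNetworked G (adjoint M) := by
  intro i j hij hadj z
  refine ext_inner_right ℝ fun w => ?_
  rw [← inner_single_right, ContinuousLinearMap.adjoint_inner_left, real_inner_comm,
    inner_single_right, h j i (Ne.symm hij) (fun h' => hadj h'.symm) w]
  simp

theorem stack_eq_sum_single (y : Stack m) : y = ∑ j, (PiLp.single 2 j (y j) : Stack m) := by
  ext i : 1
  rw [WithLp.ofLp_sum, Finset.sum_apply, Finset.sum_eq_single i]
  · simp
  · intro j _ hj; simp [hj.symm]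
  · simp

/-- Networked operators almost commute with node-wise weights that vary slowly along edges. -/
theorem norm_nodeScale_comm_sq_le {M : Stack m →L[ℝ] Stack n} (hM : IsNetworked G M) {L : ℝ}
    (hML : ‖M‖ ≤ L) {W : Fin N → ℕ} (hW : ∀ i j, G.Adj i j → W i ≤ W j + 1) {γ : ℝ}
    (h0 : 0 < γ) (h1 : γ < 1) (y : Stack m) :
    ‖nodeScale n (fun j => γ ^ W j) (M y) - M (nodeScale m (fun j => γ ^ W j) y)‖ ^ 2 ≤
      (γ⁻¹ - 1) ^ 2 * (3 * L ^ 2) * ‖nodeScale m (fun j => γ ^ W j) y‖ ^ 2 := by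
  classical
  set T := Finset.univ.image W with hT
  -- The vector is decomposed according to the level of the weight. A networked operator maps level
  -- `w` into the levels `w - 1`, `w`, `w + 1`, so each block of the commutator has at most three
  -- terms. This is the factor `3`; the degrees of the graph do not enter.
  set P : ℕ → Stack m := fun w => nodeScale m (fun j => if W j = w then 1 else 0) y with hP
  have hPj : ∀ w j, P w j = if W j = w then y j else 0 := by
    intro w j; simp only [hP, nodeScale_apply]; split_ifs <;> simp
  have hsum : ∑ w ∈ T, P w = y := by
    ext j : 1
    rw [WithLp.ofLp_sum, Finset.sum_apply, Finset.sum_eq_single (W j)]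
    · rw [hPj, if_pos rfl]
    · intro w _ hw; rw [hPj, if_neg hw.symm]
    · intro h; exact absurd (Finset.mem_image_of_mem W (Finset.mem_univ j)) h
  have hsum2 : ∑ w ∈ T, γ ^ w • P w = nodeScale m (fun j => γ ^ W j) y := by
    ext j : 1
    rw [WithLp.ofLp_sum, Finset.sum_apply, Finset.sum_eq_single (W j)]
    · rw [PiLp.smul_apply, hPj, if_pos rfl, nodeScale_apply]
    · intro w _ hw; rw [PiLp.smul_apply, hPj, if_neg hw.symm, smul_zero]
    · intro h; exact absurd (Finset.mem_image_of_mem W (Finset.mem_univ j)) h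
  have hzero : ∀ i w, ¬ (W i ≤ w + 1 ∧ w ≤ W i + 1) → M (P w) i = 0 := by
    intro i w hiw
    rw [stack_eq_sum_single (P w), map_sum, WithLp.ofLp_sum, Finset.sum_apply]
    refine Finset.sum_eq_zero fun j _ => ?_
    by_cases hj : W j = w
    · subst hj
      refine hM i j ?_ (fun h => hiw ⟨hW i j h, hW j i h.symm⟩) _
      rintro rfl; exact hiw ⟨by omega, by omega⟩
    · have h0 : (PiLp.single 2 j (0 : EuclideanSpace ℝ (Fin (m j))) : Stack m) = 0 := by
        ext k : 1
        by_cases hk : k = j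
        · subst hk; simp
        · simp [hk]
      rw [hPj, if_neg hj, h0, map_zero]; rfl
  have hcomp : ∀ i, (nodeScale n (fun j => γ ^ W j) (M y) - M (nodeScale m (fun j => γ ^ W j) y)) i =
      ∑ w ∈ T, (γ ^ W i - γ ^ w) • M (P w) i := by
    intro i
    rw [PiLp.sub_apply, nodeScale_apply, ← hsum2]
    conv_lhs => rw [← hsum]
    simp only [map_sum, map_smul, WithLp.ofLp_sum, Finset.sum_apply, PiLp.smul_apply,
      Finset.smul_sum, sub_smul, Finset.sum_sub_distrib]
  have hg : 0 ≤ γ⁻¹ - 1 := by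
    have := (one_lt_inv₀ h0).2 h1; linarith
  have hblock : ∀ i, ‖(nodeScale n (fun j => γ ^ W j) (M y) -
      M (nodeScale m (fun j => γ ^ W j) y)) i‖ ^ 2 ≤
      (γ⁻¹ - 1) ^ 2 * 3 * ∑ w ∈ T, (γ ^ w) ^ 2 * ‖M (P w) i‖ ^ 2 := by
    intro i
    rw [hcomp i]
    have e : ∑ w ∈ T, (γ ^ W i - γ ^ w) • M (P w) i =
        ∑ w ∈ T.filter (fun w => W i ≤ w + 1 ∧ w ≤ W i + 1), (γ ^ W i - γ ^ w) • M (P w) i := by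
      rw [Finset.sum_filter]
      refine Finset.sum_congr rfl fun w _ => ?_
      split_ifs with h
      · rfl
      · rw [hzero i w h, smul_zero]
    rw [e]
    set T' := T.filter (fun w => W i ≤ w + 1 ∧ w ≤ W i + 1) with hT'
    have hcard : (T'.card : ℝ) ≤ 3 := by
      have h : T' ⊆ Finset.Icc (W i - 1) (W i + 1) := by
        intro w; simp only [hT', Finset.mem_filter, Finset.mem_Icc]; omega
      have h2 := Finset.card_le_card h
      rw [Nat.card_Icc] at h2
      have h3 : T'.card ≤ 3 := by omega
      exact_mod_cast h3
    have hterm : ∀ w ∈ T', ‖(γ ^ W i - γ ^ w) • M (P w) i‖ ≤ (γ⁻¹ - 1) * (γ ^ w * ‖M (P w) i‖) := by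
      intro w hw
      rw [hT', Finset.mem_filter] at hw
      rw [norm_smul, ← mul_assoc]
      exact mul_le_mul_of_nonneg_right (abs_pow_sub_pow_le h0 h1 hw.2.1 hw.2.2) (norm_nonneg _)
    calc ‖∑ w ∈ T', (γ ^ W i - γ ^ w) • M (P w) i‖ ^ 2
        ≤ (∑ w ∈ T', (γ⁻¹ - 1) * (γ ^ w * ‖M (P w) i‖)) ^ 2 :=
          pow_le_pow_left₀ (norm_nonneg _) ((norm_sum_le _ _).trans (Finset.sum_le_sum hterm)) 2
      _ ≤ T'.card * ∑ w ∈ T', ((γ⁻¹ - 1) * (γ ^ w * ‖M (P w) i‖)) ^ 2 := sq_sum_le_card_mul_sum_sq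
      _ ≤ 3 * ∑ w ∈ T', ((γ⁻¹ - 1) * (γ ^ w * ‖M (P w) i‖)) ^ 2 :=
          mul_le_mul_of_nonneg_right hcard (Finset.sum_nonneg fun _ _ => sq_nonneg _)
      _ ≤ 3 * ∑ w ∈ T, ((γ⁻¹ - 1) * (γ ^ w * ‖M (P w) i‖)) ^ 2 :=
          mul_le_mul_of_nonneg_left (Finset.sum_le_sum_of_subset_of_nonneg
            (Finset.filter_subset _ _) fun _ _ _ => sq_nonneg _) (by norm_num)
      _ = _ := by
          rw [mul_comm ((γ⁻¹ - 1) ^ 2), mul_assoc]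
          congr 1
          rw [Finset.mul_sum]
          exact Finset.sum_congr rfl fun w _ => by ring
  rw [stack_norm_sq]
  calc ∑ i, ‖(nodeScale n (fun j => γ ^ W j) (M y) - M (nodeScale m (fun j => γ ^ W j) y)) i‖ ^ 2
      ≤ ∑ i, (γ⁻¹ - 1) ^ 2 * 3 * ∑ w ∈ T, (γ ^ w) ^ 2 * ‖M (P w) i‖ ^ 2 :=
        Finset.sum_le_sum fun i _ => hblock i
    _ = (γ⁻¹ - 1) ^ 2 * 3 * ∑ w ∈ T, (γ ^ w) ^ 2 * ‖M (P w)‖ ^ 2 := by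
        rw [← Finset.mul_sum, Finset.sum_comm]
        simp_rw [← Finset.mul_sum, ← stack_norm_sq]
    _ ≤ (γ⁻¹ - 1) ^ 2 * 3 * ∑ w ∈ T, (γ ^ w) ^ 2 * (L ^ 2 * ‖P w‖ ^ 2) := by
        refine mul_le_mul_of_nonneg_left (Finset.sum_le_sum fun w _ => ?_) (by positivity)
        rw [← mul_pow L]
        exact mul_le_mul_of_nonneg_left
          (pow_le_pow_left₀ (norm_nonneg _) (M.le_of_opNorm_le hML _) 2) (sq_nonneg _)
    _ = (γ⁻¹ - 1) ^ 2 * (3 * L ^ 2) * ∑ j, ∑ w ∈ T, (γ ^ w) ^ 2 * ‖P w j‖ ^ 2 := by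
        rw [Finset.sum_comm]
        simp_rw [← Finset.mul_sum, ← stack_norm_sq]
        rw [Finset.mul_sum, Finset.mul_sum]
        exact Finset.sum_congr rfl fun w _ => by ring
    _ = _ := by
        congr 1
        rw [stack_norm_sq]
        refine Finset.sum_congr rfl fun j _ => ?_
        rw [Finset.sum_eq_single (W j), hPj, if_pos rfl, nodeScale_apply, norm_smul, mul_pow,
          Real.norm_eq_abs, sq_abs]
        · intro w _ hw; rw [hPj, if_neg hw.symm]; simp
        · intro h; exact absurd (Finset.mem_image_of_mem W (Finset.mem_univ j)) h

theorem almostCommute_space {A : Stack n →L[ℝ] Stack n} {B : Stack m →L[ℝ] Stack n} {μ L M : ℝ}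
    (hμ : 0 < μ) (hL : 0 < L) (hM : 0 < M) (hA : ‖A‖ ≤ L) (hB : ‖B‖ ≤ L) (hnA : IsNetworked G A)
    (hnB : IsNetworked G B) {W : Fin N → ℕ} (hW : ∀ i j, G.Adj i j → W i ≤ W j + 1) :
    AlmostCommute A B (kktEps μ L M) (fun _ => nodeScale n (fun j => decayRate μ L M ^ W j))
      (fun _ => nodeScale m (fun j => decayRate μ L M ^ W j)) := by
  have hc : (decayRate μ L M)⁻¹ - 1 = kktEps μ L M / (4 * L) := inv_decayRate_sub_one
  have h0 : 0 < decayRate μ L M := decayRate_pos hμ hL hM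
  have h1 : decayRate μ L M < 1 := decayRate_lt_one hμ hL hM
  set γ := decayRate μ L M
  set ε := kktEps μ L M
  -- The denominator `4 * L` in `decayRate` leaves room for the three levels and for adding the
  -- contributions of `A` and `B`.
  have hsq : (γ⁻¹ - 1) ^ 2 * (3 * L ^ 2) = 3 / 16 * ε ^ 2 := by rw [hc]; field_simp; norm_num
  have hε : 0 ≤ ε ^ 2 := sq_nonneg ε
  refine ⟨fun τ x u => ?_, fun τ x => ?_, fun τ x => ?_⟩
  · have h2 := norm_nodeScale_comm_sq_le hnA hA hW h0 h1 x
    have h3 := norm_nodeScale_comm_sq_le hnB hB hW h0 h1 u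
    rw [hsq] at h2 h3
    have e : nodeScale n (fun j => γ ^ W j) (A x + B u) -
        (A (nodeScale n (fun j => γ ^ W j) x) + B (nodeScale m (fun j => γ ^ W j) u)) =
        (nodeScale n (fun j => γ ^ W j) (A x) - A (nodeScale n (fun j => γ ^ W j) x)) +
        (nodeScale n (fun j => γ ^ W j) (B u) - B (nodeScale m (fun j => γ ^ W j) u)) := by
      rw [map_add]; abel
    rw [e]
    refine (norm_add_sq_le_two_mul _ _).trans ?_
    have h4 : 0 ≤ ε ^ 2 * (‖nodeScale n (fun j => γ ^ W j) x‖ ^ 2 +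
      ‖nodeScale m (fun j => γ ^ W j) u‖ ^ 2) := by positivity
    linarith
  · have h2 := norm_nodeScale_comm_sq_le (L := L) hnA.adjoint
      (by rw [LinearIsometryEquiv.norm_map]; exact hA) hW h0 h1 x
    rw [hsq] at h2
    have h4 : 0 ≤ ε ^ 2 * ‖nodeScale n (fun j => γ ^ W j) x‖ ^ 2 := by positivity
    linarith
  · have h2 := norm_nodeScale_comm_sq_le (L := L) hnB.adjoint
      (by rw [LinearIsometryEquiv.norm_map]; exact hB) hW h0 h1 x
    rw [hsq] at h2
    have h4 : 0 ≤ ε ^ 2 * ‖nodeScale n (fun j => γ ^ W j) x‖ ^ 2 := by positivity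
    linarith

/-- Slowly varying weights that vanish at `i` and equal `r` outside the neighbourhood of `i`. If the
neighbourhood is the whole component of `i`, then `r` is arbitrary. -/
theorem exists_weight (G : SimpleGraph (Fin N)) (i : Fin N) {κ r : ℕ} (h : r ≤ κ ∨ N ≤ κ) :
    ∃ W : Fin N → ℕ, W i = 0 ∧ (∀ j j', G.Adj j j' → W j ≤ W j' + 1) ∧
      ∀ j, j ∉ hop G κ i → W j = r := by
  -- The graph distance from `i`, capped at `r`.
  refine ⟨fun j => (min (G.edist i j) (r : ℕ∞)).toNat, by simp, fun j j' hjj => ?_, fun j hj => ?_⟩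
  · have h1 : G.edist i j ≤ G.edist i j' + 1 := by
      have h := SimpleGraph.edist_triangle (G := G) (u := i) (v := j') (w := j)
      rwa [SimpleGraph.edist_eq_one_iff_adj.2 hjj.symm] at h
    have h2 : min (G.edist i j) (r : ℕ∞) ≤ min (G.edist i j') (r : ℕ∞) + 1 := by
      rw [← min_add_add_right]
      exact min_le_min h1 (le_self_add)
    have h3 : min (G.edist i j') (r : ℕ∞) ≠ ⊤ := ne_top_of_le_ne_top (ENat.natCast_ne_top r) (min_le_right _ _)
    have h4 := ENat.toNat_le_toNat h2 (by simp [h3])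
    rwa [ENat.toNat_add h3 (by simp), ENat.toNat_one] at h4
  · have hj' : (κ : ℕ∞) < G.edist i j := by simpa [hop] using hj
    have h1 : (r : ℕ∞) ≤ G.edist i j := by
      rcases h with h | h
      · exact le_trans (by exact_mod_cast h) hj'.le
      -- Paths have fewer than `N` edges, so a node outside a neighbourhood of radius at least `N`
      -- is unreachable and its infinite distance is capped at `r`.
      · have : ¬ G.Reachable i j := by
          intro hr
          obtain ⟨p, hp⟩ := hr.exists_isPath
          have h2 := hp.length_lt
          rw [Fintype.card_fin] at h2
          have h3 : G.edist i j ≤ (p.length : ℕ∞) := SimpleGraph.edist_le p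
          have h4 : (κ : ℕ∞) < (p.length : ℕ∞) := hj'.trans_le h3
          have h5 : κ < p.length := by exact_mod_cast h4
          omega
        rw [SimpleGraph.edist_eq_top_of_not_reachable this]
        exact le_top
    simp only [min_eq_right h1, ENat.toNat_natCast]

end Nodes

end

section

/-! ### Truncated optimality systems -/

section Truncated

open ContinuousLinearMap (adjoint)

variable {N : ℕ} {n m : Fin N → ℕ} {G : SimpleGraph (Fin N)}

/-- Constant of the spatial decay. -/
def spaceConst (μ L M : ℝ) : ℝ := 4 * kktConst μ L M * (2 + 16 * L ^ 2 * kktConst μ L M)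

theorem spaceConst_pos {μ L M : ℝ} (hμ : 0 < μ) (hL : 0 < L) (hM : 0 < M) :
    0 < spaceConst μ L M := by
  have := kktConst_pos hμ hL hM
  rw [spaceConst]; positivity

/-- The solution of an optimality system is bounded by its data. -/
theorem kkt_norm_le {X U : Type*} [NormedAddCommGroup X] [InnerProductSpace ℝ X] [CompleteSpace X]
    [NormedAddCommGroup U] [InnerProductSpace ℝ U] [CompleteSpace U]
    {A : X →L[ℝ] X} {B : U →L[ℝ] X} {μ L M : ℝ} {ℓ : ℕ}
    {g : ℕ → X → X} {h : ℕ → U → U} {gT : X → X}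
    {ζ y p : ℕ → X} {v : ℕ → U} {x : X} (hμ : 0 < μ) (hL : 0 < L) (hM : 0 < M)
    (hAB : DualBound A B 1 M ℓ) (hg : ∀ τ < ℓ, WMono μ L (ContinuousLinearMap.id ℝ X) (g τ))
    (hgT : WMono μ L (ContinuousLinearMap.id ℝ X) gT)
    (hh : ∀ τ < ℓ, WMono μ L (ContinuousLinearMap.id ℝ U) (h τ))
    (hg0 : ∀ τ < ℓ, g τ 0 = 0) (hgT0 : gT 0 = 0) (hh0 : ∀ τ < ℓ, h τ 0 = 0)
    (hk : IsKKT A B g h ζ x ℓ y v p) (hpℓ : p ℓ = gT (y ℓ)) :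
    ∑ τ ∈ Finset.range (ℓ + 1), ‖y τ‖ ^ 2 + ∑ τ ∈ Finset.range ℓ, ‖v τ‖ ^ 2 +
        ∑ τ ∈ Finset.range (ℓ + 1), ‖p τ‖ ^ 2 ≤
      4 * kktConst μ L M * (‖x‖ ^ 2 + ∑ τ ∈ Finset.range ℓ, ‖ζ τ‖ ^ 2) := by
  have h0 : IsKKT A B (fun _ _ => 0) (fun _ _ => 0) (fun _ => 0) 0 ℓ (fun _ => 0) (fun _ => 0)
      (fun _ => 0) := ⟨⟨rfl, fun _ _ => by simp⟩, fun _ _ => by simp, fun _ _ => by simp⟩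
  have key := kkt_compare (ε := 0) hμ hL hM hAB (by simp) (almostCommute_one A B) hg hgT hh hk hpℓ h0
  simp only [sub_zero, ContinuousLinearMap.id_apply, hgT0, norm_zero] at key
  refine key.trans (le_of_eq ?_)
  rw [Finset.sum_eq_zero (s := Finset.range ℓ) (f := fun τ => ‖g τ 0‖ ^ 2) (fun τ hτ => by
      rw [hg0 τ (Finset.mem_range.1 hτ)]; simp),
    Finset.sum_eq_zero (s := Finset.range ℓ) (f := fun τ => ‖h τ 0‖ ^ 2) (fun τ hτ => by
      rw [hh0 τ (Finset.mem_range.1 hτ)]; simp)]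
  ring

theorem norm_nodeScale_sub_trunc_le {κ r : ℕ} {i : Fin N} {γ : ℝ} (h0 : 0 < γ) {W : Fin N → ℕ}
    (hW : ∀ j, j ∉ hop G κ i → W j = r) (z : Stack n) :
    ‖nodeScale n (fun j => γ ^ W j) (z - trunc G n κ i z)‖ ≤ γ ^ r * ‖z‖ := by
  classical
  have : nodeScale n (fun j => γ ^ W j) (z - trunc G n κ i z) =
      nodeScale n (fun j => if j ∈ hop G κ i then 0 else γ ^ r) z := by
    rw [trunc_eq_nodeScale]
    ext j : 1
    by_cases h : j ∈ hop G κ i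
    · simp [h]
    · simp [h, hW j h]
  rw [this]
  refine norm_nodeScale_le (by positivity) (fun j => ?_) z
  split_ifs
  · simp; positivity
  · rw [abs_of_nonneg (by positivity)]

/-- With `P` the truncation, the truncated solution with multipliers `P p'` solves the untruncated
system up to residuals `z - P z`. These vanish on the neighbourhood of `i`, and outside it the
weight is `γ ^ r`, while at node `i` it is `1`. The dual bound for the truncated dynamics is needed
only to bound the residuals by the data. -/
theorem trunc_compare {A : Stack n →L[ℝ] Stack n} {B : Stack m →L[ℝ] Stack n} {μ L M : ℝ}
    (hμ : 0 < μ) (hL : 0 < L) (hM : 0 < M) (hA : ‖A‖ ≤ L) (hB : ‖B‖ ≤ L) (hnA : IsNetworked G A)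
    (hnB : IsNetworked G B) {κ r ℓ : ℕ} {i : Fin N} (hr : r ≤ κ ∨ N ≤ κ) (hℓ : 0 < ℓ)
    (hAB : DualBound A B 1 M ℓ)
    (hAB' : DualBound (trunc G n κ i ∘L A) (trunc G n κ i ∘L B) 1 M ℓ)
    {g : ℕ → Stack n → Stack n} {h : ℕ → Stack m → Stack m} {gT : Stack n → Stack n}
    {ζ y y' p p' : ℕ → Stack n} {v v' : ℕ → Stack m} {x : Stack n}
    (hg : ∀ τ < ℓ, NodeMono μ L (g τ)) (hgT : NodeMono μ L gT) (hh : ∀ τ < ℓ, NodeMono μ L (h τ))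
    (hg0 : ∀ τ < ℓ, g τ 0 = 0) (hgT0 : gT 0 = 0) (hh0 : ∀ τ < ℓ, h τ 0 = 0)
    (hk : IsKKT A B g h ζ x ℓ y v p) (hpℓ : p ℓ = gT (y ℓ))
    (hk' : IsKKT (trunc G n κ i ∘L A) (trunc G n κ i ∘L B) g h (fun τ => trunc G n κ i (ζ τ))
      (trunc G n κ i x) ℓ y' v' p') (hpℓ' : p' ℓ = gT (y' ℓ)) :
    ‖v 0 i - v' 0 i‖ ^ 2 ≤ spaceConst μ L M * (decayRate μ L M ^ r) ^ 2 *
      (‖x‖ ^ 2 + ∑ τ ∈ Finset.range ℓ, ‖ζ τ‖ ^ 2) := by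
  have hK := kktConst_pos hμ hL hM
  have h0 := decayRate_pos hμ hL hM
  obtain ⟨W, hWi, hWadj, hWr⟩ := exists_weight G i hr
  set P := trunc G n κ i with hP
  set K := kktConst μ L M
  set γ := decayRate μ L M
  set Z := ‖x‖ ^ 2 + ∑ τ ∈ Finset.range ℓ, ‖ζ τ‖ ^ 2 with hZ
  have hb := kkt_norm_le hμ hL hM hAB' (fun τ hτ => (hg τ hτ).wMono_id hL.le) (hgT.wMono_id hL.le)
    (fun τ hτ => (hh τ hτ).wMono_id hL.le) hg0 hgT0 hh0 hk' hpℓ'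
  have hPn : ∀ z, ‖P z‖ ≤ ‖z‖ := norm_trunc_le κ i
  have hPsq : ∀ z, ‖P z‖ ^ 2 ≤ ‖z‖ ^ 2 := fun z => pow_le_pow_left₀ (norm_nonneg _) (hPn z) 2
  have hb' : ∑ τ ∈ Finset.range (ℓ + 1), ‖y' τ‖ ^ 2 + ∑ τ ∈ Finset.range ℓ, ‖v' τ‖ ^ 2 +
        ∑ τ ∈ Finset.range (ℓ + 1), ‖p' τ‖ ^ 2 ≤ 4 * K * Z :=
    hb.trans (mul_le_mul_of_nonneg_left
      (add_le_add (hPsq _) (Finset.sum_le_sum fun τ _ => hPsq _)) (by positivity))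
  have hPy : ∀ τ ≤ ℓ, P (y' τ) = y' τ := by
    intro τ hτ
    cases τ with
    | zero => rw [hk'.traj.1, hP, trunc_trunc]
    | succ τ =>
      rw [hk'.traj.2 τ hτ]
      simp only [ContinuousLinearMap.comp_apply, map_add, hP, trunc_trunc]
  have hadjA : ∀ z, adjoint (P ∘L A) z = adjoint A (P z) := fun z => by
    rw [ContinuousLinearMap.adjoint_comp, hP, adjoint_trunc]; rfl
  have hadjB : ∀ z, adjoint (P ∘L B) z = adjoint B (P z) := fun z => by
    rw [ContinuousLinearMap.adjoint_comp, hP, adjoint_trunc]; rfl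
  -- The full adjoint image of the multiplier and the full successor state, before truncation; the
  -- parts that truncation removes are the residuals.
  set q : ℕ → Stack n := fun τ => adjoint A (P (p' (τ + 1))) with hq
  set e : ℕ → Stack n := fun τ => A (y' τ) + B (v' τ) + ζ τ with he
  have hk'' : IsKKT A B (fun τ z => g τ z - (q τ - P (q τ))) h
      (fun τ => ζ τ - (e τ - P (e τ))) (P x) ℓ y' v' (fun τ => P (p' τ)) := by
    refine ⟨⟨hk'.traj.1, fun τ hτ => ?_⟩, fun τ hτ => ?_, fun τ hτ => ?_⟩
    · rw [hk'.traj.2 τ hτ]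
      simp only [ContinuousLinearMap.comp_apply, he, map_add]
      abel
    · have h1 := hk'.adj τ hτ
      rw [hadjA] at h1
      simp only [hq]
      rw [h1, map_add, (hg τ hτ).trunc_eq (hg0 τ hτ) (hPy τ hτ.le)]
      abel
    · have h1 := hk'.stat τ hτ
      rwa [hadjB] at h1
  have key := kkt_compare hμ hL hM hAB (kktEps_le hμ hL hM)
    (almostCommute_space (M := M) hμ hL hM hA hB hnA hnB hWadj)
    (fun τ hτ => (hg τ hτ).wMono hL.le _) (hgT.wMono hL.le _)
    (fun τ hτ => (hh τ hτ).wMono hL.le _) hk hpℓ hk''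
  -- No terminal residual arises, because the block-wise terminal gradient of a truncated state is
  -- truncated.
  have hend : gT (y' ℓ) - P (p' ℓ) = 0 := by
    rw [hpℓ', hgT.trunc_eq hgT0 (hPy ℓ le_rfl), sub_self]
  simp only [hend, map_zero, norm_zero, sub_sub_cancel, sub_self, ne_eq, OfNat.ofNat_ne_zero,
    not_false_eq_true, zero_pow, Finset.sum_const_zero, add_zero] at key
  have hsc : ∀ z : Stack n, ‖nodeScale n (fun j => γ ^ W j) (z - P z)‖ ^ 2 ≤
      (γ ^ r) ^ 2 * ‖z‖ ^ 2 := fun z => by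
    rw [← mul_pow]
    exact pow_le_pow_left₀ (norm_nonneg _) (norm_nodeScale_sub_trunc_le h0 hWr z) 2
  have hlhs : ‖v 0 i - v' 0 i‖ ^ 2 ≤
      ∑ τ ∈ Finset.range ℓ, ‖nodeScale m (fun j => γ ^ W j) (v τ - v' τ)‖ ^ 2 := by
    refine le_trans ?_ (Finset.single_le_sum
      (f := fun τ => ‖nodeScale m (fun j => γ ^ W j) (v τ - v' τ)‖ ^ 2)
      (fun _ _ => sq_nonneg _) (Finset.mem_range.2 hℓ))
    refine pow_le_pow_left₀ (norm_nonneg _) ?_ 2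
    refine le_trans (le_of_eq ?_) (norm_block_le _ i)
    rw [nodeScale_apply, hWi, pow_zero, one_smul, PiLp.sub_apply]
  have hebound : ∑ τ ∈ Finset.range ℓ, ‖nodeScale n (fun j => γ ^ W j) (e τ - P (e τ))‖ ^ 2 ≤
      (γ ^ r) ^ 2 * (4 * L ^ 2 * (∑ τ ∈ Finset.range (ℓ + 1), ‖y' τ‖ ^ 2 +
        ∑ τ ∈ Finset.range ℓ, ‖v' τ‖ ^ 2) + 2 * ∑ τ ∈ Finset.range ℓ, ‖ζ τ‖ ^ 2) := by
    calc _ ≤ ∑ τ ∈ Finset.range ℓ, (γ ^ r) ^ 2 * (4 * L ^ 2 * (‖y' τ‖ ^ 2 + ‖v' τ‖ ^ 2) +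
          2 * ‖ζ τ‖ ^ 2) := by
          refine Finset.sum_le_sum fun τ _ => (hsc _).trans ?_
          refine mul_le_mul_of_nonneg_left ?_ (sq_nonneg _)
          refine (norm_add_sq_le_two_mul _ _).trans ?_
          have := norm_add_apply_sq_le hA hB (y' τ) (v' τ)
          linarith
      _ = (γ ^ r) ^ 2 * (4 * L ^ 2 * (∑ τ ∈ Finset.range ℓ, ‖y' τ‖ ^ 2 +
        ∑ τ ∈ Finset.range ℓ, ‖v' τ‖ ^ 2) + 2 * ∑ τ ∈ Finset.range ℓ, ‖ζ τ‖ ^ 2) := by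
          rw [← Finset.mul_sum, Finset.sum_add_distrib, ← Finset.mul_sum, ← Finset.mul_sum,
            Finset.sum_add_distrib]
      _ ≤ _ := by
          have : ∑ τ ∈ Finset.range ℓ, ‖y' τ‖ ^ 2 ≤ ∑ τ ∈ Finset.range (ℓ + 1), ‖y' τ‖ ^ 2 := by
            rw [Finset.sum_range_succ]; exact le_add_of_nonneg_right (sq_nonneg _)
          gcongr
  have hqbound : ∑ τ ∈ Finset.range ℓ, ‖nodeScale n (fun j => γ ^ W j) (q τ - P (q τ))‖ ^ 2 ≤
      (γ ^ r) ^ 2 * (L ^ 2 * ∑ τ ∈ Finset.range (ℓ + 1), ‖p' τ‖ ^ 2) := by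
    rw [Finset.sum_range_succ', mul_add, mul_add, Finset.mul_sum, Finset.mul_sum]
    refine le_trans (Finset.sum_le_sum fun τ _ => ?_) (le_add_of_nonneg_right (by positivity))
    refine (hsc _).trans (mul_le_mul_of_nonneg_left ?_ (sq_nonneg _))
    rw [← mul_pow]
    refine pow_le_pow_left₀ (norm_nonneg _) ?_ 2
    exact (norm_adjoint_le hA _).trans (mul_le_mul_of_nonneg_left (hPn _) hL.le)
  have hY0 : 0 ≤ ∑ τ ∈ Finset.range (ℓ + 1), ‖nodeScale n (fun j => γ ^ W j) (y τ - y' τ)‖ ^ 2 :=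
    Finset.sum_nonneg fun _ _ => sq_nonneg _
  have hP0 : 0 ≤ ∑ τ ∈ Finset.range (ℓ + 1),
      ‖nodeScale n (fun j => γ ^ W j) (p τ - P (p' τ))‖ ^ 2 :=
    Finset.sum_nonneg fun _ _ => sq_nonneg _
  have hp0 : 0 ≤ ∑ τ ∈ Finset.range (ℓ + 1), ‖p' τ‖ ^ 2 := Finset.sum_nonneg fun _ _ => sq_nonneg _
  have hζ0 : 0 ≤ ∑ τ ∈ Finset.range ℓ, ‖ζ τ‖ ^ 2 := Finset.sum_nonneg fun _ _ => sq_nonneg _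
  set SY := ∑ τ ∈ Finset.range (ℓ + 1), ‖y' τ‖ ^ 2
  set SV := ∑ τ ∈ Finset.range ℓ, ‖v' τ‖ ^ 2
  set SP := ∑ τ ∈ Finset.range (ℓ + 1), ‖p' τ‖ ^ 2
  have hsum : ‖nodeScale n (fun j => γ ^ W j) (x - P x)‖ ^ 2 +
      ∑ τ ∈ Finset.range ℓ, ‖nodeScale n (fun j => γ ^ W j) (e τ - P (e τ))‖ ^ 2 +
      ∑ τ ∈ Finset.range ℓ, ‖nodeScale n (fun j => γ ^ W j) (q τ - P (q τ))‖ ^ 2 ≤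
      (γ ^ r) ^ 2 * ((2 + 16 * L ^ 2 * K) * Z) := by
    refine (add_le_add (add_le_add (hsc x) hebound) hqbound).trans ?_
    rw [← mul_add, ← mul_add]
    refine mul_le_mul_of_nonneg_left ?_ (sq_nonneg _)
    have h1 := mul_le_mul_of_nonneg_left hb' (show 0 ≤ 4 * L ^ 2 by positivity)
    have h2 : 0 ≤ L ^ 2 * SP := by positivity
    have h3 := sq_nonneg ‖x‖
    linarith
  calc ‖v 0 i - v' 0 i‖ ^ 2 ≤ _ := hlhs
    _ ≤ _ := by linarith
    _ ≤ 4 * K * ((γ ^ r) ^ 2 * ((2 + 16 * L ^ 2 * K) * Z)) :=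
        mul_le_mul_of_nonneg_left hsum (by positivity)
    _ = _ := by rw [spaceConst]; ring

end Truncated

end

/-! ### Consequences of the assumptions and optimal trajectories for the true parameters -/

section

theorem WellConditioned.mono {X : Type*} [NormedAddCommGroup X] [InnerProductSpace ℝ X]
    [CompleteSpace X] {μ L L' : ℝ} {f : X → ℝ} (h : WellConditioned μ L f) (hL : L ≤ L') :
    WellConditioned μ L' f :=
  ⟨h.1, h.2.1, fun x x' => (h.2.2 x x').trans (by gcongr)⟩

theorem hasGradientAt_half_norm_sq {X : Type*} [NormedAddCommGroup X] [InnerProductSpace ℝ X]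
    [CompleteSpace X] (s : ℝ) (x : X) : HasGradientAt (fun y : X => s / 2 * ‖y‖ ^ 2) (s • x) x := by
  rw [hasGradientAt_iff_hasFDerivAt]
  have h := ((hasStrictFDerivAt_norm_sq x).hasFDerivAt).const_mul (s / 2)
  have e : InnerProductSpace.toDual ℝ X (s • x) = (s / 2) • (2 • innerSL ℝ x) := by
    ext y
    simp only [InnerProductSpace.toDual_apply_apply, real_inner_smul_left, smul_apply,
      innerSL_apply_apply, smul_eq_mul, nsmul_eq_mul]
    push_cast
    ring
  rw [e]
  exact h

theorem IsKKT.restrict {X U : Type*} [NormedAddCommGroup X] [InnerProductSpace ℝ X]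
    [CompleteSpace X] [NormedAddCommGroup U] [InnerProductSpace ℝ U] [CompleteSpace U]
    {A : X →L[ℝ] X} {B : U →L[ℝ] X} {g : ℕ → X → X} {h : ℕ → U → U} {ζ : ℕ → X} {x : X} {ℓ ℓ' : ℕ}
    {y p : ℕ → X} {v : ℕ → U} (hk : IsKKT A B g h ζ x ℓ y v p) (hℓ : ℓ' ≤ ℓ) :
    IsKKT A B g h ζ x ℓ' y v p :=
  ⟨⟨hk.traj.1, fun τ hτ => hk.traj.2 τ (by omega)⟩, fun τ hτ => hk.adj τ (by omega),
    fun τ hτ => hk.stat τ (by omega)⟩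

namespace NetProblem

variable {N : ℕ} {S : NetProblem N}

/-- The consequences of the assumptions that enter the analysis of the controller. -/
structure Regular (S : NetProblem N) (μ L M : ℝ) (κ0 : ℕ) : Prop where
  μ_pos : 0 < μ
  one_le_L : 1 ≤ L
  le_L : μ ≤ L
  M_pos : 0 < M
  networkedA : IsNetworked S.G S.A
  networkedB : IsNetworked S.G S.B
  normA : ‖S.A‖ ≤ L
  normB : ‖S.B‖ ≤ L
  dual : ∀ ℓ, DualBound S.A S.B 1 M ℓ
  dual_trunc : ∀ κ ≥ κ0, ∀ i ℓ,
    DualBound (trunc S.G S.nx κ i ∘L S.A) (trunc S.G S.nx κ i ∘L S.B) 1 M ℓ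
  state : ∀ t, ∀ θ ∈ S.Θ, WellConditioned μ L (S.stateCost t θ)
  ctrl : ∀ t, ∀ θ ∈ S.Θ, WellConditioned μ L (S.ctrlCost t θ)
  terminal : WellConditioned μ L S.F
  terminal_nonneg : ∀ x, 0 ≤ S.F x
  terminal_grad : ∀ x, ∃ s, μ ≤ s ∧ s ≤ L ∧ gradient S.F x = s • x
  state_nonneg : ∀ t, ∀ θ ∈ S.Θ, ∀ x, 0 ≤ S.stateCost t θ x
  state_grad_zero : ∀ t, ∀ θ ∈ S.Θ, gradient (S.stateCost t θ) 0 = 0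
  ctrl_grad_zero : ∀ t, ∀ θ ∈ S.Θ, gradient (S.ctrlCost t θ) 0 = 0
  ctrl_quad : ∀ t, ∀ θ ∈ S.Θ, ∀ u, μ / 2 * ‖u‖ ^ 2 ≤ S.ctrlCost t θ u
  dist_lip : ∀ t, ∀ θ ∈ S.Θ, ∀ θ' ∈ S.Θ, ‖S.dist t θ - S.dist t θ'‖ ≤ L * ‖θ - θ'‖
  state_lip : ∀ t, ∀ θ ∈ S.Θ, ∀ θ' ∈ S.Θ, ∀ x,
    ‖gradient (S.stateCost t θ) x - gradient (S.stateCost t θ') x‖ ≤ L * ‖θ - θ'‖ * ‖x‖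
  ctrl_lip : ∀ t, ∀ θ ∈ S.Θ, ∀ θ' ∈ S.Θ, ∀ u,
    ‖gradient (S.ctrlCost t θ) u - gradient (S.ctrlCost t θ') u‖ ≤ L * ‖θ - θ'‖ * ‖u‖

/-- Common constant of the dual bounds. -/
def dualConst (L γ σ : ℝ) (d : ℕ) : ℝ := max (stabConst L γ) (ctrlConst L σ d)

theorem dualConst_pos {L γ σ : ℝ} (d : ℕ) (hL : 1 < L) (hγ : γ < 1) : 0 < dualConst L γ σ d := by
  have h : 0 < (1 - γ)⁻¹ := inv_pos.2 (by linarith)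
  have hL0 : 0 < L := by linarith
  refine lt_of_lt_of_le ?_ (le_max_left _ _)
  rw [stabConst]; positivity

/-- On a nontrivial state space `μ ≤ L` is automatic; passing to `max L μ` covers the trivial space
as well. -/
theorem regular {L γ σ μ D : ℝ} {d κ0 : ℕ} (hL : 1 < L) (hγ0 : 0 < γ) (hγ1 : γ < 1) (hμ : 0 < μ)
    (hσ : 0 < σ) (hS : S.SystemAssumption L γ σ d κ0) (hC : S.CostAssumption L μ)
    (hP : S.ParamAssumption L D) : S.Regular μ (max L μ) (dualConst L γ σ d) κ0 := by
  have hmax : L ≤ max L μ := le_max_left _ _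
  have hsg : ∀ t, ∀ θ ∈ S.Θ, gradient (S.stateCost t θ) 0 = 0 := fun t θ hθ =>
    gradient_eq_zero_of_forall_ge fun y => by
      rw [hC.state_zero t θ hθ]; exact hC.state_nonneg t θ hθ y
  have hcg : ∀ t, ∀ θ ∈ S.Θ, gradient (S.ctrlCost t θ) 0 = 0 := fun t θ hθ =>
    gradient_eq_zero_of_forall_ge fun y => by
      rw [hC.ctrl_zero t θ hθ]; exact hC.ctrl_nonneg t θ hθ y
  obtain ⟨β, hβ, hβ0, hFβ⟩ := hC.terminal_radial
  exact
    { μ_pos := hμ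
      one_le_L := hL.le.trans hmax
      le_L := le_max_right _ _
      M_pos := dualConst_pos d hL hγ1
      networkedA := hS.networkedA
      networkedB := hS.networkedB
      normA := hS.normA.trans hmax
      normB := hS.normB.trans hmax
      -- Stabilizability is assumed for truncated pairs only, so the bound for the full pair rests
      -- on controllability over an extended horizon.
      dual := fun ℓ => dualBound_one_of_zero (d := d)
        ((dualBound_zero_of_controllable hL.le hσ hS.normA hS.normB hS.controllable
          (by omega)).mono le_rfl (le_max_right _ _))
      dual_trunc := fun κ hκ i ℓ => ((hS.stabilizable κ hκ i).dualBound hL.le hγ0.le hγ1 ℓ).mono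
        zero_le_one (le_max_left _ _)
      state := fun t θ hθ => (hC.state t θ hθ).mono hmax
      ctrl := fun t θ hθ => (hC.ctrl t θ hθ).mono hmax
      terminal := hC.terminal.mono hmax
      terminal_nonneg := fun x => by
        rw [hFβ, ← hβ0]
        exact hβ.monotoneOn (Set.mem_Ici.2 le_rfl) (Set.mem_Ici.2 (norm_nonneg x)) (norm_nonneg x)
      terminal_grad := fun x =>
        (hC.terminal.mono hmax).exists_gradient_eq_smul (le_max_right _ _) hβ hFβ x
      state_nonneg := hC.state_nonneg
      state_grad_zero := hsg
      ctrl_grad_zero := hcg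
      ctrl_quad := fun t θ hθ u =>
        (hC.ctrl t θ hθ).quadratic_le (hC.ctrl_zero t θ hθ) (hC.ctrl_nonneg t θ hθ) u
      dist_lip := fun t θ hθ θ' hθ' => (hP.dist_lipschitz t θ hθ θ' hθ').trans (by gcongr)
      state_lip := fun t θ hθ θ' hθ' x =>
        (norm_gradient_sub_gradient_le (hC.state t θ hθ).2.1 (hC.state t θ' hθ').2.1
          (hsg t θ hθ) (hsg t θ' hθ') (hP.hess_state t θ hθ θ' hθ') x).trans (by gcongr)
      ctrl_lip := fun t θ hθ θ' hθ' u =>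
        (norm_gradient_sub_gradient_le (hC.ctrl t θ hθ).2.1 (hC.ctrl t θ' hθ').2.1
          (hcg t θ hθ) (hcg t θ' hθ') (hP.hess_ctrl t θ hθ θ' hθ') u).trans (by gcongr) }

namespace Regular

variable {μ L M : ℝ} {κ0 : ℕ}

theorem L_pos (h : S.Regular μ L M κ0) : 0 < L := by linarith [h.one_le_L]

theorem K_pos (h : S.Regular μ L M κ0) : 0 < kktConst μ L M := kktConst_pos h.μ_pos h.L_pos h.M_pos

theorem rate_pos (h : S.Regular μ L M κ0) : 0 < decayRate μ L M :=
  decayRate_pos h.μ_pos h.L_pos h.M_pos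

theorem rate_lt_one (h : S.Regular μ L M κ0) : decayRate μ L M < 1 :=
  decayRate_lt_one h.μ_pos h.L_pos h.M_pos

theorem state_nodeMono (h : S.Regular μ L M κ0) (t : ℕ) {θ : S.Param} (hθ : θ ∈ S.Θ) :
    NodeMono μ L (gradient (S.stateCost t θ)) :=
  nodeMono_gradient (φ := fun i z => S.f t i z (θ i)) (fun _ => rfl) (h.state t θ hθ)

theorem ctrl_nodeMono (h : S.Regular μ L M κ0) (t : ℕ) {θ : S.Param} (hθ : θ ∈ S.Θ) :
    NodeMono μ L (gradient (S.ctrlCost t θ)) :=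
  nodeMono_gradient (φ := fun i z => S.c t i z (θ i)) (fun _ => rfl) (h.ctrl t θ hθ)

theorem exists_solution (h : S.Regular μ L M κ0) (A : S.State →L[ℝ] S.State)
    (B : S.Control →L[ℝ] S.State) (ζ : ℕ → S.State) (x : S.State) (t ℓ : ℕ) {ϑ : ℕ → S.Param}
    (hϑ : ∀ τ, ϑ τ ∈ S.Θ) {g : S.State → ℝ} (hg : Continuous g) (hg0 : ∀ y, 0 ≤ g y) :
    ∃ y v, IsSolution A B (fun τ => S.stateCost (t + τ) (ϑ τ))
      (fun τ => S.ctrlCost (t + τ + 1) (ϑ τ)) g ζ x ℓ y v :=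
  exists_isSolution A B ζ x h.μ_pos (fun τ _ => (h.state _ _ (hϑ τ)).differentiable.continuous)
    (fun τ _ => (h.ctrl _ _ (hϑ τ)).differentiable.continuous) hg
    (fun τ _ => h.state_nonneg _ _ (hϑ τ)) (fun τ _ => h.ctrl_quad _ _ (hϑ τ)) hg0

theorem kkt_of_solution (h : S.Regular μ L M κ0) {A : S.State →L[ℝ] S.State}
    {B : S.Control →L[ℝ] S.State} {ζ : ℕ → S.State} {x : S.State} {t ℓ : ℕ} {ϑ : ℕ → S.Param}
    (hϑ : ∀ τ, ϑ τ ∈ S.Θ) {g : S.State → ℝ} (hg : Differentiable ℝ g) {y v}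
    (hsol : IsSolution A B (fun τ => S.stateCost (t + τ) (ϑ τ))
      (fun τ => S.ctrlCost (t + τ + 1) (ϑ τ)) g ζ x ℓ y v) :
    ∃ p, IsKKT A B (fun τ => gradient (S.stateCost (t + τ) (ϑ τ)))
      (fun τ => gradient (S.ctrlCost (t + τ + 1) (ϑ τ))) ζ x ℓ y v p ∧ p ℓ = gradient g (y ℓ) :=
  hsol.exists_kkt (fun τ _ => (h.state _ _ (hϑ τ)).differentiable)
    (fun τ _ => (h.ctrl _ _ (hϑ τ)).differentiable) hg

/-- Existence of solutions of optimality systems with quadratic terminal costs. -/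
theorem exists_kkt_quadratic (h : S.Regular μ L M κ0) (ζ : ℕ → S.State) (x : S.State) (t ℓ : ℕ)
    {ϑ : ℕ → S.Param} (hϑ : ∀ τ, ϑ τ ∈ S.Θ) {s : ℝ} (hs : 0 ≤ s) :
    ∃ y v p, IsKKT S.A S.B (fun τ => gradient (S.stateCost (t + τ) (ϑ τ)))
      (fun τ => gradient (S.ctrlCost (t + τ + 1) (ϑ τ))) ζ x ℓ y v p ∧ p ℓ = s • y ℓ := by
  obtain ⟨y, v, hsol⟩ := h.exists_solution S.A S.B ζ x t ℓ hϑ (g := fun y => s / 2 * ‖y‖ ^ 2)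
    (by fun_prop) (fun y => by positivity)
  obtain ⟨p, hp, hpℓ⟩ := h.kkt_of_solution hϑ
    (fun z => (hasGradientAt_half_norm_sq s z).differentiableAt) hsol
  exact ⟨y, v, p, hp, by rw [hpℓ, (hasGradientAt_half_norm_sq s (y ℓ)).gradient]⟩

/-- The optimality system of the problem with the true parameters from time `t` to time `T`. -/
structure _root_.NetCtrl.NetProblem.TrueKKT (S : NetProblem N) (T : ℕ) (θs : ℕ → S.Param) (t : ℕ)
    (x : S.State) (y : ℕ → S.State) (v : ℕ → S.Control) (p : ℕ → S.State) : Prop where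
  kkt : IsKKT S.A S.B (fun τ => gradient (S.stateCost (t + τ) (θs (t + τ))))
    (fun τ => gradient (S.ctrlCost (t + τ + 1) (θs (t + τ))))
    (fun τ => S.dist (t + τ) (θs (t + τ))) x (T - t) y v p
  terminal : p (T - t) = gradient (S.stateCost T (θs T)) (y (T - t))

theorem exists_trueKKT (h : S.Regular μ L M κ0) {T : ℕ} {θs : ℕ → S.Param} (hθ : ∀ t, θs t ∈ S.Θ)
    (t : ℕ) (x : S.State) : ∃ y v p, S.TrueKKT T θs t x y v p := by
  obtain ⟨y, v, hsol⟩ := h.exists_solution S.A S.B (fun τ => S.dist (t + τ) (θs (t + τ))) x t (T - t)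
    (fun τ => hθ (t + τ)) (h.state T _ (hθ T)).differentiable.continuous (h.state_nonneg T _ (hθ T))
  obtain ⟨p, hp, hpℓ⟩ := h.kkt_of_solution (fun τ => hθ (t + τ))
    (h.state T _ (hθ T)).differentiable hsol
  exact ⟨y, v, p, hp, hpℓ⟩

/-- The principle of optimality at the level of optimality systems. -/
theorem trueKKT_tail {T t m : ℕ} {θs : ℕ → S.Param} {x : S.State} {y p : ℕ → S.State}
    {v : ℕ → S.Control} (hk : S.TrueKKT T θs t x y v p) (hm : t + m ≤ T) :
    S.TrueKKT T θs (t + m) (y m) (fun τ => y (m + τ)) (fun τ => v (m + τ)) (fun τ => p (m + τ)) := by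
  refine ⟨⟨⟨rfl, fun τ hτ => ?_⟩, fun τ hτ => ?_, fun τ hτ => ?_⟩, ?_⟩
  · have := hk.kkt.traj.2 (m + τ) (by omega)
    simp only [add_assoc] at this ⊢
    exact this
  · have := hk.kkt.adj (m + τ) (by omega)
    simp only [add_assoc] at this ⊢
    exact this
  · have := hk.kkt.stat (m + τ) (by omega)
    simp only [add_assoc] at this ⊢
    exact this
  · have := hk.terminal
    rw [show T - t = m + (T - (t + m)) by omega] at this
    exact this

/-- Exponentially decaying sensitivity to the initial state. -/
theorem trueKKT_initial (h : S.Regular μ L M κ0) {T t : ℕ} {θs : ℕ → S.Param}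
    (hθ : ∀ t, θs t ∈ S.Θ) {x x' : S.State} {y p y' p' : ℕ → S.State} {v v' : ℕ → S.Control}
    (hk : S.TrueKKT T θs t x y v p) (hk' : S.TrueKKT T θs t x' y' v' p') :
    (∀ m, t + m ≤ T → ‖y m - y' m‖ ≤ √(4 * kktConst μ L M) * (decayRate μ L M ^ m * ‖x - x'‖)) ∧
    (∀ m, t + m < T → ‖v m - v' m‖ ≤ √(4 * kktConst μ L M) * (decayRate μ L M ^ m * ‖x - x'‖)) := by
  have hK := h.K_pos
  have h0 := h.rate_pos
  have key : ∀ m, _ := fun m => kkt_compare_time h.μ_pos h.L_pos h.M_pos h.normA h.normB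
    (h.dual (T - t)) (fun τ _ => (h.state (t + τ) _ (hθ (t + τ))).wMono)
    (h.state T _ (hθ T)).wMono
    (fun τ _ => (h.ctrl (t + τ + 1) _ (hθ (t + τ))).wMono) hk.kkt hk.terminal hk'.kkt m rfl
  simp only [sub_self, norm_zero, mul_zero, hk'.terminal, ne_eq, OfNat.ofNat_ne_zero,
    not_false_eq_true, zero_pow, Finset.sum_const_zero, add_zero] at key
  set K := kktConst μ L M
  set γ := decayRate μ L M
  have hn : ∀ (E : Type) [NormedAddCommGroup E] (z : E) (m : ℕ),
      ‖z‖ ^ 2 ≤ 4 * K * (γ ^ (((0 : ℕ) : ℤ) - (m : ℤ)).natAbs * ‖x - x'‖) ^ 2 →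
      ‖z‖ ≤ √(4 * K) * (γ ^ m * ‖x - x'‖) := by
    intro E _ z m hz
    rw [show (((0 : ℕ) : ℤ) - (m : ℤ)).natAbs = m by omega] at hz
    refine abs_le_of_sq_le_sq' ?_ (by positivity) |>.2
    rwa [mul_pow, Real.sq_sqrt (by positivity)]
  refine ⟨fun m hm => hn _ _ m ?_, fun m hm => hn _ _ m ?_⟩
  · refine le_trans ?_ (key m)
    have h1 := Finset.single_le_sum
      (f := fun τ : ℕ => (γ ^ ((τ : ℤ) - (m : ℤ)).natAbs * ‖y τ - y' τ‖) ^ 2)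
      (fun _ _ => sq_nonneg _) (Finset.mem_range.2 (show m < T - t + 1 by omega))
    simp only [sub_self, Int.natAbs_zero, pow_zero, one_mul] at h1
    refine h1.trans ?_
    rw [add_assoc]
    exact le_add_of_nonneg_right (by positivity)
  · refine le_trans ?_ (key m)
    have h1 := Finset.single_le_sum
      (f := fun τ : ℕ => (γ ^ ((τ : ℤ) - (m : ℤ)).natAbs * ‖v τ - v' τ‖) ^ 2)
      (fun _ _ => sq_nonneg _) (Finset.mem_range.2 (show m < T - t by omega))
    simp only [sub_self, Int.natAbs_zero, pow_zero, one_mul] at h1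
    refine h1.trans ?_
    rw [add_right_comm]
    exact le_add_of_nonneg_left (by positivity)

/-- Constant of the bound for optimal trajectories. -/
def _root_.NetCtrl.trajConst (μ L M : ℝ) : ℝ := √(8 * kktConst μ L M * (1 - decayRate μ L M)⁻¹)

/-- The trajectory is compared with the zero solution of the zero system. The initial state is
damped by `γ ^ m`, and the disturbances contribute a two-sided geometric series around `m`, so the
bound does not depend on `T`. -/
theorem trueKKT_norm_le (h : S.Regular μ L M κ0) {T t : ℕ} {θs : ℕ → S.Param}
    (hθ : ∀ t, θs t ∈ S.Θ) {Dk : ℝ} (hD : ∀ s < T, ∀ θ ∈ S.Θ, ‖S.dist s θ‖ ≤ Dk)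
    (hDk : 0 ≤ Dk) {x : S.State} {y p : ℕ → S.State} {v : ℕ → S.Control}
    (hk : S.TrueKKT T θs t x y v p) :
    (∀ m, t + m ≤ T → ‖y m‖ ≤ trajConst μ L M * (decayRate μ L M ^ m * ‖x‖ + Dk)) ∧
    (∀ m, t + m < T → ‖v m‖ ≤ trajConst μ L M * (decayRate μ L M ^ m * ‖x‖ + Dk)) ∧
    (∀ m, t + m ≤ T → ‖p m‖ ≤ trajConst μ L M * (decayRate μ L M ^ m * ‖x‖ + Dk)) := by
  have hK := h.K_pos
  have h0 := h.rate_pos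
  have h1 := h.rate_lt_one
  have hz : IsKKT S.A S.B (fun _ _ => 0) (fun _ _ => 0) (fun _ => 0) (0 : S.State) (T - t)
      (fun _ => 0) (fun _ => 0) (fun _ => 0) :=
    ⟨⟨rfl, fun _ _ => by simp⟩, fun _ _ => by simp, fun _ _ => by simp⟩
  have key : ∀ m, _ := fun m => kkt_compare_time h.μ_pos h.L_pos h.M_pos h.normA h.normB
    (h.dual (T - t)) (fun τ _ => (h.state (t + τ) _ (hθ (t + τ))).wMono)
    (h.state T _ (hθ T)).wMono
    (fun τ _ => (h.ctrl (t + τ + 1) _ (hθ (t + τ))).wMono) hk.kkt hk.terminal hz m rfl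
  simp only [sub_zero, h.state_grad_zero _ _ (hθ _), h.ctrl_grad_zero _ _ (hθ _), norm_zero,
    mul_zero, ne_eq, OfNat.ofNat_ne_zero, not_false_eq_true, zero_pow, Finset.sum_const_zero,
    add_zero] at key
  set K := kktConst μ L M
  set γ := decayRate μ L M
  have hγ' : 1 ≤ (1 - γ)⁻¹ := (one_le_inv₀ (by linarith)).2 (by linarith)
  have hw : ∀ m : ℕ, ∑ τ ∈ Finset.range (T - t),
      (γ ^ (((τ + 1 : ℕ) : ℤ) - (m : ℤ)).natAbs * ‖S.dist (t + τ) (θs (t + τ))‖) ^ 2 ≤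
      2 * (1 - γ)⁻¹ * Dk ^ 2 := by
    intro m
    calc _ ≤ ∑ τ ∈ Finset.range (T - t), γ ^ ((m : ℤ) - ((τ + 1 : ℕ) : ℤ)).natAbs * Dk ^ 2 := by
          refine Finset.sum_le_sum fun τ hτ => ?_
          rw [Finset.mem_range] at hτ
          rw [mul_pow, show (((τ + 1 : ℕ) : ℤ) - (m : ℤ)).natAbs =
            ((m : ℤ) - ((τ + 1 : ℕ) : ℤ)).natAbs by omega]
          -- The weights are at most `1`, so their squares may be replaced by the weights
          -- themselves, whose sum is bounded.
          have h2 : (γ ^ ((m : ℤ) - ((τ + 1 : ℕ) : ℤ)).natAbs) ^ 2 ≤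
              γ ^ ((m : ℤ) - ((τ + 1 : ℕ) : ℤ)).natAbs :=
            pow_le_of_le_one (by positivity) (pow_le_one₀ h0.le h1.le) two_ne_zero
          exact mul_le_mul h2 (pow_le_pow_left₀ (norm_nonneg _)
            (hD _ (by omega) _ (hθ _)) 2) (sq_nonneg _) (by positivity)
      _ = (∑ τ ∈ Finset.range (T - t), γ ^ ((m : ℤ) - ((τ + 1 : ℕ) : ℤ)).natAbs) * Dk ^ 2 := by
          rw [Finset.sum_mul]
      _ ≤ _ := by
          refine mul_le_mul_of_nonneg_right ?_ (sq_nonneg _)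
          refine le_trans ?_ (sum_pow_natAbs_le h0.le h1 m (T - t + 1))
          rw [Finset.sum_range_succ']
          exact le_add_of_nonneg_right (by positivity)
  have hn : ∀ (E : Type) [NormedAddCommGroup E] (z : E) (m : ℕ),
      ‖z‖ ^ 2 ≤ 4 * K * ((γ ^ (((0 : ℕ) : ℤ) - (m : ℤ)).natAbs * ‖x‖) ^ 2 +
        ∑ τ ∈ Finset.range (T - t),
      (γ ^ (((τ + 1 : ℕ) : ℤ) - (m : ℤ)).natAbs * ‖S.dist (t + τ) (θs (t + τ))‖) ^ 2) →
      ‖z‖ ≤ trajConst μ L M * (γ ^ m * ‖x‖ + Dk) := by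
    intro E _ z m hz
    rw [show (((0 : ℕ) : ℤ) - (m : ℤ)).natAbs = m by omega] at hz
    refine abs_le_of_sq_le_sq' ?_ (by rw [trajConst]; positivity) |>.2
    rw [mul_pow, trajConst, Real.sq_sqrt (by positivity)]
    refine hz.trans ?_
    have h3 : (γ ^ m * ‖x‖) ^ 2 + 2 * (1 - γ)⁻¹ * Dk ^ 2 ≤
        2 * (1 - γ)⁻¹ * (γ ^ m * ‖x‖ + Dk) ^ 2 := by
      have h4 : 0 ≤ γ ^ m * ‖x‖ := by positivity
      generalize γ ^ m * ‖x‖ = a at h4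
      have h5 : 0 ≤ (1 - γ)⁻¹ * (a * Dk) := by positivity
      have h6 : a ^ 2 ≤ (1 - γ)⁻¹ * a ^ 2 := le_mul_of_one_le_left (sq_nonneg a) hγ'
      nlinarith
    have h4 := mul_le_mul_of_nonneg_left (add_le_add_right (hw m) ((γ ^ m * ‖x‖) ^ 2))
      (show 0 ≤ 4 * K by positivity)
    have h5 := mul_le_mul_of_nonneg_left h3 (show 0 ≤ 4 * K by positivity)
    linarith
  refine ⟨fun m hm => hn _ _ m ?_, fun m hm => hn _ _ m ?_, fun m hm => hn _ _ m ?_⟩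
  · refine le_trans ?_ (key m)
    have h1 := Finset.single_le_sum
      (f := fun τ : ℕ => (γ ^ ((τ : ℤ) - (m : ℤ)).natAbs * ‖y τ‖) ^ 2)
      (fun _ _ => sq_nonneg _) (Finset.mem_range.2 (show m < T - t + 1 by omega))
    simp only [sub_self, Int.natAbs_zero, pow_zero, one_mul] at h1
    refine h1.trans ?_
    rw [add_assoc]
    exact le_add_of_nonneg_right (by positivity)
  · refine le_trans ?_ (key m)
    have h1 := Finset.single_le_sum
      (f := fun τ : ℕ => (γ ^ ((τ : ℤ) - (m : ℤ)).natAbs * ‖v τ‖) ^ 2)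
      (fun _ _ => sq_nonneg _) (Finset.mem_range.2 (show m < T - t by omega))
    simp only [sub_self, Int.natAbs_zero, pow_zero, one_mul] at h1
    refine h1.trans ?_
    rw [add_right_comm]
    exact le_add_of_nonneg_left (by positivity)
  · refine le_trans ?_ (key m)
    have h1 := Finset.single_le_sum
      (f := fun τ : ℕ => (γ ^ ((τ : ℤ) - (m : ℤ)).natAbs * ‖p τ‖) ^ 2)
      (fun _ _ => sq_nonneg _) (Finset.mem_range.2 (show m < T - t + 1 by omega))
    simp only [sub_self, Int.natAbs_zero, pow_zero, one_mul] at h1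
    refine h1.trans ?_
    exact le_add_of_nonneg_left (by positivity)

end Regular

end NetProblem

end

/-! ### Error of a single control: truncation, terminal cost, forecasts -/

section

/-- Different nodes may use different points of a Lipschitz curve without a loss that depends on
the number of nodes. -/
theorem sum_norm_block_curve_le {N : ℕ} {n : Fin N → ℕ} {a b c : ℝ} (hab : a ≤ b)
    {V : ℝ → Stack n}
    (hV : ∀ s ∈ Set.Icc a b, ∀ s' ∈ Set.Icc a b, ‖V s - V s'‖ ≤ c * |s - s'|)
    {s : Fin N → ℝ} (hs : ∀ i, s i ∈ Set.Icc a b) :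
    ∑ i, ‖V (s i) i - V a i‖ ^ 2 ≤ 4 * (c * (b - a)) ^ 2 := by
  have hn0 : (0 : ℝ) < N + 1 := by positivity
  -- A grid with `N + 1` cells. Moving each block to a nearby grid point costs `(c * h) ^ 2` per
  -- node, in total at most a multiple of `N * h ^ 2`. Along the grid, Cauchy–Schwarz costs a factor
  -- `N + 1` per block, but summing over the blocks first restores full norms, so that the total is
  -- `((N + 1) * c * h) ^ 2`.
  set h : ℝ := (b - a) / (N + 1) with hh
  have hba : b - a = (N + 1) * h := by rw [hh]; field_simp
  have h0 : 0 ≤ h := div_nonneg (by linarith) hn0.le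
  let q : ℕ → ℝ := fun j => a + j * h
  have hq : ∀ j : ℕ, j ≤ N + 1 → q j ∈ Set.Icc a b := by
    intro j hj
    have h1 : (j : ℝ) ≤ N + 1 := by exact_mod_cast hj
    have h2 := mul_le_mul_of_nonneg_right h1 h0
    have h3 : 0 ≤ (j : ℝ) * h := by positivity
    exact ⟨by simp only [q]; linarith, by simp only [q]; linarith⟩
  have hcell : ∀ i, ∃ j : ℕ, j ≤ N + 1 ∧ |s i - q j| ≤ h := by
    intro i
    obtain ⟨h1, h2⟩ := hs i
    rcases h0.eq_or_lt with h00 | hpos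
    · refine ⟨0, by omega, ?_⟩
      rw [← h00, mul_zero] at hba
      simp only [q, ← h00]
      rw [show s i = a by linarith]; simp
    · refine ⟨⌊(s i - a) / h⌋₊, ?_, ?_⟩
      · refine Nat.floor_le_of_le ?_
        rw [div_le_iff₀ hpos]; push_cast; linarith
      · have h3 := Nat.floor_le (show 0 ≤ (s i - a) / h from div_nonneg (by linarith) h0)
        have h4 := Nat.lt_floor_add_one ((s i - a) / h)
        rw [le_div_iff₀ hpos] at h3
        rw [div_lt_iff₀ hpos] at h4
        rw [abs_le]
        constructor <;> simp only [q] <;> linarith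
  choose j hj hjs using hcell
  have hstep : ∀ l < N + 1, ‖V (q (l + 1)) - V (q l)‖ ^ 2 ≤ (c * h) ^ 2 := by
    intro l hl
    have h1 := hV _ (hq (l + 1) (by omega)) _ (hq l (by omega))
    have h2 : |q (l + 1) - q l| = h := by
      simp only [q]; push_cast
      rw [show a + (↑l + 1) * h - (a + ↑l * h) = h by ring, abs_of_nonneg h0]
    rw [h2] at h1
    exact pow_le_pow_left₀ (norm_nonneg _) h1 2
  have hi : ∀ i, ‖V (s i) i - V a i‖ ^ 2 ≤ 2 * (c * h) ^ 2 +
      2 * ((N + 1) * ∑ l ∈ Finset.range (N + 1), ‖V (q (l + 1)) i - V (q l) i‖ ^ 2) := by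
    intro i
    have e : V (s i) i - V a i = (V (s i) - V (q (j i))) i +
        ∑ l ∈ Finset.range (j i), (V (q (l + 1)) i - V (q l) i) := by
      rw [Finset.sum_range_sub (fun l => V (q l) i)]
      simp [q]
    rw [e]
    refine (norm_add_sq_le_two_mul _ _).trans ?_
    have h1 : ‖(V (s i) - V (q (j i))) i‖ ^ 2 ≤ (c * h) ^ 2 := by
      rcases le_or_gt 0 c with hc | hc
      · refine pow_le_pow_left₀ (norm_nonneg _) ?_ 2
        refine (norm_block_le _ _).trans ((hV _ (hs i) _ (hq _ (hj i))).trans ?_)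
        exact mul_le_mul_of_nonneg_left (hjs i) hc
      · have h2 := hV _ (hs i) _ (hq _ (hj i))
        have h3 : ‖V (s i) - V (q (j i))‖ ≤ 0 :=
          h2.trans (mul_nonpos_of_nonpos_of_nonneg hc.le (abs_nonneg _))
        have h4 := (norm_block_le (V (s i) - V (q (j i))) i).trans h3
        have h5 : ‖(V (s i) - V (q (j i))) i‖ = 0 := le_antisymm h4 (norm_nonneg _)
        rw [h5, zero_pow two_ne_zero]; exact sq_nonneg _
    have h2 : ‖∑ l ∈ Finset.range (j i), (V (q (l + 1)) i - V (q l) i)‖ ^ 2 ≤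
        (N + 1) * ∑ l ∈ Finset.range (N + 1), ‖V (q (l + 1)) i - V (q l) i‖ ^ 2 := by
      calc _ ≤ (∑ l ∈ Finset.range (j i), ‖V (q (l + 1)) i - V (q l) i‖) ^ 2 :=
            pow_le_pow_left₀ (norm_nonneg _) (norm_sum_le _ _) 2
        _ ≤ (∑ l ∈ Finset.range (N + 1), ‖V (q (l + 1)) i - V (q l) i‖) ^ 2 := by
            refine pow_le_pow_left₀ (Finset.sum_nonneg fun _ _ => norm_nonneg _) ?_ 2
            exact Finset.sum_le_sum_of_subset_of_nonneg (Finset.range_mono (hj i))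
              (fun _ _ _ => norm_nonneg _)
        _ ≤ _ := by
            have := sq_sum_le_card_mul_sum_sq (s := Finset.range (N + 1))
              (f := fun l => ‖V (q (l + 1)) i - V (q l) i‖)
            simpa using this
    linarith
  have hN : (N : ℝ) ≤ (N + 1) ^ 2 := by nlinarith [(Nat.cast_nonneg N : (0 : ℝ) ≤ N)]
  calc ∑ i, ‖V (s i) i - V a i‖ ^ 2 ≤ ∑ i : Fin N, (2 * (c * h) ^ 2 +
      2 * ((N + 1) * ∑ l ∈ Finset.range (N + 1), ‖V (q (l + 1)) i - V (q l) i‖ ^ 2)) :=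
        Finset.sum_le_sum fun i _ => hi i
    _ = N * (2 * (c * h) ^ 2) + 2 * ((N + 1) *
          ∑ l ∈ Finset.range (N + 1), ‖V (q (l + 1)) - V (q l)‖ ^ 2) := by
        rw [Finset.sum_add_distrib, ← Finset.mul_sum, ← Finset.mul_sum, ← Finset.mul_sum,
          Finset.sum_comm]
        congr 1
        · simp; ring
        · congr 2
          exact Finset.sum_congr rfl fun l _ => (by rw [stack_norm_sq]; rfl)
    _ ≤ N * (2 * (c * h) ^ 2) + 2 * ((N + 1) * ∑ l ∈ Finset.range (N + 1), (c * h) ^ 2) := by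
        gcongr (_ + 2 * (_ * ?_))
        refine Finset.sum_le_sum fun l hl => ?_
        exact hstep l (Finset.mem_range.1 hl)
    _ ≤ _ := by
        rw [hba, Finset.sum_const, Finset.card_range, nsmul_eq_mul]
        push_cast
        have := mul_le_mul_of_nonneg_right hN (show 0 ≤ 2 * (c * h) ^ 2 by positivity)
        linarith

/-- Here `s1` is the truncation error, `s2` the effect of the different terminal coefficients of the
agents, and `s3` the effect of the forecasts and of the terminal mismatch. -/
theorem error_budget {sp K2 K q a1 a2 a3 a4 s1 s2 s3 e : ℝ} (hsp : 0 ≤ sp) (hK2 : 0 ≤ K2)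
    (hK : 0 ≤ K) (hq : 0 ≤ q) (ha1 : 0 ≤ a1) (ha2 : 0 ≤ a2) (ha3 : 0 ≤ a3) (ha4 : 0 ≤ a4)
    (he : e ≤ 3 * (s1 + s2 + s3)) (h1 : s1 ≤ sp * a1) (h2 : s2 ≤ 64 * K2 * a2)
    (h3 : s3 ≤ 4 * K * (a4 + 2 * q * a3 + 4 * q * a2)) :
    e ≤ (3 * sp + 192 * K2 + 12 * K * (1 + 4 * q)) * (a1 + a2 + a3 + a4) := by
  have e1 : 0 ≤ sp * (a2 + a3 + a4) := by positivity
  have e2 : 0 ≤ K2 * (a1 + a3 + a4) := by positivity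
  have e3 : 0 ≤ K * (a1 + a2 + a3) := by positivity
  have e4 : 0 ≤ K * q * (4 * a1 + 2 * a3 + 4 * a4) := by positivity
  linarith

namespace NetProblem.Regular

variable {N : ℕ} {S : NetProblem N} {μ L M : ℝ} {κ0 : ℕ}

/-- First controls for exact and predicted parameters. -/
theorem forecast_compare (h : S.Regular μ L M κ0) {T t ℓ : ℕ} {θs : ℕ → S.Param}
    (hθ : ∀ t, θs t ∈ S.Θ) {Dk : ℝ} (hD : ∀ s < T, ∀ θ ∈ S.Θ, ‖S.dist s θ‖ ≤ Dk)
    (hDk : 0 ≤ Dk) {ϑ : ℕ → S.Param} (hϑ : ∀ τ, ϑ τ ∈ S.Θ) (hℓ : 0 < ℓ) (htℓ : t + ℓ ≤ T)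
    {gT : S.State → S.State} (hgT : WMono μ L (ContinuousLinearMap.id ℝ S.State) gT)
    {x : S.State} {y p Y P : ℕ → S.State} {v V : ℕ → S.Control}
    (hk : IsKKT S.A S.B (fun τ => gradient (S.stateCost (t + τ) (ϑ τ)))
      (fun τ => gradient (S.ctrlCost (t + τ + 1) (ϑ τ)))
      (fun τ => S.dist (t + τ) (ϑ τ)) x ℓ y v p) (hpℓ : p ℓ = gT (y ℓ))
    (hY : S.TrueKKT T θs t x Y V P) :
    ‖v 0 - V 0‖ ^ 2 ≤ 4 * kktConst μ L M * (
      ∑ τ ∈ Finset.range ℓ,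
        (decayRate μ L M ^ τ * ‖S.dist (t + τ) (ϑ τ) - S.dist (t + τ) (θs (t + τ))‖) ^ 2 +
      2 * (L * trajConst μ L M) ^ 2 * ∑ τ ∈ Finset.range ℓ, (decayRate μ L M ^ τ *
        (‖ϑ τ - θs (t + τ)‖ * (decayRate μ L M ^ τ * ‖x‖ + Dk))) ^ 2 +
      (decayRate μ L M ^ ℓ * ‖gT (Y ℓ) - P ℓ‖) ^ 2) := by
  have hK := h.K_pos
  have h0 := h.rate_pos
  have h1 := h.rate_lt_one
  have hL := h.L_pos
  obtain ⟨bY, bV, -⟩ := h.trueKKT_norm_le hθ hD hDk hY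
  have key := kkt_compare_time h.μ_pos h.L_pos h.M_pos h.normA h.normB
    (h.dual ℓ) (fun τ _ => (h.state (t + τ) _ (hϑ τ)).wMono) hgT
    (fun τ _ => (h.ctrl (t + τ + 1) _ (hϑ τ)).wMono) hk hpℓ
    -- The true trajectory runs up to time `T`. Cut off after `ℓ` steps it violates the terminal
    -- condition of the plan, and this mismatch is the last term of the bound.
    (hY.kkt.restrict (show ℓ ≤ T - t by omega)) 0 rfl
  simp only [Nat.cast_zero, sub_zero, Int.natAbs_natCast, sub_self, norm_zero, mul_zero, ne_eq,
    OfNat.ofNat_ne_zero, not_false_eq_true, zero_pow, zero_add] at key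
  set K := kktConst μ L M
  set γ := decayRate μ L M
  set c := trajConst μ L M
  have hc : 0 ≤ c := Real.sqrt_nonneg _
  have hv : ‖v 0 - V 0‖ ^ 2 ≤ ∑ τ ∈ Finset.range ℓ, (γ ^ τ * ‖v τ - V τ‖) ^ 2 := by
    have := Finset.single_le_sum (f := fun τ : ℕ => (γ ^ τ * ‖v τ - V τ‖) ^ 2)
      (fun _ _ => sq_nonneg _) (Finset.mem_range.2 hℓ)
    simpa using this
  have hsY : ∑ τ ∈ Finset.range ℓ, (γ ^ τ * ‖gradient (S.stateCost (t + τ) (ϑ τ)) (Y τ) -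
      gradient (S.stateCost (t + τ) (θs (t + τ))) (Y τ)‖) ^ 2 ≤ (L * c) ^ 2 *
      ∑ τ ∈ Finset.range ℓ, (γ ^ τ * (‖ϑ τ - θs (t + τ)‖ * (γ ^ τ * ‖x‖ + Dk))) ^ 2 := by
    rw [Finset.mul_sum]
    refine Finset.sum_le_sum fun τ hτ => ?_
    rw [Finset.mem_range] at hτ
    rw [← mul_pow]
    refine pow_le_pow_left₀ (by positivity) ?_ 2
    calc _ ≤ γ ^ τ * (L * ‖ϑ τ - θs (t + τ)‖ * (c * (γ ^ τ * ‖x‖ + Dk))) := by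
          gcongr
          refine (h.state_lip _ _ (hϑ τ) _ (hθ _) _).trans ?_
          gcongr
          exact bY τ (by omega)
      _ = _ := by ring
  have hsV : ∑ τ ∈ Finset.range ℓ, (γ ^ τ * ‖gradient (S.ctrlCost (t + τ + 1) (ϑ τ)) (V τ) -
      gradient (S.ctrlCost (t + τ + 1) (θs (t + τ))) (V τ)‖) ^ 2 ≤ (L * c) ^ 2 *
      ∑ τ ∈ Finset.range ℓ, (γ ^ τ * (‖ϑ τ - θs (t + τ)‖ * (γ ^ τ * ‖x‖ + Dk))) ^ 2 := by
    rw [Finset.mul_sum]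
    refine Finset.sum_le_sum fun τ hτ => ?_
    rw [Finset.mem_range] at hτ
    rw [← mul_pow]
    refine pow_le_pow_left₀ (by positivity) ?_ 2
    calc _ ≤ γ ^ τ * (L * ‖ϑ τ - θs (t + τ)‖ * (c * (γ ^ τ * ‖x‖ + Dk))) := by
          gcongr
          refine (h.ctrl_lip _ _ (hϑ τ) _ (hθ _) _).trans ?_
          gcongr
          exact bV τ (by omega)
      _ = _ := by ring
  have hw : ∑ τ ∈ Finset.range ℓ, (γ ^ (τ + 1) *
      ‖S.dist (t + τ) (ϑ τ) - S.dist (t + τ) (θs (t + τ))‖) ^ 2 ≤ ∑ τ ∈ Finset.range ℓ,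
      (γ ^ τ * ‖S.dist (t + τ) (ϑ τ) - S.dist (t + τ) (θs (t + τ))‖) ^ 2 := by
    refine Finset.sum_le_sum fun τ _ => pow_le_pow_left₀ (by positivity) ?_ 2
    gcongr ?_ * _
    exact pow_le_pow_of_le_one h0.le h1.le (Nat.le_succ τ)
  have hkey := (hv.trans (by
    refine le_trans ?_ key
    rw [add_right_comm]
    exact le_add_of_nonneg_left (by positivity)))
  norm_cast at hkey hw
  refine hkey.trans (mul_le_mul_of_nonneg_left ?_ (by positivity))
  linarith

/-- Sensitivity of the first control to a quadratic terminal cost. -/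
theorem quadratic_compare (h : S.Regular μ L M κ0) {t k : ℕ} (hk0 : 0 < k) {ϑ : ℕ → S.Param}
    (hϑ : ∀ τ, ϑ τ ∈ S.Θ) {x : S.State} {s s' : ℝ} (hs : s ∈ Set.Icc μ L) (hs' : s' ∈ Set.Icc μ L)
    {y p y' p' : ℕ → S.State} {v v' : ℕ → S.Control}
    (hk : IsKKT S.A S.B (fun τ => gradient (S.stateCost (t + τ) (ϑ τ)))
      (fun τ => gradient (S.ctrlCost (t + τ + 1) (ϑ τ)))
      (fun τ => S.dist (t + τ) (ϑ τ)) x k y v p) (hp : p k = s • y k)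
    (hk' : IsKKT S.A S.B (fun τ => gradient (S.stateCost (t + τ) (ϑ τ)))
      (fun τ => gradient (S.ctrlCost (t + τ + 1) (ϑ τ)))
      (fun τ => S.dist (t + τ) (ϑ τ)) x k y' v' p') (hp' : p' k = s' • y' k)
    {Z : ℝ} (hZ0 : 0 ≤ Z)
    (hZ : ‖x‖ ^ 2 + ∑ τ ∈ Finset.range k, ‖S.dist (t + τ) (ϑ τ)‖ ^ 2 ≤ Z ^ 2) :
    ‖v 0 - v' 0‖ ≤ 4 * kktConst μ L M * decayRate μ L M ^ k * Z * |s - s'| := by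
  have hK := h.K_pos
  have h0 := h.rate_pos
  have hb := kkt_norm_le h.μ_pos h.L_pos h.M_pos (h.dual k)
    (fun τ _ => (h.state (t + τ) _ (hϑ τ)).wMono) (wMono_smul h.μ_pos hs'.1 hs'.2 _)
    (fun τ _ => (h.ctrl (t + τ + 1) _ (hϑ τ)).wMono)
    (fun τ _ => h.state_grad_zero _ _ (hϑ τ)) (smul_zero _)
    (fun τ _ => h.ctrl_grad_zero _ _ (hϑ τ)) hk' hp'
  have key := kkt_compare_time h.μ_pos h.L_pos h.M_pos h.normA h.normB
    (h.dual k) (fun τ _ => (h.state (t + τ) _ (hϑ τ)).wMono) (wMono_smul h.μ_pos hs.1 hs.2 _)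
    (fun τ _ => (h.ctrl (t + τ + 1) _ (hϑ τ)).wMono) hk hp hk' 0 rfl
  simp only [Nat.cast_zero, sub_zero, Int.natAbs_natCast, sub_self, norm_zero, mul_zero, ne_eq,
    OfNat.ofNat_ne_zero, not_false_eq_true, zero_pow, zero_add, Finset.sum_const_zero,
    add_zero, hp', ← sub_smul, norm_smul, Real.norm_eq_abs] at key
  set K := kktConst μ L M
  set γ := decayRate μ L M
  have hv : ‖v 0 - v' 0‖ ^ 2 ≤ ∑ τ ∈ Finset.range k, (γ ^ τ * ‖v τ - v' τ‖) ^ 2 := by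
    have := Finset.single_le_sum (f := fun τ : ℕ => (γ ^ τ * ‖v τ - v' τ‖) ^ 2)
      (fun _ _ => sq_nonneg _) (Finset.mem_range.2 hk0)
    simpa using this
  -- Changing the coefficient perturbs only the terminal condition, by `(s - s') • y' k`, and `y' k`
  -- is bounded by the data.
  have hy : ‖y' k‖ ^ 2 ≤ 4 * K * Z ^ 2 := by
    have h2 := Finset.single_le_sum (f := fun τ : ℕ => ‖y' τ‖ ^ 2)
      (fun _ _ => sq_nonneg _) (Finset.mem_range.2 (Nat.lt_succ_self k))
    have h3 := mul_le_mul_of_nonneg_left hZ (show 0 ≤ 4 * K by positivity)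
    have h4 : 0 ≤ ∑ τ ∈ Finset.range k, ‖v' τ‖ ^ 2 := by positivity
    have h5 : 0 ≤ ∑ τ ∈ Finset.range (k + 1), ‖p' τ‖ ^ 2 := by positivity
    linarith
  refine abs_le_of_sq_le_sq' ?_ (by positivity) |>.2
  have h6 : ‖v 0 - v' 0‖ ^ 2 ≤ 4 * K * (γ ^ k * (|s - s'| * ‖y' k‖)) ^ 2 := by
    refine hv.trans (le_trans ?_ key)
    rw [add_right_comm]
    exact le_add_of_nonneg_left (by positivity)
  have h7 := mul_le_mul_of_nonneg_left hy (show 0 ≤ 4 * K * (γ ^ k * |s - s'|) ^ 2 by positivity)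
  refine h6.trans (le_trans (le_of_eq ?_) (h7.trans (le_of_eq ?_))) <;> ring

/-- Constant of the bound for the error of one control. -/
def _root_.NetCtrl.errConst (μ L M : ℝ) : ℝ :=
  3 * spaceConst μ L M + 192 * (kktConst μ L M * L) ^ 2 +
    12 * kktConst μ L M * (1 + 4 * (L * trajConst μ L M) ^ 2)

/-- Node-wise weights are not available for the non-separable `F`, but an agent's plan also
satisfies the optimality system with terminal gradient `s • y`, where `s` is read off from that
plan. The error is split into three parts: truncation with this `s`, replacement of all the `s` by
`μ`, and comparison of the untruncated plan for `μ` with the true optimal trajectory. -/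
theorem early_error_sq_le (h : S.Regular μ L M κ0) {T t k κ r : ℕ} {θs : ℕ → S.Param}
    (hθ : ∀ t, θs t ∈ S.Θ) {Dk : ℝ} (hD : ∀ s < T, ∀ θ ∈ S.Θ, ‖S.dist s θ‖ ≤ Dk)
    (hDk : 0 ≤ Dk) {ϑ : ℕ → S.Param} (hϑ : ∀ τ, ϑ τ ∈ S.Θ) (hk0 : 0 < k) (htk : t + k ≤ T)
    (hκ : κ0 ≤ κ) (hr : r ≤ κ ∨ N ≤ κ)
    (hsum : ∑ τ ∈ Finset.range k, ‖S.dist (t + τ) (ϑ τ)‖ ≤ Dk)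
    {x : S.State} {u : S.Control}
    (hu : ∀ i, ∃ y v, S.IsAgentSolution κ i t k ϑ S.F x y v ∧ u i = v 0 i)
    {Y P : ℕ → S.State} {V : ℕ → S.Control} (hY : S.TrueKKT T θs t x Y V P) :
    ‖u - V 0‖ ^ 2 ≤ errConst μ L M * (N * (decayRate μ L M ^ r * (‖x‖ + Dk)) ^ 2 +
      (decayRate μ L M ^ k * (‖x‖ + Dk)) ^ 2 +
      ∑ τ ∈ Finset.range k, (decayRate μ L M ^ τ *
        (‖ϑ τ - θs (t + τ)‖ * (decayRate μ L M ^ τ * ‖x‖ + Dk))) ^ 2 +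
      ∑ τ ∈ Finset.range k,
        (decayRate μ L M ^ τ * ‖S.dist (t + τ) (ϑ τ) - S.dist (t + τ) (θs (t + τ))‖) ^ 2) := by
  have hK := h.K_pos
  have h0 := h.rate_pos
  have h1 := h.rate_lt_one
  have hL := h.L_pos
  have hsp := spaceConst_pos h.μ_pos hL h.M_pos
  have hZ : ‖x‖ ^ 2 + ∑ τ ∈ Finset.range k, ‖S.dist (t + τ) (ϑ τ)‖ ^ 2 ≤ (‖x‖ + Dk) ^ 2 := by
    have h2 := sum_sq_le_sq_sum (Finset.range k) (c := fun τ => ‖S.dist (t + τ) (ϑ τ)‖)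
      (fun _ _ => norm_nonneg _)
    have h3 := pow_le_pow_left₀ (by positivity) hsum 2
    have h4 : 0 ≤ ‖x‖ * Dk := by positivity
    nlinarith
  have hmμ : μ ∈ Set.Icc μ L := ⟨le_rfl, h.le_L⟩
  have hex : ∀ s : ℝ, ∃ v : S.Control, s ∈ Set.Icc μ L → ∃ (y : ℕ → S.State) (v' : ℕ → S.Control)
      (p : ℕ → S.State), v = v' 0 ∧ IsKKT S.A S.B (fun τ => gradient (S.stateCost (t + τ) (ϑ τ)))
      (fun τ => gradient (S.ctrlCost (t + τ + 1) (ϑ τ))) (fun τ => S.dist (t + τ) (ϑ τ)) x k y v' p ∧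
      p k = s • y k := by
    intro s
    by_cases hs : s ∈ Set.Icc μ L
    · obtain ⟨y, v, p, hk, hp⟩ := h.exists_kkt_quadratic (fun τ => S.dist (t + τ) (ϑ τ)) x t k hϑ
        (h.μ_pos.le.trans hs.1)
      exact ⟨v 0, fun _ => ⟨y, v, p, rfl, hk, hp⟩⟩
    · exact ⟨0, fun hs' => absurd hs' hs⟩
  choose Vs hVs using hex
  have hagent : ∀ i, ∃ s ∈ Set.Icc μ L, ‖Vs s i - u i‖ ^ 2 ≤
      spaceConst μ L M * (decayRate μ L M ^ r * (‖x‖ + Dk)) ^ 2 := by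
    intro i
    obtain ⟨y', v', hsol, hui⟩ := hu i
    obtain ⟨p', hk', hp'⟩ := h.kkt_of_solution hϑ h.terminal.differentiable hsol
    -- The coefficient depends on the terminal state of this agent's own plan.
    obtain ⟨s, hs1, hs2, hs⟩ := h.terminal_grad (y' k)
    rw [hs] at hp'
    obtain ⟨y, v, p, hv, hk, hp⟩ := hVs s ⟨hs1, hs2⟩
    have key := trunc_compare h.μ_pos hL h.M_pos h.normA h.normB h.networkedA h.networkedB hr hk0
      (h.dual k) (h.dual_trunc κ hκ i k) (fun τ _ => h.state_nodeMono (t + τ) (hϑ τ))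
      (nodeMono_smul h.μ_pos hs1 hs2) (fun τ _ => h.ctrl_nodeMono (t + τ + 1) (hϑ τ))
      (fun τ _ => h.state_grad_zero _ _ (hϑ τ)) (smul_zero _)
      (fun τ _ => h.ctrl_grad_zero _ _ (hϑ τ)) hk hp hk' hp'
    refine ⟨s, ⟨hs1, hs2⟩, ?_⟩
    rw [hv, hui]
    refine key.trans ?_
    rw [mul_pow, ← mul_assoc]
    exact mul_le_mul_of_nonneg_left hZ (by positivity)
  choose s hs hsu using hagent
  have hgrid := sum_norm_block_curve_le (V := Vs)
    (c := 4 * kktConst μ L M * decayRate μ L M ^ k * (‖x‖ + Dk)) h.le_L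
    (fun s hs s' hs' => by
      obtain ⟨y, v, p, hv, hk, hp⟩ := hVs s hs
      obtain ⟨y', v', p', hv', hk', hp'⟩ := hVs s' hs'
      rw [hv, hv']
      exact h.quadratic_compare hk0 hϑ hs hs' hk hp hk' hp' (by positivity) hZ) hs
  obtain ⟨y, v, p, hv, hk, hp⟩ := hVs μ hmμ
  have hfc := h.forecast_compare hθ hD hDk hϑ hk0 htk (wMono_smul h.μ_pos le_rfl h.le_L _)
    hk hp hY
  obtain ⟨bY, -, bP⟩ := h.trueKKT_norm_le hθ hD hDk hY
  have htot : ‖u - V 0‖ ^ 2 ≤ 3 * (∑ i, ‖Vs (s i) i - u i‖ ^ 2 + ∑ i, ‖Vs (s i) i - Vs μ i‖ ^ 2 +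
      ‖Vs μ - V 0‖ ^ 2) := by
    rw [stack_norm_sq, stack_norm_sq (Vs μ - V 0), ← Finset.sum_add_distrib,
      ← Finset.sum_add_distrib, Finset.mul_sum]
    refine Finset.sum_le_sum fun i _ => ?_
    have e : (u - V 0) i = -(Vs (s i) i - u i) + (Vs (s i) i - Vs μ i) + (Vs μ - V 0) i := by
      simp only [PiLp.sub_apply]; abel
    rw [e]
    have h2 := norm_add_le (-(Vs (s i) i - u i) + (Vs (s i) i - Vs μ i)) ((Vs μ - V 0) i)
    have h3 := norm_add_le (-(Vs (s i) i - u i)) (Vs (s i) i - Vs μ i)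
    rw [norm_neg] at h3
    refine (pow_le_pow_left₀ (norm_nonneg _) (h2.trans (add_le_add_left h3 _)) 2).trans ?_
    generalize ‖Vs (s i) i - u i‖ = a
    generalize ‖Vs (s i) i - Vs μ i‖ = b
    generalize ‖(Vs μ - V 0) i‖ = c
    nlinarith [sq_nonneg (a - b), sq_nonneg (b - c), sq_nonneg (a - c)]
  have hc : 0 ≤ trajConst μ L M := Real.sqrt_nonneg _
  -- The terminal mismatch is merely bounded; it becomes small through the weight at time `k`.
  have hres : ‖μ • Y k - P k‖ ≤ 2 * (L * trajConst μ L M) * (‖x‖ + Dk) := by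
    have hle : decayRate μ L M ^ k * ‖x‖ + Dk ≤ ‖x‖ + Dk := by
      gcongr
      exact mul_le_of_le_one_left (norm_nonneg _) (pow_le_one₀ h0.le h1.le)
    have hy := (bY k htk).trans (mul_le_mul_of_nonneg_left hle hc)
    have hP := (bP k htk).trans (mul_le_mul_of_nonneg_left hle hc)
    have h2 := norm_sub_le (μ • Y k) (P k)
    rw [norm_smul, Real.norm_eq_abs, abs_of_pos h.μ_pos] at h2
    have h3 := mul_le_mul h.le_L hy (norm_nonneg _) hL.le
    have h4 : trajConst μ L M * (‖x‖ + Dk) ≤ L * (trajConst μ L M * (‖x‖ + Dk)) :=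
      le_mul_of_one_le_left (by positivity) h.one_le_L
    linarith
  have hres2 : (decayRate μ L M ^ k * ‖μ • Y k - P k‖) ^ 2 ≤ 4 * (L * trajConst μ L M) ^ 2 *
      (decayRate μ L M ^ k * (‖x‖ + Dk)) ^ 2 := by
    refine (pow_le_pow_left₀ (by positivity) (mul_le_mul_of_nonneg_left hres
      (pow_nonneg h0.le k)) 2).trans (le_of_eq ?_)
    ring
  have hs1 : ∑ i, ‖Vs (s i) i - u i‖ ^ 2 ≤
      spaceConst μ L M * (N * (decayRate μ L M ^ r * (‖x‖ + Dk)) ^ 2) := by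
    refine (Finset.sum_le_sum fun i _ => hsu i).trans (le_of_eq ?_)
    simp; ring
  rw [← hv] at hfc
  have hLμ : (L - μ) ^ 2 ≤ L ^ 2 := pow_le_pow_left₀ (by linarith [h.le_L]) (by linarith [h.μ_pos]) 2
  have hgrid2 : ∑ i, ‖Vs (s i) i - Vs μ i‖ ^ 2 ≤ 64 * (kktConst μ L M * L) ^ 2 *
      (decayRate μ L M ^ k * (‖x‖ + Dk)) ^ 2 := by
    refine hgrid.trans ?_
    have := mul_le_mul_of_nonneg_left hLμ (show 0 ≤ 64 * kktConst μ L M ^ 2 *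
      (decayRate μ L M ^ k * (‖x‖ + Dk)) ^ 2 by positivity)
    refine le_trans (le_of_eq ?_) (this.trans (le_of_eq ?_)) <;> ring
  have hfc' := hfc.trans (mul_le_mul_of_nonneg_left (add_le_add_right hres2 _)
    (show 0 ≤ 4 * kktConst μ L M by positivity))
  exact error_budget hsp.le (sq_nonneg _) hK.le (sq_nonneg _) (by positivity) (by positivity)
    (by positivity) (by positivity) htot hs1 hgrid2 hfc'

/-- When the plan reaches `T`, the terminal cost is separable and truncation is estimated directly.
The terminal mismatch is a forecast error for the parameter at time `T`; hence no term in `γ ^ k`,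
and one more summand in the forecast sum. -/
theorem late_error_sq_le (h : S.Regular μ L M κ0) {T t k κ r : ℕ} {θs : ℕ → S.Param}
    (hθ : ∀ t, θs t ∈ S.Θ) {Dk : ℝ} (hD : ∀ s < T, ∀ θ ∈ S.Θ, ‖S.dist s θ‖ ≤ Dk)
    (hDk : 0 ≤ Dk) {ϑ : ℕ → S.Param} (hϑ : ∀ τ, ϑ τ ∈ S.Θ) (hk0 : 0 < k) (htk : t + k = T)
    (hκ : κ0 ≤ κ) (hr : r ≤ κ ∨ N ≤ κ)
    (hsum : ∑ τ ∈ Finset.range k, ‖S.dist (t + τ) (ϑ τ)‖ ≤ Dk)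
    {x : S.State} {u : S.Control}
    (hu : ∀ i, ∃ y v, S.IsAgentSolution κ i t k ϑ (S.stateCost T (ϑ k)) x y v ∧ u i = v 0 i)
    {Y P : ℕ → S.State} {V : ℕ → S.Control} (hY : S.TrueKKT T θs t x Y V P) :
    ‖u - V 0‖ ^ 2 ≤ errConst μ L M * (N * (decayRate μ L M ^ r * (‖x‖ + Dk)) ^ 2 +
      ∑ τ ∈ Finset.range (k + 1), (decayRate μ L M ^ τ *
        (‖ϑ τ - θs (t + τ)‖ * (decayRate μ L M ^ τ * ‖x‖ + Dk))) ^ 2 +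
      ∑ τ ∈ Finset.range k,
        (decayRate μ L M ^ τ * ‖S.dist (t + τ) (ϑ τ) - S.dist (t + τ) (θs (t + τ))‖) ^ 2) := by
  have hK := h.K_pos
  have h0 := h.rate_pos
  have h1 := h.rate_lt_one
  have hL := h.L_pos
  have hsp := spaceConst_pos h.μ_pos hL h.M_pos
  have hZ : ‖x‖ ^ 2 + ∑ τ ∈ Finset.range k, ‖S.dist (t + τ) (ϑ τ)‖ ^ 2 ≤ (‖x‖ + Dk) ^ 2 := by
    have h2 := sum_sq_le_sq_sum (Finset.range k) (c := fun τ => ‖S.dist (t + τ) (ϑ τ)‖)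
      (fun _ _ => norm_nonneg _)
    have h3 := pow_le_pow_left₀ (by positivity) hsum 2
    have h4 : 0 ≤ ‖x‖ * Dk := by positivity
    nlinarith
  obtain ⟨y, v, hsolf⟩ := h.exists_solution S.A S.B (fun τ => S.dist (t + τ) (ϑ τ)) x t k
    hϑ (h.state T _ (hϑ k)).differentiable.continuous (h.state_nonneg T _ (hϑ k))
  obtain ⟨p, hk, hp⟩ := h.kkt_of_solution hϑ (h.state T _ (hϑ k)).differentiable hsolf
  have hagent : ∀ i, ‖v 0 i - u i‖ ^ 2 ≤
      spaceConst μ L M * (decayRate μ L M ^ r * (‖x‖ + Dk)) ^ 2 := by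
    intro i
    obtain ⟨y', v', hsol, hui⟩ := hu i
    obtain ⟨p', hk', hp'⟩ := h.kkt_of_solution hϑ (h.state T _ (hϑ k)).differentiable hsol
    have key := trunc_compare h.μ_pos hL h.M_pos h.normA h.normB h.networkedA h.networkedB hr hk0
      (h.dual k) (h.dual_trunc κ hκ i k) (fun τ _ => h.state_nodeMono (t + τ) (hϑ τ))
      (h.state_nodeMono T (hϑ k)) (fun τ _ => h.ctrl_nodeMono (t + τ + 1) (hϑ τ))
      (fun τ _ => h.state_grad_zero _ _ (hϑ τ)) (h.state_grad_zero _ _ (hϑ k))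
      (fun τ _ => h.ctrl_grad_zero _ _ (hϑ τ)) hk hp hk' hp'
    rw [hui]
    refine key.trans ?_
    rw [mul_pow, ← mul_assoc]
    exact mul_le_mul_of_nonneg_left hZ (by positivity)
  have hfc := h.forecast_compare hθ hD hDk hϑ hk0 htk.le (h.state T _ (hϑ k)).wMono hk hp hY
  obtain ⟨bY, -, -⟩ := h.trueKKT_norm_le hθ hD hDk hY
  have hc : 0 ≤ trajConst μ L M := Real.sqrt_nonneg _
  have hterm := hY.terminal
  rw [show T - t = k by omega] at hterm
  have hres : (decayRate μ L M ^ k * ‖gradient (S.stateCost T (ϑ k)) (Y k) - P k‖) ^ 2 ≤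
      4 * (L * trajConst μ L M) ^ 2 * (decayRate μ L M ^ k *
        (‖ϑ k - θs (t + k)‖ * (decayRate μ L M ^ k * ‖x‖ + Dk))) ^ 2 := by
    rw [hterm, htk]
    have h2 : decayRate μ L M ^ k * ‖gradient (S.stateCost T (ϑ k)) (Y k) -
        gradient (S.stateCost T (θs T)) (Y k)‖ ≤ (L * trajConst μ L M) * (decayRate μ L M ^ k *
        (‖ϑ k - θs T‖ * (decayRate μ L M ^ k * ‖x‖ + Dk))) := by
      calc _ ≤ decayRate μ L M ^ k * (L * ‖ϑ k - θs T‖ *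
            (trajConst μ L M * (decayRate μ L M ^ k * ‖x‖ + Dk))) := by
            gcongr
            refine (h.state_lip _ _ (hϑ k) _ (hθ _) _).trans ?_
            gcongr
            exact bY k htk.le
        _ = _ := by ring
    refine (pow_le_pow_left₀ (by positivity) h2 2).trans ?_
    rw [mul_pow]
    refine mul_le_mul_of_nonneg_right ?_ (sq_nonneg _)
    linarith [sq_nonneg (L * trajConst μ L M)]
  have htot : ‖u - V 0‖ ^ 2 ≤ 3 * (∑ i, ‖v 0 i - u i‖ ^ 2 + ‖v 0 - V 0‖ ^ 2) := by
    have e : ∑ i, ‖v 0 i - u i‖ ^ 2 = ‖v 0 - u‖ ^ 2 := by rw [stack_norm_sq]; rfl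
    rw [e]
    have e2 : u - V 0 = -(v 0 - u) + (v 0 - V 0) := by abel
    rw [e2]
    have h2 := norm_add_sq_le_two_mul (-(v 0 - u)) (v 0 - V 0)
    rw [norm_neg] at h2
    linarith [sq_nonneg ‖v 0 - u‖, sq_nonneg ‖v 0 - V 0‖]
  have hs1 : ∑ i, ‖v 0 i - u i‖ ^ 2 ≤
      spaceConst μ L M * (N * (decayRate μ L M ^ r * (‖x‖ + Dk)) ^ 2) := by
    refine (Finset.sum_le_sum fun i _ => hagent i).trans (le_of_eq ?_)
    simp; ring
  have hfc' := hfc.trans (mul_le_mul_of_nonneg_left (add_le_add_right hres _)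
    (show 0 ≤ 4 * kktConst μ L M by positivity))
  rw [Finset.sum_range_succ, add_comm (∑ τ ∈ Finset.range k, (decayRate μ L M ^ τ *
        (‖ϑ τ - θs (t + τ)‖ * (decayRate μ L M ^ τ * ‖x‖ + Dk))) ^ 2), ← add_assoc]
  exact error_budget (s2 := 0) hsp.le (sq_nonneg _) hK.le (sq_nonneg _) (by positivity)
    (by positivity) (by positivity) (by positivity) (by rwa [add_zero]) hs1 (by positivity) hfc'

end NetProblem.Regular

end

/-! ### A Gronwall inequality and the closed loop -/

section

/-- A discrete Gronwall inequality with a geometric kernel. -/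
theorem gronwall_geometric {z : ℕ → ℝ} {a b g q X : ℝ} {T : ℕ} (ha : 0 < a) (ha1 : a < 1)
    (hb : 0 ≤ b) (hg : 0 ≤ g) (hq : 0 ≤ q) (hX : 0 ≤ X) (hgs : g ≤ a * (1 - a) / 2)
    (hz : ∀ t ≤ T, z t ≤ b * (a ^ t * X) + q +
      ∑ s ∈ Finset.range t, (a ^ 2) ^ (t - s - 1) * (g * z s)) :
    ∀ t ≤ T, z t ≤ 2 * b * (a ^ t * X) + 2 * q := by
  intro t
  induction t using Nat.strong_induction_on with
  | _ t ih =>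
  intro ht
  refine (hz t ht).trans ?_
  have h1 : ∑ s ∈ Finset.range t, (a ^ 2) ^ (t - s - 1) * (g * z s) ≤
      ∑ s ∈ Finset.range t, (g * (2 * b * X) * a ^ (t - 1) + g * (2 * q)) * a ^ (t - 1 - s) := by
    refine Finset.sum_le_sum fun s hs => ?_
    rw [Finset.mem_range] at hs
    have h2 := ih s hs (by omega)
    -- The kernel decays at rate `a ^ 2`, faster than the claimed rate `a`. The gap leaves a
    -- geometric series in `a`, summable uniformly in `t`.
    have h3 : (a ^ 2) ^ (t - s - 1) * a ^ s = a ^ (t - 1) * a ^ (t - 1 - s) := by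
      rw [← pow_mul, ← pow_add, ← pow_add]; congr 1; omega
    have h4 : (a ^ 2) ^ (t - s - 1) ≤ a ^ (t - 1 - s) := by
      rw [← pow_mul]; exact pow_le_pow_of_le_one ha.le ha1.le (by omega)
    calc (a ^ 2) ^ (t - s - 1) * (g * z s)
        ≤ (a ^ 2) ^ (t - s - 1) * (g * (2 * b * (a ^ s * X) + 2 * q)) := by gcongr
      _ = g * (2 * b * X) * ((a ^ 2) ^ (t - s - 1) * a ^ s) +
          g * (2 * q) * (a ^ 2) ^ (t - s - 1) := by ring
      _ ≤ g * (2 * b * X) * (a ^ (t - 1) * a ^ (t - 1 - s)) + g * (2 * q) * a ^ (t - 1 - s) := by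
          rw [h3]; gcongr
      _ = _ := by ring
  rw [← Finset.mul_sum, Finset.sum_range_reflect (fun j => a ^ j) t] at h1
  rcases Nat.eq_zero_or_pos t with rfl | htpos
  · simp only [Finset.range_zero, Finset.sum_empty, pow_zero, one_mul] at h1 ⊢
    have : 0 ≤ b * X := by positivity
    linarith
  have hs := sum_pow_le ha.le ha1 t
  have h1a : 0 < 1 - a := by linarith
  have h5 := mul_le_mul_of_nonneg_left hs
    (show 0 ≤ g * (2 * b * X) * a ^ (t - 1) + g * (2 * q) by positivity)
  have h6 : g * (1 - a)⁻¹ ≤ a / 2 := by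
    rw [← div_eq_mul_inv, div_le_iff₀ h1a]; linarith
  have h7 : a ^ t = a * a ^ (t - 1) := by rw [← pow_succ']; congr 1; omega
  have h8 := mul_le_mul_of_nonneg_left h6 (show 0 ≤ 2 * b * X * a ^ (t - 1) + 2 * q by positivity)
  have h9 : q * a ≤ q := mul_le_of_le_one_right hq ha1.le
  have h10 : b * (a ^ t * X) = a / 2 * (2 * b * X * a ^ (t - 1)) := by rw [h7]; ring
  linarith

namespace NetProblem

variable {N : ℕ} {S : NetProblem N}

/-- The disturbances of any `k` consecutive steps up to time `T` are bounded by `Dk` in total. -/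
def WindowBound (S : NetProblem N) (T k : ℕ) (Dk : ℝ) : Prop :=
  ∀ t, t + k ≤ T → ∀ ϑ : ℕ → S.Param, (∀ τ, ϑ τ ∈ S.Θ) →
    ∑ τ ∈ Finset.range k, ‖S.dist (t + τ) (ϑ τ)‖ ≤ Dk

section windows

variable {T k : ℕ} {Dk : ℝ}

theorem window_nonneg (hw : S.WindowBound T k Dk) (hkT : k ≤ T) {θ : S.Param} (hθ : θ ∈ S.Θ) :
    0 ≤ Dk :=
  (Finset.sum_nonneg fun _ _ => norm_nonneg _).trans (hw 0 (by omega) (fun _ => θ) fun _ => hθ)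

theorem window_sum_le (hw : S.WindowBound T k Dk) (hkT : k ≤ T) {t ℓ : ℕ} (hℓ : ℓ ≤ k)
    (htℓ : t + ℓ ≤ T) {ϑ : ℕ → S.Param}
    (hϑ : ∀ τ, ϑ τ ∈ S.Θ) : ∑ τ ∈ Finset.range ℓ, ‖S.dist (t + τ) (ϑ τ)‖ ≤ Dk := by
  rcases le_or_gt (t + k) T with h | h
  · refine le_trans ?_ (hw t h ϑ hϑ)
    exact Finset.sum_le_sum_of_subset_of_nonneg (Finset.range_mono hℓ) fun _ _ _ => norm_nonneg _
  -- A window that would extend beyond `T` is replaced by the last full window. For the times added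
  -- on the left, subtraction on `ℕ` gives the index `0`, which is harmless since every admissible
  -- parameter may be used there.
  · have h1 := hw (T - k) (by omega) (fun τ => ϑ (τ - (t - (T - k)))) fun _ => hϑ _
    refine le_trans ?_ h1
    have h2 : ∑ τ ∈ Finset.range ℓ, ‖S.dist (t + τ) (ϑ τ)‖ =
        ∑ τ ∈ Finset.Ico (t - (T - k)) (t - (T - k) + ℓ),
          ‖S.dist (T - k + τ) (ϑ (τ - (t - (T - k))))‖ := by
      rw [Finset.sum_Ico_eq_sum_range]
      rw [Nat.add_sub_cancel_left]
      refine Finset.sum_congr rfl fun τ _ => ?_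
      rw [Nat.add_sub_cancel_left, show T - k + (t - (T - k) + τ) = t + τ by omega]
    rw [h2]
    refine Finset.sum_le_sum_of_subset_of_nonneg (fun τ hτ => ?_) fun _ _ _ => norm_nonneg _
    rw [Finset.mem_Ico] at hτ
    rw [Finset.mem_range]; omega

theorem dist_norm_le (hw : S.WindowBound T k Dk) (hk : 0 < k) (hkT : k ≤ T) {s : ℕ}
    (hs : s < T) {θ : S.Param} (hθ : θ ∈ S.Θ) :
    ‖S.dist s θ‖ ≤ Dk := by
  have := window_sum_le hw hkT (t := s) (ℓ := 1) (by omega) (by omega) (ϑ := fun _ => θ)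
    fun _ => hθ
  simpa using this

end windows

namespace Regular

variable {μ L M : ℝ} {κ0 : ℕ}

/-- Error of the control applied by the distributed controller, relative to the optimal control
from the current state. -/
theorem control_error_sq_le (h : S.Regular μ L M κ0) {T t k κ r : ℕ} {θs : ℕ → S.Param}
    {θh : ℕ → ℕ → S.Param} (hθ : ∀ t, θs t ∈ S.Θ) (hθh : ∀ s t, θh s t ∈ S.Θ) {Dk : ℝ}
    (hw : S.WindowBound T k Dk) (hk0 : 0 < k) (hkT : k ≤ T) (hκ : κ0 ≤ κ) (hr : r ≤ κ ∨ N ≤ κ)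
    {x0 : S.State}
    {x : ℕ → S.State} {u : ℕ → S.Control} (hx : S.IsUDTPC T k κ θs θh x0 x u) (ht : t < T)
    {Y P : ℕ → S.State} {V : ℕ → S.Control} (hY : S.TrueKKT T θs t (x t) Y V P) :
    ‖u t - V 0‖ ^ 2 ≤ errConst μ L M * (N * (decayRate μ L M ^ r * (‖x t‖ + Dk)) ^ 2 +
      (decayRate μ L M ^ k * (‖x t‖ + Dk)) ^ 2 +
      ∑ τ ∈ Finset.range (min k (T - t) + 1), (decayRate μ L M ^ τ *
        (‖θh (t + τ) t - θs (t + τ)‖ * (decayRate μ L M ^ τ * ‖x t‖ + Dk))) ^ 2 +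
      ∑ τ ∈ Finset.range (min k (T - t)), (decayRate μ L M ^ τ *
        ‖S.dist (t + τ) (θh (t + τ) t) - S.dist (t + τ) (θs (t + τ))‖) ^ 2) := by
  have hDk := window_nonneg hw hkT (hθ 0)
  have hD : ∀ s < T, ∀ θ ∈ S.Θ, ‖S.dist s θ‖ ≤ Dk := fun s hs θ hθ => dist_norm_le hw hk0 hkT hs hθ
  have hE : 0 ≤ errConst μ L M := by
    have := h.K_pos
    have := spaceConst_pos h.μ_pos h.L_pos h.M_pos
    rw [errConst]; positivity
  rcases lt_or_ge (t + k) T with htk | htk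
  · rw [min_eq_left (by omega)]
    refine (h.early_error_sq_le hθ hD hDk (fun τ => hθh (t + τ) t) hk0 htk.le hκ hr
      (window_sum_le hw hkT le_rfl htk.le fun τ => hθh (t + τ) t) (hx.early t htk) hY).trans ?_
    refine mul_le_mul_of_nonneg_left ?_ hE
    gcongr
    omega
  · rw [min_eq_right (by omega)]
    have hl := hx.late t ht htk
    rw [show θh T t = (fun τ => θh (t + τ) t) (T - t) by
      simp only; congr 1; omega] at hl
    refine (h.late_error_sq_le hθ hD hDk (fun τ => hθh (t + τ) t) (by omega) (by omega) hκ hr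
      (window_sum_le hw hkT (by omega) (by omega) fun τ => hθh (t + τ) t) hl hY).trans ?_
    refine mul_le_mul_of_nonneg_left ?_ hE
    gcongr
    exact le_add_of_nonneg_right (by positivity)

/-- Deviation of a closed-loop trajectory from the optimal trajectory with the same initial state,
by telescoping over the optimal trajectories from the visited states. -/
theorem deviation_le (h : S.Regular μ L M κ0) {T : ℕ} {θs : ℕ → S.Param}
    (hθ : ∀ t, θs t ∈ S.Θ) {x0 : S.State} {x : ℕ → S.State} {u : ℕ → S.Control}
    (hx : IsTraj S.A S.B (fun t => S.dist t (θs t)) x0 T x u) {Y P : ℕ → ℕ → S.State}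
    {V : ℕ → ℕ → S.Control} (hY : ∀ s, S.TrueKKT T θs s (x s) (Y s) (V s) (P s)) :
    (∀ t ≤ T, ‖x t - Y 0 t‖ ≤ ∑ s ∈ Finset.range t,
      decayRate μ L M ^ (t - s - 1) * (√(4 * kktConst μ L M) * L * ‖u s - V s 0‖)) ∧
    (∀ t < T, ‖u t - V 0 t‖ ≤ ‖u t - V t 0‖ + ∑ s ∈ Finset.range t,
      decayRate μ L M ^ (t - s - 1) * (√(4 * kktConst μ L M) * L * ‖u s - V s 0‖)) := by
  have h0 := h.rate_pos
  have hjump : ∀ s < T, ‖Y s 1 - x (s + 1)‖ ≤ L * ‖u s - V s 0‖ := by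
    intro s hs
    have h1 := (hY s).kkt.traj.2 0 (by omega)
    rw [(hY s).kkt.traj.1, zero_add] at h1
    rw [h1, hx.2 s hs]
    simp only [add_zero]
    have e : S.A (x s) + S.B (V s 0) + S.dist s (θs s) - (S.A (x s) + S.B (u s) + S.dist s (θs s)) =
        - S.B (u s - V s 0) := by rw [map_sub]; abel
    rw [e, norm_neg]
    exact (S.B.le_opNorm _).trans (mul_le_mul_of_nonneg_right h.normB (norm_nonneg _))
  -- The tail of the optimal trajectory from `x s` and the optimal trajectory from `x (s + 1)` solve
  -- the same problem; their initial states differ by the image under `B` of the control error.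
  have hinit : ∀ s < T, _ := fun s hs =>
    h.trueKKT_initial hθ (trueKKT_tail (hY s) (m := 1) (by omega)) (hY (s + 1))
  have hstepY : ∀ t ≤ T, ∀ s < t, ‖Y (s + 1) (t - (s + 1)) - Y s (t - s)‖ ≤
      decayRate μ L M ^ (t - s - 1) * (√(4 * kktConst μ L M) * L * ‖u s - V s 0‖) := by
    intro t ht s hs
    have h1 := (hinit s (by omega)).1 (t - s - 1) (by omega)
    simp only [show 1 + (t - s - 1) = t - s by omega] at h1
    rw [norm_sub_rev, show t - (s + 1) = t - s - 1 by omega]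
    refine h1.trans ?_
    calc _ ≤ √(4 * kktConst μ L M) * (decayRate μ L M ^ (t - s - 1) * (L * ‖u s - V s 0‖)) := by
          gcongr
          exact hjump s (by omega)
      _ = _ := by ring
  have hstepV : ∀ t < T, ∀ s < t, ‖V (s + 1) (t - (s + 1)) - V s (t - s)‖ ≤
      decayRate μ L M ^ (t - s - 1) * (√(4 * kktConst μ L M) * L * ‖u s - V s 0‖) := by
    intro t ht s hs
    have h1 := (hinit s (by omega)).2 (t - s - 1) (by omega)
    simp only [show 1 + (t - s - 1) = t - s by omega] at h1
    rw [norm_sub_rev, show t - (s + 1) = t - s - 1 by omega]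
    refine h1.trans ?_
    calc _ ≤ √(4 * kktConst μ L M) * (decayRate μ L M ^ (t - s - 1) * (L * ‖u s - V s 0‖)) := by
          gcongr
          exact hjump s (by omega)
      _ = _ := by ring
  constructor
  · intro t ht
    have e : x t - Y 0 t = ∑ s ∈ Finset.range t, (Y (s + 1) (t - (s + 1)) - Y s (t - s)) := by
      rw [Finset.sum_range_sub (fun s => Y s (t - s)), Nat.sub_self, Nat.sub_zero,
        (hY t).kkt.traj.1]
    rw [e]
    exact (norm_sum_le _ _).trans (Finset.sum_le_sum fun s hs =>
      hstepY t ht s (Finset.mem_range.1 hs))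
  · intro t ht
    have e : u t - V 0 t = (u t - V t 0) +
        ∑ s ∈ Finset.range t, (V (s + 1) (t - (s + 1)) - V s (t - s)) := by
      rw [Finset.sum_range_sub (fun s => V s (t - s)), Nat.sub_self, Nat.sub_zero]
      abel
    rw [e]
    refine (norm_add_le _ _).trans (add_le_add_right ?_ _)
    exact (norm_sum_le _ _).trans (Finset.sum_le_sum fun s hs =>
      hstepV t ht s (Finset.mem_range.1 hs))

end Regular

end NetProblem

end

/-! ### Stability of the closed loop and sums of squared errors -/

section

/-- Convolution with a causal geometric kernel is bounded on `ℓ²`. -/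
theorem sum_causal_sq_le {γ : ℝ} (h0 : 0 ≤ γ) (h1 : γ < 1) {T : ℕ} (e d : ℕ → ℝ) (hd0 : ∀ t, 0 ≤ d t)
    (hd : ∀ t ≤ T, d t ≤ ∑ s ∈ Finset.range t, γ ^ (t - s - 1) * e s) :
    ∑ t ∈ Finset.range (T + 1), d t ^ 2 ≤
      ((1 - γ)⁻¹) ^ 2 * ∑ s ∈ Finset.range T, e s ^ 2 := by
  let κ : ℕ → ℕ → ℝ := fun t s => if s < t then γ ^ (t - s - 1) else 0
  have hκ : ∀ t s, 0 ≤ κ t s := fun t s => by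
    simp only [κ]; split_ifs
    · positivity
    · exact le_rfl
  have hrow : ∀ t ≤ T, ∀ c : ℕ → ℝ, ∑ s ∈ Finset.range T, κ t s * c s =
      ∑ s ∈ Finset.range t, γ ^ (t - s - 1) * c s := by
    intro t ht c
    rw [← Finset.sum_subset (Finset.range_mono ht) (fun s _ hs => by
      rw [Finset.mem_range] at hs; simp [κ, hs])]
    exact Finset.sum_congr rfl fun s hs => by simp [κ, Finset.mem_range.1 hs]
  have hs := schur_sum_sq_le (Finset.range (T + 1)) (Finset.range T) κ e (a := (1 - γ)⁻¹)
    (b := (1 - γ)⁻¹) hκ (inv_nonneg.2 (by linarith)) (fun t ht => by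
      rw [Finset.mem_range] at ht
      have := hrow t (by omega) (fun _ => 1)
      simp only [mul_one] at this
      rw [this]
      have h2 : ∀ s ∈ Finset.range t, γ ^ (t - s - 1) = γ ^ (t - 1 - s) := fun s _ => by
        congr 1; omega
      rw [Finset.sum_congr rfl h2, Finset.sum_range_reflect (fun j => γ ^ j) t]
      exact sum_pow_le h0 h1 t) (fun s hs => by
      rw [Finset.mem_range] at hs
      rw [Finset.range_eq_Ico, ← Finset.sum_Ico_consecutive _ (Nat.zero_le (s + 1)) (by omega),
        Finset.sum_eq_zero (s := Finset.Ico 0 (s + 1)) (fun t ht => by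
          rw [Finset.mem_Ico] at ht
          exact if_neg (by omega)), zero_add, Finset.sum_Ico_eq_sum_range]
      refine le_trans (le_of_eq (Finset.sum_congr rfl fun j _ => ?_)) (sum_pow_le h0 h1 _)
      simp only [κ]
      rw [if_pos (by omega)]
      congr 1; omega)
  refine le_trans (Finset.sum_le_sum fun t ht => ?_) (hs.trans (le_of_eq (by ring)))
  rw [Finset.mem_range] at ht
  rw [hrow t (by omega)]
  exact pow_le_pow_left₀ (hd0 t) (hd t (by omega)) 2

theorem sum_le_sqrt_mul_card {ι : Type*} (s : Finset ι) (c : ι → ℝ) {n G : ℝ} (hn : (s.card : ℝ) ≤ n)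
    (hG : ∑ i ∈ s, c i ^ 2 ≤ G) : ∑ i ∈ s, c i ≤ √(n * G) := by
  refine Real.le_sqrt_of_sq_le ((sq_sum_le_card_mul_sum_sq (s := s) (f := c)).trans ?_)
  exact mul_le_mul hn hG (by positivity) (le_trans (by positivity) hn)

namespace NetProblem.Regular

variable {N : ℕ} {S : NetProblem N} {μ L M : ℝ} {κ0 : ℕ}

theorem errConst_nonneg (h : S.Regular μ L M κ0) : 0 ≤ errConst μ L M := by
  have := h.K_pos
  have := spaceConst_pos h.μ_pos h.L_pos h.M_pos
  rw [errConst]; positivity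

/-- The linear form of the error needed for the Gronwall argument. A forecast error perturbs a
gradient in proportion to the state or control where it is evaluated. Of the bound for these, the
part from the current state decays and is thus weighted twice, which gives the sum with exponents `2
* τ`; the part from the disturbances does not decay and gives `Q`. -/
theorem control_error_le (h : S.Regular μ L M κ0) {T t k κ : ℕ} {θs : ℕ → S.Param}
    {θh : ℕ → ℕ → S.Param} (hθ : ∀ t, θs t ∈ S.Θ) (hθh : ∀ s t, θh s t ∈ S.Θ) {Dk : ℝ}
    (hw : S.WindowBound T k Dk) (hk0 : 0 < k) (hkT : k ≤ T) (hκ : κ0 ≤ κ) {x0 : S.State}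
    {x : ℕ → S.State} {u : ℕ → S.Control} (hx : S.IsUDTPC T k κ θs θh x0 x u) (ht : t < T)
    {Y P : ℕ → S.State} {V : ℕ → S.Control} (hY : S.TrueKKT T θs t (x t) Y V P) {s Q : ℝ}
    (hs : ∑ τ ∈ Finset.range (min k (T - t) + 1), decayRate μ L M ^ (2 * τ) *
      ‖θh (t + τ) t - θs (t + τ)‖ ≤ s)
    (hQ : ∑ τ ∈ Finset.range (min k (T - t) + 1), decayRate μ L M ^ τ *
      ‖θh (t + τ) t - θs (t + τ)‖ ≤ Q) :
    ‖u t - V 0‖ ≤ √(errConst μ L M) *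
      ((N * decayRate μ L M ^ κ + decayRate μ L M ^ k + s) * ‖x t‖ +
      (N * decayRate μ L M ^ κ + decayRate μ L M ^ k + Q + 2 * (1 - decayRate μ L M)⁻¹) * Dk) := by
  have key := h.control_error_sq_le hθ hθh hw hk0 hkT hκ (Or.inl le_rfl) hx ht hY
  have hDk := window_nonneg hw hkT (hθ 0)
  have h0 := h.rate_pos
  have h1 := h.rate_lt_one
  have hE := h.errConst_nonneg
  set γ := decayRate μ L M
  have b1 : (N : ℝ) * (γ ^ κ * (‖x t‖ + Dk)) ^ 2 ≤ (N * (γ ^ κ * (‖x t‖ + Dk))) ^ 2 := by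
    rw [mul_pow (N : ℝ)]
    refine mul_le_mul_of_nonneg_right ?_ (sq_nonneg _)
    exact_mod_cast Nat.le_self_pow two_ne_zero N
  have b3 : ∑ τ ∈ Finset.range (min k (T - t) + 1), (γ ^ τ *
      (‖θh (t + τ) t - θs (t + τ)‖ * (γ ^ τ * ‖x t‖ + Dk))) ^ 2 ≤ (s * ‖x t‖ + Q * Dk) ^ 2 := by
    refine (sum_sq_le_sq_sum _ fun _ _ => by positivity).trans ?_
    refine pow_le_pow_left₀ (Finset.sum_nonneg fun _ _ => by positivity) ?_ 2
    have e : ∑ τ ∈ Finset.range (min k (T - t) + 1), γ ^ τ *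
        (‖θh (t + τ) t - θs (t + τ)‖ * (γ ^ τ * ‖x t‖ + Dk)) =
        (∑ τ ∈ Finset.range (min k (T - t) + 1), γ ^ (2 * τ) * ‖θh (t + τ) t - θs (t + τ)‖) * ‖x t‖ +
        (∑ τ ∈ Finset.range (min k (T - t) + 1), γ ^ τ * ‖θh (t + τ) t - θs (t + τ)‖) * Dk := by
      rw [Finset.sum_mul, Finset.sum_mul, ← Finset.sum_add_distrib]
      exact Finset.sum_congr rfl fun τ _ => by ring
    rw [e]
    gcongr
  have b4 : ∑ τ ∈ Finset.range (min k (T - t)), (γ ^ τ *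
        ‖S.dist (t + τ) (θh (t + τ) t) - S.dist (t + τ) (θs (t + τ))‖) ^ 2 ≤
      (2 * (1 - γ)⁻¹ * Dk) ^ 2 := by
    refine (sum_sq_le_sq_sum _ fun _ _ => by positivity).trans ?_
    refine pow_le_pow_left₀ (Finset.sum_nonneg fun _ _ => by positivity) ?_ 2
    calc _ ≤ ∑ τ ∈ Finset.range (min k (T - t)), γ ^ τ * (2 * Dk) := by
          refine Finset.sum_le_sum fun τ hτ => ?_
          rw [Finset.mem_range] at hτ
          gcongr
          have h2 := dist_norm_le hw hk0 hkT (s := t + τ) (by omega) (hθh (t + τ) t)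
          have h3 := dist_norm_le hw hk0 hkT (s := t + τ) (by omega) (hθ (t + τ))
          exact (norm_sub_le _ _).trans (by linarith)
      _ = (∑ τ ∈ Finset.range (min k (T - t)), γ ^ τ) * (2 * Dk) := by rw [Finset.sum_mul]
      _ ≤ (1 - γ)⁻¹ * (2 * Dk) := by
          gcongr
          exact sum_pow_le h0.le h1 _
      _ = _ := by ring
  have hs0 : 0 ≤ s := le_trans (Finset.sum_nonneg fun _ _ => by positivity) hs
  have hQ0 : 0 ≤ Q := le_trans (Finset.sum_nonneg fun _ _ => by positivity) hQ
  have h1' : 0 ≤ (1 - γ)⁻¹ := inv_nonneg.2 (by linarith)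
  refine abs_le_of_sq_le_sq' ?_ (by positivity) |>.2
  rw [mul_pow, Real.sq_sqrt hE]
  refine key.trans (mul_le_mul_of_nonneg_left ?_ hE)
  refine (add_le_add (add_le_add (add_le_add_left b1 _) b3) b4).trans ?_
  have n1 : 0 ≤ (N : ℝ) * (γ ^ κ * (‖x t‖ + Dk)) := by positivity
  have n2 : 0 ≤ γ ^ k * (‖x t‖ + Dk) := by positivity
  have n3 : 0 ≤ s * ‖x t‖ + Q * Dk := by positivity
  have n4 : 0 ≤ 2 * (1 - γ)⁻¹ * Dk := by positivity
  have e : (N * γ ^ κ + γ ^ k + s) * ‖x t‖ + (N * γ ^ κ + γ ^ k + Q + 2 * (1 - γ)⁻¹) * Dk =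
      (N : ℝ) * (γ ^ κ * (‖x t‖ + Dk)) + γ ^ k * (‖x t‖ + Dk) + (s * ‖x t‖ + Q * Dk) +
        2 * (1 - γ)⁻¹ * Dk := by ring
  rw [e]
  generalize (N : ℝ) * (γ ^ κ * (‖x t‖ + Dk)) = z1 at n1
  generalize γ ^ k * (‖x t‖ + Dk) = z2 at n2
  generalize s * ‖x t‖ + Q * Dk = z3 at n3
  generalize 2 * (1 - γ)⁻¹ * Dk = z4 at n4
  have := mul_nonneg n1 n2
  have := mul_nonneg n1 n3
  have := mul_nonneg n1 n4
  have := mul_nonneg n2 n3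
  have := mul_nonneg n2 n4
  have := mul_nonneg n3 n4
  linarith [show (z1 + z2 + z3 + z4) ^ 2 = z1 ^ 2 + z2 ^ 2 + z3 ^ 2 + z4 ^ 2 + 2 * (z1 * z2) +
    2 * (z1 * z3) + 2 * (z1 * z4) + 2 * (z2 * z3) + 2 * (z2 * z4) + 2 * (z3 * z4) by ring]

/-- Gain from the error of the controls to the states. -/
def _root_.NetCtrl.gainConst (μ L M : ℝ) : ℝ := √(4 * kktConst μ L M) * L * √(errConst μ L M)

/-- Input-to-state stability of the closed loop. -/
theorem state_norm_le (h : S.Regular μ L M κ0) {T k κ : ℕ} {θs : ℕ → S.Param}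
    {θh : ℕ → ℕ → S.Param} (hθ : ∀ t, θs t ∈ S.Θ) (hθh : ∀ s t, θh s t ∈ S.Θ) {Dk : ℝ}
    (hw : S.WindowBound T k Dk) (hk0 : 0 < k) (hkT : k ≤ T) (hκ : κ0 ≤ κ) {x0 : S.State}
    {x : ℕ → S.State} {u : ℕ → S.Control} (hx : S.IsUDTPC T k κ θs θh x0 x u) {a s Q : ℝ}
    (ha0 : 0 < a) (ha1 : a < 1) (ha : decayRate μ L M = a ^ 2) (hs0 : 0 ≤ s) (hQ0 : 0 ≤ Q)
    (hs : ∀ t < T, ∑ τ ∈ Finset.range (min k (T - t) + 1), decayRate μ L M ^ (2 * τ) *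
      ‖θh (t + τ) t - θs (t + τ)‖ ≤ s)
    (hQ : ∀ t < T, ∑ τ ∈ Finset.range (min k (T - t) + 1), decayRate μ L M ^ τ *
      ‖θh (t + τ) t - θs (t + τ)‖ ≤ Q)
    (hsmall : gainConst μ L M * (N * decayRate μ L M ^ κ + decayRate μ L M ^ k + s) ≤
      a * (1 - a) / 2) :
    ∀ t ≤ T, ‖x t‖ ≤ 2 * trajConst μ L M * (a ^ t * ‖x0‖) +
      2 * ((trajConst μ L M + gainConst μ L M * (N * decayRate μ L M ^ κ + decayRate μ L M ^ k + Q +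
        2 * (1 - decayRate μ L M)⁻¹) * (1 - decayRate μ L M)⁻¹) * Dk) := by
  have hDk := window_nonneg hw hkT (hθ 0)
  have h0 := h.rate_pos
  have h1 := h.rate_lt_one
  have hL := h.L_pos
  have hD : ∀ s < T, ∀ θ ∈ S.Θ, ‖S.dist s θ‖ ≤ Dk := fun s hs θ hθ => dist_norm_le hw hk0 hkT hs hθ
  have hex : ∀ s, ∃ Y V P, S.TrueKKT T θs s (x s) Y V P := fun s => h.exists_trueKKT hθ s (x s)
  choose Y V P hY using hex
  have hdev := (h.deviation_le hθ hx.traj hY).1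
  have hY0 := (h.trueKKT_norm_le hθ hD hDk (hY 0)).1
  have hc : 0 ≤ trajConst μ L M := Real.sqrt_nonneg _
  have hgn : 0 ≤ gainConst μ L M := by rw [gainConst]; positivity
  set γ := decayRate μ L M
  have h1' : 0 ≤ (1 - γ)⁻¹ := inv_nonneg.2 (by linarith)
  refine gronwall_geometric (z := fun t => ‖x t‖)
    (g := gainConst μ L M * (N * γ ^ κ + γ ^ k + s)) ha0 ha1 hc (by positivity) (by positivity)
    (norm_nonneg _) hsmall fun t ht => ?_
  have hb := hY0 t (by omega)
  rw [hx.traj.1] at hb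
  -- The optimal trajectory decays at rate `a ^ 2`; only rate `a` is kept, as the closed loop needs
  -- the gap.
  have hat : γ ^ t ≤ a ^ t := by
    rw [ha]; exact pow_le_pow_left₀ (by positivity) (by nlinarith) t
  have hb2 : trajConst μ L M * (γ ^ t * ‖x0‖ + Dk) ≤
      trajConst μ L M * (a ^ t * ‖x0‖) + trajConst μ L M * Dk := by
    rw [← mul_add]; gcongr
  have herr : ∑ s' ∈ Finset.range t, γ ^ (t - s' - 1) * (√(4 * kktConst μ L M) * L *
      ‖u s' - V s' 0‖) ≤ gainConst μ L M * (N * γ ^ κ + γ ^ k + Q + 2 * (1 - γ)⁻¹) * (1 - γ)⁻¹ * Dk +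
      ∑ s' ∈ Finset.range t, (a ^ 2) ^ (t - s' - 1) *
        (gainConst μ L M * (N * γ ^ κ + γ ^ k + s) * ‖x s'‖) := by
    rw [← ha]
    calc _ ≤ ∑ s' ∈ Finset.range t, (γ ^ (t - 1 - s') *
          (gainConst μ L M * (N * γ ^ κ + γ ^ k + Q + 2 * (1 - γ)⁻¹) * Dk) +
          γ ^ (t - s' - 1) * (gainConst μ L M * (N * γ ^ κ + γ ^ k + s) * ‖x s'‖)) := by
          refine Finset.sum_le_sum fun s' hs' => ?_
          rw [Finset.mem_range] at hs'
          have he := h.control_error_le hθ hθh hw hk0 hkT hκ hx (show s' < T by omega) (hY s')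
            (hs s' (by omega)) (hQ s' (by omega))
          rw [show t - 1 - s' = t - s' - 1 by omega, ← mul_add]
          refine mul_le_mul_of_nonneg_left ?_ (by positivity)
          refine (mul_le_mul_of_nonneg_left he (show 0 ≤ √(4 * kktConst μ L M) * L by
            positivity)).trans (le_of_eq ?_)
          rw [gainConst]; ring
      _ ≤ _ := by
          rw [Finset.sum_add_distrib, ← Finset.sum_mul, Finset.sum_range_reflect (fun j => γ ^ j) t]
          refine add_le_add_left ?_ _
          refine (mul_le_mul_of_nonneg_right (sum_pow_le h0.le h1 t) (by positivity)).trans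
            (le_of_eq ?_)
          ring
  have htri := norm_sub_norm_le (x t) (Y 0 t)
  have := hdev t ht
  linarith

/-- Sum of the squared errors of the controls. -/
theorem sum_error_sq_le (h : S.Regular μ L M κ0) {T k κ r : ℕ} {θs : ℕ → S.Param}
    {θh : ℕ → ℕ → S.Param} (hθ : ∀ t, θs t ∈ S.Θ) (hθh : ∀ s t, θh s t ∈ S.Θ) {Dk : ℝ}
    (hw : S.WindowBound T k Dk) (hk0 : 0 < k) (hkT : k ≤ T) (hκ : κ0 ≤ κ) (hr : r ≤ κ ∨ N ≤ κ)
    {x0 : S.State} {x : ℕ → S.State} {u : ℕ → S.Control} (hx : S.IsUDTPC T k κ θs θh x0 x u)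
    {Y P : ℕ → ℕ → S.State} {V : ℕ → ℕ → S.Control}
    (hY : ∀ s, S.TrueKKT T θs s (x s) (Y s) (V s) (P s)) {a X : ℝ} (ha : decayRate μ L M ≤ a)
    (hX : ∀ t < T, ‖x t‖ ≤ X) {Φ : ℕ → ℝ}
    (hΦ : ∀ n, Φ n = ∑ t ∈ Finset.range (T - n + 1), ‖θh (t + n) t - θs (t + n)‖ ^ 2) :
    ∑ t ∈ Finset.range T, ‖u t - V t 0‖ ^ 2 ≤ errConst μ L M * ((X + Dk) ^ 2 + L ^ 2) *
      (T * (N * decayRate μ L M ^ (2 * r) + decayRate μ L M ^ (2 * k)) +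
        ∑ n ∈ Finset.range (k + 1), a ^ n * Φ n) := by
  have hDk := window_nonneg hw hkT (hθ 0)
  have h0 := h.rate_pos
  have h1 := h.rate_lt_one
  have hE := h.errConst_nonneg
  set γ := decayRate μ L M
  -- The indicator keeps those pairs for which the forecast time `t + n` does not exceed `T`.
  -- Exchanging the sums over `t` and `n` then produces the quantities `Φ n`.
  have hstep : ∀ t ∈ Finset.range T, ‖u t - V t 0‖ ^ 2 ≤ errConst μ L M * ((X + Dk) ^ 2 + L ^ 2) *
      ((N * γ ^ (2 * r) + γ ^ (2 * k)) + ∑ n ∈ Finset.range (k + 1), a ^ n *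
        (if t < T - n + 1 then ‖θh (t + n) t - θs (t + n)‖ ^ 2 else 0)) := by
    intro t ht
    rw [Finset.mem_range] at ht
    refine (h.control_error_sq_le hθ hθh hw hk0 hkT hκ hr hx ht (hY t)).trans ?_
    rw [mul_assoc]
    refine mul_le_mul_of_nonneg_left ?_ hE
    have hZ : (‖x t‖ + Dk) ^ 2 ≤ (X + Dk) ^ 2 :=
      pow_le_pow_left₀ (by positivity) (by linarith [hX t ht]) 2
    have hsub : Finset.range (min k (T - t) + 1) ⊆ Finset.range (k + 1) :=
      Finset.range_mono (by omega)
    have c1 : (N : ℝ) * (γ ^ r * (‖x t‖ + Dk)) ^ 2 + (γ ^ k * (‖x t‖ + Dk)) ^ 2 ≤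
        ((X + Dk) ^ 2 + L ^ 2) * (N * γ ^ (2 * r) + γ ^ (2 * k)) := by
      calc _ = (‖x t‖ + Dk) ^ 2 * (N * γ ^ (2 * r) + γ ^ (2 * k)) := by ring
        _ ≤ _ := mul_le_mul_of_nonneg_right (hZ.trans (by linarith [sq_nonneg L])) (by positivity)
    have hif : ∀ n ∈ Finset.range (k + 1), 0 ≤ a ^ n *
        (if t < T - n + 1 then ‖θh (t + n) t - θs (t + n)‖ ^ 2 else 0) := fun n _ => by
      have : 0 ≤ a := h0.le.trans ha
      split_ifs <;> positivity
    have hpow : ∀ n : ℕ, (γ ^ n) ^ 2 ≤ a ^ n := fun n => by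
      refine le_trans ?_ (pow_le_pow_left₀ h0.le ha n)
      exact pow_le_of_le_one (by positivity) (pow_le_one₀ h0.le h1.le) two_ne_zero
    have c2 : ∑ τ ∈ Finset.range (min k (T - t) + 1), (γ ^ τ *
        (‖θh (t + τ) t - θs (t + τ)‖ * (γ ^ τ * ‖x t‖ + Dk))) ^ 2 ≤
        (X + Dk) ^ 2 * ∑ n ∈ Finset.range (k + 1), a ^ n *
        (if t < T - n + 1 then ‖θh (t + n) t - θs (t + n)‖ ^ 2 else 0) := by
      refine le_trans ?_ (mul_le_mul_of_nonneg_left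
        (Finset.sum_le_sum_of_subset_of_nonneg hsub fun n hn _ => hif n hn) (sq_nonneg _))
      rw [Finset.mul_sum]
      refine Finset.sum_le_sum fun τ hτ => ?_
      rw [Finset.mem_range] at hτ
      rw [if_pos (by omega)]
      have h2 : (γ ^ τ * ‖x t‖ + Dk) ^ 2 ≤ (X + Dk) ^ 2 := by
        refine le_trans (pow_le_pow_left₀ (by positivity) ?_ 2) hZ
        gcongr
        exact mul_le_of_le_one_left (norm_nonneg _) (pow_le_one₀ h0.le h1.le)
      calc _ = (γ ^ τ * ‖x t‖ + Dk) ^ 2 * ((γ ^ τ) ^ 2 * ‖θh (t + τ) t - θs (t + τ)‖ ^ 2) := by ring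
        _ ≤ _ := by gcongr; exact hpow τ
    have c3 : ∑ τ ∈ Finset.range (min k (T - t)), (γ ^ τ *
        ‖S.dist (t + τ) (θh (t + τ) t) - S.dist (t + τ) (θs (t + τ))‖) ^ 2 ≤
        L ^ 2 * ∑ n ∈ Finset.range (k + 1), a ^ n *
        (if t < T - n + 1 then ‖θh (t + n) t - θs (t + n)‖ ^ 2 else 0) := by
      refine le_trans ?_ (mul_le_mul_of_nonneg_left
        (Finset.sum_le_sum_of_subset_of_nonneg
          ((Finset.range_mono (Nat.le_succ _)).trans hsub) fun n hn _ => hif n hn) (sq_nonneg _))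
      rw [Finset.mul_sum]
      refine Finset.sum_le_sum fun τ hτ => ?_
      rw [Finset.mem_range] at hτ
      rw [if_pos (by omega)]
      have h2 := pow_le_pow_left₀ (norm_nonneg _)
        (h.dist_lip (t + τ) _ (hθh (t + τ) t) _ (hθ (t + τ))) 2
      calc _ = (γ ^ τ) ^ 2 *
            ‖S.dist (t + τ) (θh (t + τ) t) - S.dist (t + τ) (θs (t + τ))‖ ^ 2 := by ring
        _ ≤ a ^ τ * (L * ‖θh (t + τ) t - θs (t + τ)‖) ^ 2 :=
            mul_le_mul (hpow τ) h2 (sq_nonneg _) (pow_nonneg (h0.le.trans ha) τ)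
        _ = _ := by ring
    exact le_trans (add_le_add (add_le_add c1 c2) c3) (le_of_eq (by ring))
  refine (Finset.sum_le_sum hstep).trans ?_
  rw [← Finset.mul_sum, Finset.sum_add_distrib, Finset.sum_const, Finset.card_range, nsmul_eq_mul,
    Finset.sum_comm]
  refine mul_le_mul_of_nonneg_left (add_le_add_right (Finset.sum_le_sum fun n _ => ?_) _)
    (by positivity)
  rw [← Finset.mul_sum, hΦ, ← Finset.sum_filter]
  refine mul_le_mul_of_nonneg_left ?_ (pow_nonneg (h0.le.trans ha) n)
  refine Finset.sum_le_sum_of_subset_of_nonneg (fun t ht => ?_) fun _ _ _ => sq_nonneg _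
  rw [Finset.mem_filter] at ht
  exact Finset.mem_range.2 ht.2

/-- Constant of the comparison of costs. -/
def _root_.NetCtrl.gainSqConst (μ L M : ℝ) : ℝ :=
  ((1 - decayRate μ L M)⁻¹) ^ 2 * (√(4 * kktConst μ L M) * L) ^ 2

/-- The deviations are causal convolutions of the control errors with a geometric kernel, which act
boundedly on ℓ² independently of `T`. -/
theorem deviation_sq_le (h : S.Regular μ L M κ0) {T : ℕ} {θs : ℕ → S.Param}
    (hθ : ∀ t, θs t ∈ S.Θ) {x0 : S.State} {x : ℕ → S.State} {u : ℕ → S.Control}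
    (hx : IsTraj S.A S.B (fun t => S.dist t (θs t)) x0 T x u) {Y P : ℕ → ℕ → S.State}
    {V : ℕ → ℕ → S.Control} (hY : ∀ s, S.TrueKKT T θs s (x s) (Y s) (V s) (P s)) :
    (∑ t ∈ Finset.range (T + 1), ‖x t - Y 0 t‖ ^ 2 ≤
      gainSqConst μ L M * ∑ t ∈ Finset.range T, ‖u t - V t 0‖ ^ 2) ∧
    (∑ t ∈ Finset.range T, ‖u t - V 0 t‖ ^ 2 ≤
      2 * (1 + gainSqConst μ L M) * ∑ t ∈ Finset.range T, ‖u t - V t 0‖ ^ 2) := by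
  obtain ⟨hdx, hdu⟩ := h.deviation_le hθ hx hY
  have h0 := h.rate_pos
  have h1 := h.rate_lt_one
  have e : ((1 - decayRate μ L M)⁻¹) ^ 2 * ∑ s ∈ Finset.range T,
      (√(4 * kktConst μ L M) * L * ‖u s - V s 0‖) ^ 2 =
      gainSqConst μ L M * ∑ t ∈ Finset.range T, ‖u t - V t 0‖ ^ 2 := by
    simp only [mul_pow _ ‖_‖]
    rw [← Finset.mul_sum, gainSqConst, mul_assoc]
  constructor
  · rw [← e]
    exact sum_causal_sq_le h0.le h1 _ (fun t => ‖x t - Y 0 t‖) (fun t => norm_nonneg _) hdx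
  · have hc := sum_causal_sq_le h0.le h1 (fun s => √(4 * kktConst μ L M) * L * ‖u s - V s 0‖)
      (fun t => ∑ s ∈ Finset.range t, decayRate μ L M ^ (t - s - 1) *
        (√(4 * kktConst μ L M) * L * ‖u s - V s 0‖))
      (fun t => Finset.sum_nonneg fun s _ => by have := h.L_pos; positivity) (T := T)
      (fun t _ => le_rfl)
    rw [e, Finset.sum_range_succ] at hc
    have hc' := le_trans (le_add_of_nonneg_right (sq_nonneg _)) hc
    calc ∑ t ∈ Finset.range T, ‖u t - V 0 t‖ ^ 2
        ≤ ∑ t ∈ Finset.range T, 2 * (‖u t - V t 0‖ ^ 2 + (∑ s ∈ Finset.range t,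
            decayRate μ L M ^ (t - s - 1) * (√(4 * kktConst μ L M) * L * ‖u s - V s 0‖)) ^ 2) :=
          Finset.sum_le_sum fun t ht =>
            (pow_le_pow_left₀ (norm_nonneg _) (hdu t (Finset.mem_range.1 ht)) 2).trans
              (sq_add_le_two_mul _ _)
      _ ≤ _ := by
          rw [← Finset.mul_sum, Finset.sum_add_distrib]
          linarith

/-- The cost of a closed-loop trajectory exceeds the optimal cost by an amount that is controlled
by the deviation of the trajectories. -/
theorem cost_sub_le (h : S.Regular μ L M κ0) {T : ℕ} {θs : ℕ → S.Param}
    (hθ : ∀ t, θs t ∈ S.Θ) {x xs : ℕ → S.State} {u us : ℕ → S.Control} {X G H : ℝ} (hT : 0 < T)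
    (hX : 0 ≤ X) (hxs : ∀ t ≤ T, ‖xs t‖ ≤ X) (hus : ∀ t < T, ‖us t‖ ≤ X)
    (hH : ∑ t ∈ Finset.range (T + 1), ‖x t - xs t‖ ^ 2 ≤ H * G)
    (hH' : ∑ t ∈ Finset.range T, ‖u t - us t‖ ^ 2 ≤ H * G) :
    S.cost T θs x u - S.cost T θs xs us ≤ 2 * L * X * √(2 * T * (H * G)) + 2 * L * (H * G) := by
  have hL := h.L_pos
  have hf : ∀ t ≤ T, S.stateCost t (θs t) (x t) - S.stateCost t (θs t) (xs t) ≤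
      L * X * ‖x t - xs t‖ + L * ‖x t - xs t‖ ^ 2 := by
    intro t ht
    have h2 := (h.state t _ (hθ t)).upper_bound h.μ_pos.le (xs t) (x t)
    have h3 := (h.state t _ (hθ t)).norm_gradient_sub_le (xs t) 0
    rw [h.state_grad_zero t _ (hθ t), sub_zero, sub_zero] at h3
    have h4 := real_inner_le_norm (gradient (S.stateCost t (θs t)) (xs t)) (x t - xs t)
    have h5 := mul_le_mul_of_nonneg_right (h3.trans (mul_le_mul_of_nonneg_left (hxs t ht) hL.le))
      (norm_nonneg (x t - xs t))
    linarith
  have hc : ∀ t < T, S.ctrlCost (t + 1) (θs t) (u t) - S.ctrlCost (t + 1) (θs t) (us t) ≤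
      L * X * ‖u t - us t‖ + L * ‖u t - us t‖ ^ 2 := by
    intro t ht
    have h2 := (h.ctrl (t + 1) _ (hθ t)).upper_bound h.μ_pos.le (us t) (u t)
    have h3 := (h.ctrl (t + 1) _ (hθ t)).norm_gradient_sub_le (us t) 0
    rw [h.ctrl_grad_zero (t + 1) _ (hθ t), sub_zero, sub_zero] at h3
    have h4 := real_inner_le_norm (gradient (S.ctrlCost (t + 1) (θs t)) (us t)) (u t - us t)
    have h5 := mul_le_mul_of_nonneg_right (h3.trans (mul_le_mul_of_nonneg_left (hus t ht) hL.le))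
      (norm_nonneg (u t - us t))
    linarith
  have hT1 : (1 : ℝ) ≤ T := by exact_mod_cast hT
  -- The count `2 * T` covers the `T + 1` states because `T ≥ 1`.
  have s1 := sum_le_sqrt_mul_card (Finset.range (T + 1)) (fun t => ‖x t - xs t‖)
    (n := 2 * T) (by rw [Finset.card_range]; push_cast; linarith) hH
  have s2 := sum_le_sqrt_mul_card (Finset.range T) (fun t => ‖u t - us t‖)
    (n := 2 * T) (by rw [Finset.card_range]; linarith) hH'
  have e : S.cost T θs x u - S.cost T θs xs us =
      ∑ t ∈ Finset.range (T + 1), (S.stateCost t (θs t) (x t) - S.stateCost t (θs t) (xs t)) +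
      ∑ t ∈ Finset.range T,
        (S.ctrlCost (t + 1) (θs t) (u t) - S.ctrlCost (t + 1) (θs t) (us t)) := by
    rw [cost, cost, horizonCost, horizonCost, Finset.sum_range_succ]
    simp only [Finset.sum_add_distrib, Finset.sum_sub_distrib]
    ring
  rw [e]
  have t1 := Finset.sum_le_sum fun t (ht : t ∈ Finset.range (T + 1)) =>
    hf t (by rw [Finset.mem_range] at ht; omega)
  have t2 := Finset.sum_le_sum fun t (ht : t ∈ Finset.range T) => hc t (Finset.mem_range.1 ht)
  rw [Finset.sum_add_distrib, ← Finset.mul_sum, ← Finset.mul_sum] at t1 t2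
  have m1 := mul_le_mul_of_nonneg_left s1 (show 0 ≤ L * X by positivity)
  have m2 := mul_le_mul_of_nonneg_left s2 (show 0 ≤ L * X by positivity)
  have m3 := mul_le_mul_of_nonneg_left hH hL.le
  have m4 := mul_le_mul_of_nonneg_left hH' hL.le
  linarith

end NetProblem.Regular

end

/-! ### Existence of trajectories, regret, and the rates of the theorem -/

section

namespace NetProblem

variable {N : ℕ} {S : NetProblem N}

theorem isOPT_iff {T : ℕ} {θs : ℕ → S.Param} {x0 : S.State} {xs : ℕ → S.State}
    {us : ℕ → S.Control} : S.IsOPT T θs x0 xs us ↔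
    IsSolution S.A S.B (fun τ => S.stateCost (0 + τ) (θs (0 + τ)))
      (fun τ => S.ctrlCost (0 + τ + 1) (θs (0 + τ))) (S.stateCost T (θs T))
      (fun τ => S.dist (0 + τ) (θs (0 + τ))) x0 T xs us := by
  simp only [zero_add]
  exact Iff.rfl

namespace Regular

variable {μ L M : ℝ} {κ0 : ℕ}

theorem exists_isOPT (h : S.Regular μ L M κ0) (T : ℕ) {θs : ℕ → S.Param} (hθ : ∀ t, θs t ∈ S.Θ)
    (x0 : S.State) : ∃ xs us, S.IsOPT T θs x0 xs us := by
  obtain ⟨y, v, hsol⟩ := h.exists_solution S.A S.B (fun τ => S.dist (0 + τ) (θs (0 + τ))) x0 0 T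
    (fun τ => hθ (0 + τ)) (h.state T _ (hθ T)).differentiable.continuous (h.state_nonneg T _ (hθ T))
  exact ⟨y, v, isOPT_iff.2 hsol⟩

theorem trueKKT_of_isOPT (h : S.Regular μ L M κ0) {T : ℕ} {θs : ℕ → S.Param}
    (hθ : ∀ t, θs t ∈ S.Θ) {x0 : S.State} {xs : ℕ → S.State} {us : ℕ → S.Control}
    (hopt : S.IsOPT T θs x0 xs us) : ∃ p, S.TrueKKT T θs 0 x0 xs us p := by
  obtain ⟨p, hp, hpT⟩ := h.kkt_of_solution (fun τ => hθ (0 + τ))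
    (h.state T _ (hθ T)).differentiable (isOPT_iff.1 hopt)
  exact ⟨p, hp, hpT⟩

theorem exists_isUDTPC (h : S.Regular μ L M κ0) (T k κ : ℕ) {θs : ℕ → S.Param}
    {θh : ℕ → ℕ → S.Param} (hθh : ∀ s t, θh s t ∈ S.Θ) (x0 : S.State) :
    ∃ x u, S.IsUDTPC T k κ θs θh x0 x u := by
  -- A feedback law is chosen for every time and state. For `t ≥ T` the planning horizon `T - t` is
  -- `0`, so the choice is possible there too and is not used.
  have hctl : ∀ (t : ℕ) (x : S.State), ∃ u : S.Control,
      (t + k < T → ∀ i, ∃ y v,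
        S.IsAgentSolution κ i t k (fun τ => θh (t + τ) t) S.F x y v ∧ u i = v 0 i) ∧
      (T ≤ t + k → ∀ i, ∃ y v,
        S.IsAgentSolution κ i t (T - t) (fun τ => θh (t + τ) t) (S.stateCost T (θh T t)) x y v ∧
          u i = v 0 i) := by
    intro t x
    rcases lt_or_ge (t + k) T with ht | ht
    · have hs : ∀ i, ∃ y v, S.IsAgentSolution κ i t k (fun τ => θh (t + τ) t) S.F x y v :=
        fun i => h.exists_solution _ _ _ _ t k (fun τ => hθh (t + τ) t)
          h.terminal.differentiable.continuous h.terminal_nonneg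
      choose y v hyv using hs
      exact ⟨WithLp.toLp 2 fun i => v i 0 i, fun _ i => ⟨y i, v i, hyv i, rfl⟩,
        fun h' => absurd h' (by omega)⟩
    · have hs : ∀ i, ∃ y v, S.IsAgentSolution κ i t (T - t) (fun τ => θh (t + τ) t)
          (S.stateCost T (θh T t)) x y v :=
        fun i => h.exists_solution _ _ _ _ t (T - t) (fun τ => hθh (t + τ) t)
          (h.state T _ (hθh T t)).differentiable.continuous (h.state_nonneg T _ (hθh T t))
      choose y v hyv using hs
      exact ⟨WithLp.toLp 2 fun i => v i 0 i, fun h' => absurd h' (by omega),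
        fun _ i => ⟨y i, v i, hyv i, rfl⟩⟩
  choose ctl hearly hlate using hctl
  let x : ℕ → S.State := fun n => Nat.rec x0
    (fun m z => S.A z + S.B (ctl m z) + S.dist m (θs m)) n
  exact ⟨x, fun n => ctl n (x n), ⟨rfl, fun _ _ => rfl⟩, fun t ht => hearly t (x t) ht,
    fun t _ ht => hlate t (x t) ht⟩

/-- The regret in terms of the errors of the controls. -/
theorem regret_le (h : S.Regular μ L M κ0) {T k κ r : ℕ} {θs : ℕ → S.Param}
    {θh : ℕ → ℕ → S.Param} (hθ : ∀ t, θs t ∈ S.Θ) (hθh : ∀ s t, θh s t ∈ S.Θ) {Dk : ℝ}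
    (hw : S.WindowBound T k Dk) (hk0 : 0 < k) (hkT : k ≤ T) (hκ : κ0 ≤ κ) (hr : r ≤ κ ∨ N ≤ κ)
    {x0 : S.State} {x xs : ℕ → S.State} {u us : ℕ → S.Control}
    (hx : S.IsUDTPC T k κ θs θh x0 x u) (hopt : S.IsOPT T θs x0 xs us) {a X x0b : ℝ}
    (ha : decayRate μ L M ≤ a) (hX : ∀ t < T, ‖x t‖ ≤ X) (hx0 : ‖x0‖ ≤ x0b) {Φ : ℕ → ℝ}
    (hΦ : ∀ n, Φ n = ∑ t ∈ Finset.range (T - n + 1), ‖θh (t + n) t - θs (t + n)‖ ^ 2) {G : ℝ}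
    (hG : T * (N * decayRate μ L M ^ (2 * r) + decayRate μ L M ^ (2 * k)) +
        ∑ n ∈ Finset.range (k + 1), a ^ n * Φ n ≤ G) :
    S.cost T θs x u - S.cost T θs xs us ≤
      2 * L * (trajConst μ L M * (x0b + Dk)) * √(2 * T * (2 * (1 + gainSqConst μ L M) *
        (errConst μ L M * ((X + Dk) ^ 2 + L ^ 2) * G))) +
      2 * L * (2 * (1 + gainSqConst μ L M) *
        (errConst μ L M * ((X + Dk) ^ 2 + L ^ 2) * G)) := by
  have hDk := window_nonneg hw hkT (hθ 0)
  have h0 := h.rate_pos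
  have h1 := h.rate_lt_one
  have hE := h.errConst_nonneg
  have hc : 0 ≤ trajConst μ L M := Real.sqrt_nonneg _
  have hgs : 0 ≤ gainSqConst μ L M := by rw [gainSqConst]; positivity
  have hD : ∀ s < T, ∀ θ ∈ S.Θ, ‖S.dist s θ‖ ≤ Dk := fun s hs θ hθ => dist_norm_le hw hk0 hkT hs hθ
  obtain ⟨p, hp⟩ := h.trueKKT_of_isOPT hθ hopt
  -- At time `0` the given optimal trajectory is selected, so that uniqueness of optimal
  -- trajectories is not needed.
  have hex : ∀ s, ∃ Y V P, S.TrueKKT T θs s (x s) Y V P ∧ (s = 0 → Y = xs ∧ V = us) := by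
    intro s
    rcases s with _ | s
    · rw [hx.traj.1]; exact ⟨xs, us, p, hp, fun _ => ⟨rfl, rfl⟩⟩
    · obtain ⟨Y, V, P, hY⟩ := h.exists_trueKKT hθ (s + 1) (x (s + 1))
      exact ⟨Y, V, P, hY, fun h' => absurd h' (Nat.succ_ne_zero s)⟩
  choose Y V P hY hY0 using hex
  obtain ⟨hd1, hd2⟩ := h.deviation_sq_le hθ hx.traj hY
  rw [(hY0 0 rfl).1] at hd1
  rw [(hY0 0 rfl).2] at hd2
  have hsum := (h.sum_error_sq_le hθ hθh hw hk0 hkT hκ hr hx hY ha hX hΦ).trans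
    (mul_le_mul_of_nonneg_left hG (by positivity))
  obtain ⟨bx, bu, -⟩ := h.trueKKT_norm_le hθ hD hDk hp
  have hle : ∀ m : ℕ, trajConst μ L M * (decayRate μ L M ^ m * ‖x0‖ + Dk) ≤
      trajConst μ L M * (x0b + Dk) := fun m => by
    gcongr
    exact (mul_le_of_le_one_left (norm_nonneg _) (pow_le_one₀ h0.le h1.le)).trans hx0
  have hx0b : 0 ≤ x0b := (norm_nonneg _).trans hx0
  have he : 0 ≤ ∑ t ∈ Finset.range T, ‖u t - V t 0‖ ^ 2 := by positivity
  refine h.cost_sub_le hθ (by omega) (by positivity) (fun t ht => (bx t (by omega)).trans (hle t))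
    (fun t ht => (bu t (by omega)).trans (hle t)) (hd1.trans ?_) (hd2.trans ?_)
  · refine mul_le_mul (by linarith) hsum he (by positivity)
  · exact mul_le_mul_of_nonneg_left hsum (by positivity)

end Regular

end NetProblem

theorem δS_pos (L γ μ : ℝ) : 0 < δS L γ μ := by
  have : 0 ≤ ρ L γ μ := Real.sqrt_nonneg _
  rw [δS]; linarith

theorem δS_lt_one {L γ μ : ℝ} (hL : 1 < L) (hγ1 : γ < 1) (hμ : 0 < μ) : δS L γ μ < 1 := by
  have hLH : 0 < LH L := by rw [LH]; linarith
  have hL0 : 0 < L := by linarith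
  have hμJ : 0 < μJ L γ := by
    have : 0 < 1 - γ := by linarith
    rw [μJ]; positivity
  have hμH : 0 < μH L γ μ := by rw [μH]; positivity
  have : ρ L γ μ < 1 := by
    rw [ρ, Real.sqrt_lt' one_pos, one_pow, div_lt_one (by positivity)]
    linarith [pow_pos hμH 2]
  rw [δS]; linarith

/-- A lower bound of the exponent by a quotient of logarithms. -/
theorem pow_le_of_log_div_le {δ q : ℝ} {n : ℕ} (h0 : 0 < δ) (h1 : δ < 1) (hq : 0 < q)
    (hn : Real.log q / Real.log δ ≤ n) : δ ^ n ≤ q := by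
  have hl := Real.log_neg h0 h1
  rw [div_le_iff_of_neg hl] at hn
  rw [← Real.log_le_log_iff (by positivity) hq, Real.log_pow]
  exact hn

/-- Passage from a bound with a slow rate to the two regimes of the closed-loop estimate. -/
theorem regime_bounds {C δ a X W z : ℝ} (hC : 1 ≤ C) (h0 : 0 < δ) (h1 : δ < 1) (ha0 : 0 ≤ a)
    (ha : a ≤ √δ) (hX : 0 ≤ X) (hW : 0 ≤ W) {T k t : ℕ} (hz : z ≤ C * (a ^ t * X) + W) :
    (z ≤ C / (1 - √δ) * (1 - (1 - √δ)) ^ (t - k) * X + W / (1 - √δ)) ∧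
    (t ≤ T → T < t + k → z ≤ C ^ 2 / (1 - √δ) ^ 2 * (1 - (1 - √δ)) ^ ((T : ℤ) - 2 * (k : ℤ)) *
      δ ^ (t + k - T) * X + 2 * C * W / (1 - √δ) ^ 2) := by
  have hs0 : 0 < √δ := Real.sqrt_pos.2 h0
  have hs1 : √δ < 1 := by rw [Real.sqrt_lt' one_pos]; simpa using h1
  have hsq : √δ ^ 2 = δ := Real.sq_sqrt h0.le
  generalize √δ = b at *
  have hξ : 0 < 1 - b := by linarith
  have hξ1 : (1 - b) ^ 2 ≤ 1 := pow_le_one₀ hξ.le (by linarith)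
  have hC0 : 0 < C := by linarith
  have hb : a ^ t ≤ b ^ t := pow_le_pow_left₀ ha0 ha t
  rw [sub_sub_cancel]
  have hz2 : z ≤ C * (b ^ t * X) + W := hz.trans (by gcongr)
  constructor
  · refine hz2.trans (add_le_add ?_ (le_div_self hW hξ (by linarith)))
    rw [← mul_assoc]
    refine mul_le_mul_of_nonneg_right ?_ hX
    exact mul_le_mul (le_div_self hC0.le hξ (by linarith))
      (pow_le_pow_of_le_one hs0.le hs1.le (by omega)) (by positivity) (by positivity)
  · intro htT hTk
    have hCC : C ≤ C ^ 2 := by nlinarith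
    -- With `δ = b ^ 2` the exponents on the right add up to `2 * t - T`, which is at most `t`. An
    -- integer power is used because `T - 2 * k` may be negative.
    have hpow : b ^ t ≤ b ^ ((T : ℤ) - 2 * (k : ℤ)) * δ ^ (t + k - T) := by
      rw [← hsq, ← pow_mul, ← zpow_natCast, ← zpow_natCast, ← zpow_add₀ hs0.ne']
      refine zpow_le_zpow_right_of_le_one₀ hs0 hs1.le ?_
      push_cast [Nat.cast_sub hTk.le]
      omega
    refine hz2.trans (add_le_add ?_ ?_)
    · rw [← mul_assoc]
      refine mul_le_mul_of_nonneg_right ?_ hX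
      rw [mul_assoc]
      exact mul_le_mul (hCC.trans (le_div_self (by positivity) (by positivity) hξ1)) hpow
        (by positivity) (by positivity)
    · refine le_trans ?_ (le_div_self (by positivity) (by positivity) hξ1)
      nlinarith

/-- From a sum of squared errors to the form of the regret bound. -/
theorem regret_form {c b G A q T : ℝ} (hc : 0 ≤ c) (hb : 0 ≤ b) (hT : 0 ≤ T) (hA : 0 ≤ A)
    (hq : 0 ≤ q) (hq2 : q ≤ 2) (hG : G ≤ T * q + A) :
    c * √(2 * T * (b * G)) + b * G ≤
      (c * √(2 * b) + 2 * b) * (√(T * A + T ^ 2 * q) + A) := by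
  set s := √(T * A + T ^ 2 * q) with hs
  have hs0 : 0 ≤ s := Real.sqrt_nonneg _
  have h1 : √(2 * T * (b * G)) ≤ √(2 * b) * s := by
    rw [hs, ← Real.sqrt_mul (by positivity)]
    refine Real.sqrt_le_sqrt ?_
    have := mul_le_mul_of_nonneg_left hG (show 0 ≤ 2 * b * T by positivity)
    linarith
  -- Since `q ≤ 2`, the term linear in `T` is dominated by the square root of `T ^ 2 * q`.
  have h2 : T * q ≤ 2 * s := by
    have h3 : √((T * q) ^ 2) ≤ √(2 ^ 2 * (T * A + T ^ 2 * q)) := by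
      refine Real.sqrt_le_sqrt ?_
      have h4 : 0 ≤ T * A := by positivity
      have h5 := mul_le_mul_of_nonneg_left hq2 (show 0 ≤ T ^ 2 * q by positivity)
      have h6 : 0 ≤ T ^ 2 * q := by positivity
      nlinarith
    rwa [Real.sqrt_sq (by positivity), Real.sqrt_mul (by norm_num),
      Real.sqrt_sq (by norm_num)] at h3
  have h7 := mul_le_mul_of_nonneg_left h1 hc
  have h8 := mul_le_mul_of_nonneg_left (hG.trans (add_le_add_left h2 A)) hb
  have h9 : 0 ≤ c * √(2 * b) * A := by positivity
  have h10 : 0 ≤ b * A := by positivity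
  linarith

/-- A radius for which truncation errors decay at a prescribed rate: on the whole network,
truncation is exact. -/
theorem exists_truncation_radius {γ δ : ℝ} (h0 : 0 < γ) (h1 : γ < 1) (hδ : 0 < δ) (hδ1 : δ < 1)
    (N κ : ℕ) : ∃ r : ℕ, (r ≤ κ ∨ N ≤ κ) ∧ γ ^ (2 * r) ≤ (δ ^ (2 * N))⁻¹ * δ ^ (2 * κ) := by
  have hp : 0 < δ ^ (2 * N) := by positivity
  rcases lt_or_ge κ N with h | h
  -- For `κ < N` even the trivial radius suffices, because the prefactor is at least `δ ^ (-2 * κ)`.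
  · refine ⟨0, Or.inl (Nat.zero_le _), ?_⟩
    rw [mul_zero, pow_zero, inv_mul_eq_div, one_le_div hp]
    exact pow_le_pow_of_le_one hδ.le hδ1.le (by omega)
  · obtain ⟨r, hr⟩ := exists_pow_lt_of_lt_one
      (show 0 < (δ ^ (2 * N))⁻¹ * δ ^ (2 * κ) by positivity) h1
    exact ⟨r, Or.inr h, (pow_le_pow_of_le_one h0.le h1.le (by omega)).trans hr.le⟩

end

/-! ### Small-gain conditions from the hypotheses on radius, horizon and forecasts -/

section

/-- The only form in which the lower bound on the truncation radius is used: the truncation part of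
the loop gain is at most a third of `C⁻¹`. -/
theorem nat_mul_pow_le {C δ lam : ℝ} {N κ : ℕ} (hC : 1 ≤ C) (h0 : 0 < δ) (h1 : δ < 1)
    (hl0 : 0 ≤ lam) (hl : lam ≤ δ) (hN : 0 < N)
    (hκ : Real.log (√δ * (1 - √δ) / (3 * C ^ 2 * N)) / Real.log δ ≤ κ) :
    N * lam ^ κ ≤ 3⁻¹ * C⁻¹ := by
  have hs0 : 0 < √δ := Real.sqrt_pos.2 h0
  have hs1 : √δ < 1 := by rw [Real.sqrt_lt' one_pos]; simpa using h1
  have hs1' : 0 < 1 - √δ := by linarith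
  have hC0 : 0 < C := by linarith
  have hN' : (0 : ℝ) < N := by exact_mod_cast hN
  have hC2 : (C ^ 2)⁻¹ ≤ C⁻¹ := inv_anti₀ hC0 (le_self_pow₀ hC two_ne_zero)
  have h3 := pow_le_of_log_div_le h0 h1 (q := √δ * (1 - √δ) / (3 * C ^ 2 * N)) (by positivity) hκ
  have h2 : √δ * (1 - √δ) ≤ 1 := by nlinarith
  calc N * lam ^ κ ≤ N * (√δ * (1 - √δ) / (3 * C ^ 2 * N)) := by
        gcongr
        exact (pow_le_pow_left₀ hl0 hl κ).trans h3
    _ = √δ * (1 - √δ) * (3⁻¹ * (C ^ 2)⁻¹) := by field_simp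
    _ ≤ 1 * (3⁻¹ * C⁻¹) := by gcongr
    _ = _ := one_mul _

theorem horizon_bounds {C δ lam : ℝ} {k : ℕ} (hC : 1 ≤ C) (h0 : 0 < δ) (h1 : δ < 1)
    (hl0 : 0 ≤ lam) (hl : lam ≤ δ)
    (hk : 2 * Real.log (δ * (1 - δ) / (6 * C ^ 3)) / Real.log δ ≤ k) :
    0 < k ∧ lam ^ k ≤ C⁻¹ := by
  have hC0 : 0 < C := by linarith
  have h1' : 0 < 1 - δ := by linarith
  have h2 : δ * (1 - δ) ≤ 1 := by nlinarith
  have hC3 : 1 ≤ C ^ 3 := one_le_pow₀ hC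
  have hC2 : 1 ≤ C ^ 2 := one_le_pow₀ hC
  have hq1 : δ * (1 - δ) / (6 * C ^ 3) < 1 := by
    rw [div_lt_one (by positivity)]; linarith
  have hq0 : 0 < δ * (1 - δ) / (6 * C ^ 3) := by positivity
  constructor
  · have h3 : 0 < 2 * Real.log (δ * (1 - δ) / (6 * C ^ 3)) / Real.log δ :=
      div_pos_of_neg_of_neg (by linarith [Real.log_neg hq0 hq1]) (Real.log_neg h0 h1)
    exact_mod_cast h3.trans_le hk
  -- The factor `2` in front of the logarithm means that `δ ^ k` is at most the square of the
  -- quotient; one power of it is enough.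
  · have h3 := pow_le_of_log_div_le h0 h1 (q := (δ * (1 - δ) / (6 * C ^ 3)) ^ 2)
      (by positivity) (by rw [Real.log_pow]; exact_mod_cast hk)
    refine (pow_le_pow_left₀ hl0 hl k).trans (h3.trans ?_)
    refine (pow_le_of_le_one hq0.le hq1.le two_ne_zero).trans ?_
    rw [div_le_iff₀ (by positivity), show C⁻¹ * (6 * C ^ 3) = 6 * C ^ 2 by field_simp]
    linarith

/-- Only the summand `m = 0` of the summability condition is needed, that is, the forecasts made at
time `t` itself. -/
theorem forecast_sum_le {φ : ℕ → ℕ → ℝ} (hφ : ∀ s t, 0 ≤ φ s t) {C L δ lam : ℝ} {T k t : ℕ}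
    (hC : 1 ≤ C) (hL : 1 ≤ L) (h0 : 0 < δ) (h1 : δ < 1) (hl0 : 0 ≤ lam) (hl : lam ≤ δ) (hk : 0 < k)
    (ht : t < T)
    (hsum : ∑ m ∈ (Finset.range k).filter (fun m => m ≤ t),
      ∑ n ∈ (Finset.range (k + 1)).filter (fun n => t - m + n ≤ T),
        φ (t - m + n) (t - m) * δ ^ (2 * (n : ℝ) + (m : ℝ) / 2) ≤ √δ / (3 * L * C ^ 2)) :
    ∑ τ ∈ Finset.range (min k (T - t) + 1), lam ^ (2 * τ) * φ (t + τ) t ≤ 3⁻¹ * C⁻¹ := by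
  have hC0 : 0 < C := by linarith
  have hs1 : √δ ≤ 1 := Real.sqrt_le_one.2 h1.le
  have hC2 : (C ^ 2)⁻¹ ≤ C⁻¹ := inv_anti₀ hC0 (le_self_pow₀ hC two_ne_zero)
  have h2 := Finset.single_le_sum (s := (Finset.range k).filter (fun m => m ≤ t))
    (f := fun m => ∑ n ∈ (Finset.range (k + 1)).filter (fun n => t - m + n ≤ T),
      φ (t - m + n) (t - m) * δ ^ (2 * (n : ℝ) + (m : ℝ) / 2))
    (fun m _ => Finset.sum_nonneg fun n _ => mul_nonneg (hφ _ _) (by positivity))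
    (Finset.mem_filter.2 ⟨Finset.mem_range.2 hk, Nat.zero_le t⟩)
  simp only [Nat.sub_zero, Nat.cast_zero, zero_div, add_zero] at h2
  have h3 : ∑ τ ∈ Finset.range (min k (T - t) + 1), lam ^ (2 * τ) * φ (t + τ) t ≤
      ∑ n ∈ (Finset.range (k + 1)).filter (fun n => t + n ≤ T),
        φ (t + n) t * δ ^ (2 * (n : ℝ)) := by
    calc _ ≤ ∑ n ∈ Finset.range (min k (T - t) + 1), φ (t + n) t * δ ^ (2 * (n : ℝ)) := by
          refine Finset.sum_le_sum fun n _ => ?_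
          rw [mul_comm, show (2 * (n : ℝ)) = ((2 * n : ℕ) : ℝ) by push_cast; ring,
            Real.rpow_natCast]
          exact mul_le_mul_of_nonneg_left (pow_le_pow_left₀ hl0 hl _) (hφ _ _)
      _ ≤ _ := by
          refine Finset.sum_le_sum_of_subset_of_nonneg (fun n hn => ?_)
            fun _ _ _ => mul_nonneg (hφ _ _) (by positivity)
          rw [Finset.mem_range] at hn
          rw [Finset.mem_filter, Finset.mem_range]
          omega
  refine h3.trans (h2.trans (hsum.trans ?_))
  calc √δ / (3 * L * C ^ 2) ≤ 1 / (3 * 1 * C ^ 2) := by gcongr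
    _ = 3⁻¹ * (C ^ 2)⁻¹ := by field_simp
    _ ≤ _ := by gcongr

/-- The decay `lam ^ τ ≤ δ ^ τ` outweighs the growth of the forecast errors, leaving a geometric
series with ratio `δ / (δ + ε)`. -/
theorem forecast_growth_sum_le {φ : ℕ → ℝ} (hφ0 : ∀ n, 0 ≤ φ n) {R δ ε lam : ℝ} {n : ℕ} (hR : 0 ≤ R)
    (h0 : 0 < δ) (hε : 0 < ε) (hl0 : 0 ≤ lam) (hl : lam ≤ δ)
    (hφ : ∀ m < n, φ m ≤ R * (δ + ε) ^ (-(m : ℤ))) :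
    ∑ τ ∈ Finset.range n, lam ^ τ * φ τ ≤ R * (δ + ε) / ε := by
  have hlt : δ / (δ + ε) < 1 := by rw [div_lt_one (by positivity)]; linarith
  calc _ ≤ ∑ m ∈ Finset.range n, R * (δ / (δ + ε)) ^ m := by
        refine Finset.sum_le_sum fun m hm => ?_
        have h1 := hφ m (Finset.mem_range.1 hm)
        calc _ ≤ δ ^ m * (R * (δ + ε) ^ (-(m : ℤ))) :=
              mul_le_mul (pow_le_pow_left₀ hl0 hl m) h1 (hφ0 m) (by positivity)
          _ = _ := by rw [zpow_neg, zpow_natCast, div_pow]; ring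
    _ ≤ R * (1 - δ / (δ + ε))⁻¹ := by
        rw [← Finset.mul_sum]
        exact mul_le_mul_of_nonneg_left (sum_pow_le (by positivity) hlt _) hR
    _ = _ := by
        rw [one_sub_div (by positivity), add_sub_cancel_left, inv_div, mul_div_assoc]

/-- Gain from the disturbances to the states. -/
def stateConst (μ L M : ℝ) : ℝ :=
  2 * (trajConst μ L M + gainConst μ L M * (3 + 2 * (1 - decayRate μ L M)⁻¹) *
    (1 - decayRate μ L M)⁻¹)

/-- Constant of the regret bound. -/
def regretConst (μ L M X x0b Dk e : ℝ) (N : ℕ) : ℝ :=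
  2 * L * (trajConst μ L M * (x0b + Dk) *
    √(2 * (2 * (1 + gainSqConst μ L M) * (errConst μ L M * ((X + Dk) ^ 2 + L ^ 2)) *
      (N * (e ^ (2 * N))⁻¹ + 1))) +
    2 * (2 * (1 + gainSqConst μ L M) * (errConst μ L M * ((X + Dk) ^ 2 + L ^ 2)) *
      (N * (e ^ (2 * N))⁻¹ + 1)))

namespace NetProblem.Regular

variable {N : ℕ} {S : NetProblem N} {μ L M : ℝ} {κ0 : ℕ}

theorem gainConst_nonneg (h : S.Regular μ L M κ0) : 0 ≤ gainConst μ L M := by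
  have := h.L_pos
  rw [gainConst]; positivity

theorem state_norm_le_of_small (h : S.Regular μ L M κ0) {T k κ : ℕ} {θs : ℕ → S.Param}
    {θh : ℕ → ℕ → S.Param} (hθ : ∀ t, θs t ∈ S.Θ) (hθh : ∀ s t, θh s t ∈ S.Θ) {Dk : ℝ}
    (hw : S.WindowBound T k Dk) (hk0 : 0 < k) (hkT : k ≤ T) (hκ : κ0 ≤ κ) {x0 : S.State}
    {x : ℕ → S.State} {u : ℕ → S.Control} (hx : S.IsUDTPC T k κ θs θh x0 x u) {a C Q : ℝ}
    (ha0 : 0 < a) (ha1 : a < 1) (ha : decayRate μ L M = a ^ 2) (hC : 1 ≤ C) (hQ1 : 1 ≤ Q)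
    (hgC : 6 * gainConst μ L M / (a * (1 - a)) ≤ C)
    (hκN : N * decayRate μ L M ^ κ ≤ 3⁻¹ * C⁻¹) (hkC : decayRate μ L M ^ k ≤ C⁻¹)
    (hs : ∀ t < T, ∑ τ ∈ Finset.range (min k (T - t) + 1), decayRate μ L M ^ (2 * τ) *
      ‖θh (t + τ) t - θs (t + τ)‖ ≤ 3⁻¹ * C⁻¹)
    (hQ : ∀ t < T, ∑ τ ∈ Finset.range (min k (T - t) + 1), decayRate μ L M ^ τ *
      ‖θh (t + τ) t - θs (t + τ)‖ ≤ Q) :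
    ∀ t ≤ T, ‖x t‖ ≤ 2 * trajConst μ L M * (a ^ t * ‖x0‖) + stateConst μ L M * (Q * Dk) := by
  intro t ht
  have hDk := window_nonneg hw hkT (hθ 0)
  have hgc := h.gainConst_nonneg
  have htc : 0 ≤ trajConst μ L M := Real.sqrt_nonneg _
  have hC0 : 0 < C := by linarith
  have h1a : 0 < 1 - a := by linarith
  have hinv : 0 ≤ (1 - decayRate μ L M)⁻¹ := inv_nonneg.2 (by linarith [h.rate_lt_one])
  have hC1 : C⁻¹ ≤ 1 := inv_le_one_of_one_le₀ hC
  have hCp : 0 < C⁻¹ := by positivity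
  -- The contributions of truncation, horizon and forecasts are each at most `C⁻¹`; the factor `6`
  -- in the bound on `C` consists of these three and of the `2` in the Gronwall condition.
  have hsmall : gainConst μ L M * (N * decayRate μ L M ^ κ + decayRate μ L M ^ k + 3⁻¹ * C⁻¹) ≤
      a * (1 - a) / 2 := by
    rw [div_le_iff₀ (by positivity)] at hgC
    calc _ ≤ gainConst μ L M * (3 * C⁻¹) := by gcongr; linarith
      _ = (6 * gainConst μ L M) * C⁻¹ / 2 := by ring
      _ ≤ (C * (a * (1 - a))) * C⁻¹ / 2 := by gcongr
      _ = _ := by field_simp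
  refine (h.state_norm_le hθ hθh hw hk0 hkT hκ hx ha0 ha1 ha (by positivity) (by linarith)
    hs hQ hsmall t ht).trans (add_le_add_right ?_ _)
  have h1 : N * decayRate μ L M ^ κ + decayRate μ L M ^ k + Q + 2 * (1 - decayRate μ L M)⁻¹ ≤
      (3 + 2 * (1 - decayRate μ L M)⁻¹) * Q := by
    have h2 : 2 * (1 - decayRate μ L M)⁻¹ ≤ 2 * (1 - decayRate μ L M)⁻¹ * Q :=
      le_mul_of_one_le_right (by positivity) hQ1
    linarith
  have h2 : trajConst μ L M ≤ trajConst μ L M * Q := le_mul_of_one_le_right htc hQ1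
  have h3 := mul_le_mul_of_nonneg_right (mul_le_mul_of_nonneg_left h1 hgc) hinv
  have h4 := mul_le_mul_of_nonneg_right (add_le_add h2 h3) hDk
  rw [stateConst]
  linarith

/-- The rate `e` of the truncation error is arbitrary in `(0, 1)`; it is paid for by the factor `(e
^ (2 * N))⁻¹` from the choice of the truncation radius. -/
theorem regret_le_regretConst (h : S.Regular μ L M κ0) {T k κ : ℕ} {θs : ℕ → S.Param}
    {θh : ℕ → ℕ → S.Param} (hθ : ∀ t, θs t ∈ S.Θ) (hθh : ∀ s t, θh s t ∈ S.Θ) {Dk : ℝ}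
    (hw : S.WindowBound T k Dk) (hk0 : 0 < k) (hkT : k ≤ T) (hκ : κ0 ≤ κ)
    {x0 : S.State} {x xs : ℕ → S.State} {u us : ℕ → S.Control}
    (hx : S.IsUDTPC T k κ θs θh x0 x u) (hopt : S.IsOPT T θs x0 xs us) {a X x0b e : ℝ}
    (ha : decayRate μ L M ≤ a) (ha1 : a ≤ 1) (he0 : 0 < e) (he1 : e < 1)
    (hX : ∀ t < T, ‖x t‖ ≤ X) (hx0 : ‖x0‖ ≤ x0b) {Φ : ℕ → ℝ}
    (hΦ : ∀ n, Φ n = ∑ t ∈ Finset.range (T - n + 1), ‖θh (t + n) t - θs (t + n)‖ ^ 2) :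
    S.cost T θs x u - S.cost T θs xs us ≤ regretConst μ L M X x0b Dk e N *
      (√((T : ℝ) * ∑ n ∈ Finset.range (k + 1), a ^ n * Φ n +
        (T : ℝ) ^ 2 * (e ^ (2 * κ) + a ^ (2 * k))) +
      ∑ n ∈ Finset.range (k + 1), a ^ n * Φ n) := by
  have hDk := window_nonneg hw hkT (hθ 0)
  have hL := h.L_pos
  have htc : 0 ≤ trajConst μ L M := Real.sqrt_nonneg _
  have hr0 : 0 ≤ x0b := (norm_nonneg _).trans hx0
  have ha0 : 0 < a := h.rate_pos.trans_le ha
  obtain ⟨rad, hrad, hradb⟩ := exists_truncation_radius h.rate_pos h.rate_lt_one he0 he1 N κ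
  have hE := h.errConst_nonneg
  have hgs : 0 ≤ gainSqConst μ L M := by rw [gainSqConst]; positivity
  have hA : 0 ≤ ∑ n ∈ Finset.range (k + 1), a ^ n * Φ n :=
    Finset.sum_nonneg fun n _ => by rw [hΦ]; positivity
  have hq0 : 0 ≤ e ^ (2 * κ) + a ^ (2 * k) := by positivity
  have hq2 : e ^ (2 * κ) + a ^ (2 * k) ≤ 2 := by
    have h1 := pow_le_one₀ (n := 2 * κ) he0.le he1.le
    have h2 := pow_le_one₀ (n := 2 * k) ha0.le ha1
    linarith
  have hG : T * (N * decayRate μ L M ^ (2 * rad) + decayRate μ L M ^ (2 * k)) +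
      ∑ n ∈ Finset.range (k + 1), a ^ n * Φ n ≤
      (N * (e ^ (2 * N))⁻¹ + 1) * (T * (e ^ (2 * κ) + a ^ (2 * k)) +
          ∑ n ∈ Finset.range (k + 1), a ^ n * Φ n) := by
    have h1 : N * decayRate μ L M ^ (2 * rad) + decayRate μ L M ^ (2 * k) ≤
        (N * (e ^ (2 * N))⁻¹ + 1) * (e ^ (2 * κ) + a ^ (2 * k)) := by
      have h2 := mul_le_mul_of_nonneg_left hradb (Nat.cast_nonneg (α := ℝ) N)
      have h3 := pow_le_pow_left₀ h.rate_pos.le ha (2 * k)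
      have h4 : 0 ≤ N * (e ^ (2 * N))⁻¹ * a ^ (2 * k) := by positivity
      have h5 : 0 ≤ e ^ (2 * κ) := by positivity
      linarith
    have h2 := mul_le_mul_of_nonneg_left h1 (Nat.cast_nonneg (α := ℝ) T)
    have h3 : 0 ≤ N * (e ^ (2 * N))⁻¹ * ∑ n ∈ Finset.range (k + 1), a ^ n * Φ n := by positivity
    linarith
  have hreg := h.regret_le hθ hθh hw hk0 hkT hκ hrad hx hopt ha hX hx0 hΦ hG
  have hform := regret_form (c := trajConst μ L M * (x0b + Dk))
    (b := 2 * (1 + gainSqConst μ L M) * (errConst μ L M * ((X + Dk) ^ 2 + L ^ 2)) *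
      (N * (e ^ (2 * N))⁻¹ + 1)) (T := T) (by positivity) (by positivity)
    (Nat.cast_nonneg T) hA hq0 hq2 le_rfl
  refine hreg.trans (le_trans (le_of_eq ?_) ((mul_le_mul_of_nonneg_left hform
    (show 0 ≤ 2 * L by positivity)).trans (le_of_eq (mul_assoc _ _ _).symm)))
  simp only [mul_assoc]
  rw [← mul_add, ← mul_add]

end NetProblem.Regular

end

end

end NetCtrl

/-! ### The theorem -/

theorem theorem2 (L γ μ σ : ℝ) (d : ℕ) (hL : 1 < L) (hγ0 : 0 < γ) (hγ1 : γ < 1)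
    (hμ : 0 < μ) (hσ : 0 < σ) :
    -- the temporal decay constants depend only on `L`, `γ`, `μ`, `σ` and `d`
    ∃ Ω δT : ℝ, 0 < Ω ∧ 0 < δT ∧ δT < 1 ∧
      (∀ (N : ℕ) (S : NetProblem N) (κ0 : ℕ),
        S.SystemAssumption L γ σ d κ0 → S.CostAssumption L μ → S.TemporalDecay d Ω δT) ∧
      ∀ (p : ℕ → ℝ) (D : ℝ), Subexponential p → 0 ≤ D →
      ∀ C δ ξ : ℝ, C = max Ω (max (NetCtrl.Γ L γ μ p) (NetCtrl.Υ L γ μ D)) →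
        δ = max (NetCtrl.δS L γ μ) δT → ξ = 1 - √δ →
      ∀ (N : ℕ) (R ε Dk r : ℝ), 1 ≤ R → 0 < ε →
      -- the constant hidden in the `O`-notation of the regret bound
      ∃ Kreg : ℝ,
      ∀ (S : NetProblem N) (κ0 : ℕ), S.SystemAssumption L γ σ d κ0 → S.CostAssumption L μ →
        S.BandAssumption p → S.ParamAssumption L D →
      ∀ (T k κ : ℕ) (θs : ℕ → S.Param) (θh : ℕ → ℕ → S.Param) (x0 : S.State),
        k ≤ T →
        (∀ t, θs t ∈ S.Θ) → (∀ s t, θh s t ∈ S.Θ) →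
        ‖x0‖ ≤ r →
        -- the disturbances of any `k` consecutive steps are bounded by `Dk` in total
        (∀ t, t + k ≤ T → ∀ ϑ : ℕ → S.Param, (∀ τ, ϑ τ ∈ S.Θ) →
          ∑ τ ∈ Finset.range k, ‖S.dist (t + τ) (ϑ τ)‖ ≤ Dk) →
        (κ : ℝ) ≥ max (κ0 : ℝ)
          (Real.log (√δ * (1 - √δ) / (3 * C ^ 2 * N)) / Real.log δ) →
        (k : ℝ) ≥ 2 * Real.log (δ * (1 - δ) / (6 * C ^ 3)) / Real.log δ →
        -- summability condition on the forecast errors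
        (∀ t < T, ∑ m ∈ (Finset.range k).filter (fun m => m ≤ t),
            ∑ n ∈ (Finset.range (k + 1)).filter (fun n => t - m + n ≤ T),
              ‖θh (t - m + n) (t - m) - θs (t - m + n)‖ * δ ^ (2 * (n : ℝ) + (m : ℝ) / 2)
            ≤ √δ / (3 * L * C ^ 2)) →
        -- growth condition on the forecast errors
        (∀ t < T, ∀ n ≤ k, t + n ≤ T →
          ‖θh (t + n) t - θs (t + n)‖ ≤ R * (δ + ε) ^ (-(n : ℤ))) →
      -- the controller and the offline optimum are well defined
      (∃ x u, S.IsUDTPC T k κ θs θh x0 x u) ∧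
      (∃ xs us, S.IsOPT T θs x0 xs us) ∧
      ∀ x u, S.IsUDTPC T k κ θs θh x0 x u →
        -- input-to-state stability
        (∀ W : ℝ, W = 8 * L * N * C ^ 2 * (δ + ε) * R / ((1 - δ) ^ 2 * ε) * Dk →
          (∀ t, t + k ≤ T →
            ‖x t‖ ≤ C / ξ * (1 - ξ) ^ (t - k) * ‖x0‖ + W / ξ) ∧
          (∀ t, t ≤ T → T < t + k →
            ‖x t‖ ≤ C ^ 2 / ξ ^ 2 * (1 - ξ) ^ ((T : ℤ) - 2 * (k : ℤ)) * δ ^ (t + k - T) * ‖x0‖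
              + 2 * C * W / ξ ^ 2)) ∧
        -- regret
        (∀ xs us, S.IsOPT T θs x0 xs us →
          ∀ Φ : ℕ → ℝ,
            (∀ n, Φ n = ∑ t ∈ Finset.range (T - n + 1), ‖θh (t + n) t - θs (t + n)‖ ^ 2) →
          S.cost T θs x u - S.cost T θs xs us ≤
            Kreg * (√((T : ℝ) * ∑ n ∈ Finset.range (k + 1), δT ^ n * Φ n +
                (T : ℝ) ^ 2 * (NetCtrl.δS L γ μ ^ (2 * κ) + δT ^ (2 * k))) +
              ∑ n ∈ Finset.range (k + 1), δT ^ n * Φ n)) := by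
  have hL0 : 0 < L := by linarith
  have hLm : 0 < max L μ := lt_max_of_lt_left hL0
  obtain ⟨M, hMdef⟩ : ∃ M, M = NetProblem.dualConst L γ σ d := ⟨_, rfl⟩
  have hM : 0 < M := hMdef ▸ NetProblem.dualConst_pos d hL hγ1
  have hrate0 : 0 < decayRate μ L M := decayRate_pos hμ hL0 hM
  have hrate1 : decayRate μ L M < 1 := decayRate_lt_one hμ hL0 hM
  have hlam0 : 0 < decayRate μ (max L μ) M := decayRate_pos hμ hLm hM
  have hlam1 : decayRate μ (max L μ) M < 1 := decayRate_lt_one hμ hLm hM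
  have hK : 0 < kktConst μ (max L μ) M := kktConst_pos hμ hLm hM
  -- The open-loop rate is `a ^ 2`; the Gronwall argument yields rate `a` for the closed loop.
  obtain ⟨a, ha⟩ : ∃ a, a = √(decayRate μ (max L μ) M) := ⟨_, rfl⟩
  have ha0 : 0 < a := ha ▸ Real.sqrt_pos.2 hlam0
  have ha1 : a < 1 := by rw [ha, Real.sqrt_lt' one_pos]; simpa using hlam1
  have hasq : decayRate μ (max L μ) M = a ^ 2 := by rw [ha, Real.sq_sqrt hlam0.le]
  have hlama : decayRate μ (max L μ) M ≤ a := by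
    rw [hasq]; exact pow_le_of_le_one ha0.le ha1.le two_ne_zero
  have h1lam : 0 < 1 - decayRate μ (max L μ) M := by linarith
  have h1a : 0 < 1 - a := by linarith
  have htc0 : 0 ≤ trajConst μ (max L μ) M := Real.sqrt_nonneg _
  have hgc0 : 0 ≤ gainConst μ (max L μ) M := by rw [gainConst]; positivity
  have hsc0 : 0 ≤ stateConst μ (max L μ) M := by rw [stateConst]; positivity
  have hg0 : 0 ≤ 6 * gainConst μ (max L μ) M / (a * (1 - a)) := by positivity
  have hΩ₀ : 0 ≤ √(4 * kktConst μ L M * (1 + L ^ 2)) * (decayRate μ L M)⁻¹ := by positivity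
  -- The summands of `Ω` make `C` dominate `1`, the constant of temporal decay, the small-gain
  -- threshold, and the two constants of the state bound. The rate `δT` dominates both the
  -- closed-loop rate `a` and the rate of temporal decay, which is computed with `L` itself.
  refine ⟨1 + √(4 * kktConst μ L M * (1 + L ^ 2)) * (decayRate μ L M)⁻¹ +
    6 * gainConst μ (max L μ) M / (a * (1 - a)) + 2 * trajConst μ (max L μ) M +
    stateConst μ (max L μ) M, max a (decayRate μ L M), by positivity, lt_max_of_lt_left ha0,
    max_lt ha1 hrate1, ?_, ?_⟩
  · intro N S κ0 hS hC
    exact (NetProblem.temporalDecay_decayRate hL.le hμ hσ hM (hMdef ▸ le_max_right _ _) hS hC).mono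
      (by linarith) hΩ₀ hrate0.le (le_max_right _ _)
  intro p D _ _ C δ ξ hC hδ hξ N R ε Dk r hR hε
  subst hξ
  have hδT1 : max a (decayRate μ L M) < 1 := max_lt ha1 hrate1
  have haδT : a ≤ max a (decayRate μ L M) := le_max_left _ _
  generalize max a (decayRate μ L M) = δT at *
  have hδS0 := δS_pos L γ μ
  have hδS1 : NetCtrl.δS L γ μ < 1 := δS_lt_one hL hγ1 hμ
  have hδ0 : 0 < δ := hδ ▸ lt_max_of_lt_left hδS0
  have hδ1 : δ < 1 := hδ ▸ max_lt hδS1 hδT1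
  have haδ : a ≤ δ := haδT.trans (hδ ▸ le_max_right _ _)
  have hlamδ : decayRate μ (max L μ) M ≤ δ := hlama.trans haδ
  have hΩC := hC ▸ le_max_left _ (max (NetCtrl.Γ L γ μ p) (NetCtrl.Υ L γ μ D))
  have hC1 : 1 ≤ C := by linarith
  have hQ1 : 1 ≤ R * (δ + ε) / ε := by
    rw [one_le_div hε]
    have := mul_le_mul_of_nonneg_right hR (show 0 ≤ δ + ε by positivity)
    linarith
  refine ⟨regretConst μ (max L μ) M (2 * trajConst μ (max L μ) M * r +
    stateConst μ (max L μ) M * (R * (δ + ε) / ε * Dk)) r Dk (NetCtrl.δS L γ μ) N, ?_⟩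
  intro S κ0 hS hCost _ hP T k κ θs θh x0 hkT hθ hθh hx0 hw hκ hk hsumφ hφ
  have h : S.Regular μ (max L μ) M κ0 :=
    hMdef ▸ NetProblem.regular hL hγ0 hγ1 hμ hσ hS hCost hP
  have hw' : S.WindowBound T k Dk := hw
  have hDk : 0 ≤ Dk := NetProblem.window_nonneg hw' hkT (hθ 0)
  -- An empty graph has diameter `0`, which contradicts `κ0` being smaller than the diameter.
  have hN : 0 < N := by
    rcases Nat.eq_zero_or_pos N with rfl | hN
    · have h1 := hS.diam
      rw [SimpleGraph.ediam_eq_zero_of_subsingleton] at h1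
      exact absurd h1 (by simp)
    · exact hN
  have hκ0 : κ0 ≤ κ := by exact_mod_cast (le_max_left _ _).trans hκ
  have hκN := nat_mul_pow_le hC1 hδ0 hδ1 hlam0.le hlamδ hN ((le_max_right _ _).trans hκ)
  obtain ⟨hk0, hkC⟩ := horizon_bounds hC1 hδ0 hδ1 hlam0.le hlamδ hk
  refine ⟨h.exists_isUDTPC T k κ hθh x0, h.exists_isOPT T hθ x0, fun x u hx => ?_⟩
  have hstate := h.state_norm_le_of_small hθ hθh hw' hk0 hkT hκ0 hx ha0 ha1 hasq hC1 hQ1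
    (by linarith) hκN hkC
    (fun t ht => forecast_sum_le (φ := fun s t => ‖θh s t - θs s‖) (fun _ _ => norm_nonneg _)
      hC1 hL.le hδ0 hδ1 hlam0.le hlamδ hk0 ht (hsumφ t ht))
    (fun t ht => forecast_growth_sum_le (φ := fun n => ‖θh (t + n) t - θs (t + n)‖)
      (fun _ => norm_nonneg _) (by linarith) hδ0 hε hlam0.le hlamδ
      fun n hn => hφ t ht n (by omega) (by omega))
  refine ⟨fun W hW => ?_, fun xs us hopt Φ hΦ => ?_⟩
  · have hKW : stateConst μ (max L μ) M * (R * (δ + ε) / ε * Dk) ≤ W := by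
      have h2 : W = 8 * L * N * C ^ 2 / (1 - δ) ^ 2 * (R * (δ + ε) / ε * Dk) := by
        have h3 : 1 - δ ≠ 0 := by linarith
        rw [hW]; field_simp
      rw [h2]
      refine mul_le_mul_of_nonneg_right ?_ (by positivity)
      -- Only the factor `C ^ 2` of `W` is needed to dominate the state constant; the remaining
      -- factors are at least `1`.
      have h1 : stateConst μ (max L μ) M ≤ C ^ 2 :=
        le_trans (by linarith) (le_self_pow₀ hC1 two_ne_zero)
      have h3 : 0 < 1 - δ := by linarith
      refine h1.trans (le_trans ?_ (le_div_self (by positivity) (by positivity)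
        (pow_le_one₀ h3.le (by linarith))))
      have h4 : (1 : ℝ) ≤ N := by exact_mod_cast hN
      have h5 : 1 ≤ L * N := one_le_mul_of_one_le_of_one_le hL.le h4
      exact le_mul_of_one_le_left (by positivity) (by linarith)
    have hW0 : 0 ≤ W := le_trans (by positivity) hKW
    -- The closed loop decays at rate `a ≤ δ`, faster than the rate `1 - ξ = √δ` of the claim.
    have haδ' : a ≤ √δ := haδ.trans (by
      rw [Real.le_sqrt hδ0.le hδ0.le]
      exact pow_le_of_le_one hδ0.le hδ1.le two_ne_zero)
    have hz : ∀ t ≤ T, ‖x t‖ ≤ C * (a ^ t * ‖x0‖) + W := fun t ht =>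
      (hstate t ht).trans (add_le_add (mul_le_mul_of_nonneg_right (by linarith) (by positivity)) hKW)
    exact ⟨fun t ht => (regime_bounds (T := T) (k := k) (t := t) hC1 hδ0 hδ1 ha0.le haδ'
        (norm_nonneg x0) hW0 (hz t (by omega))).1,
      fun t ht htk => (regime_bounds hC1 hδ0 hδ1 ha0.le haδ' (norm_nonneg x0) hW0
        (hz t ht)).2 ht htk⟩
  · refine h.regret_le_regretConst hθ hθh hw' hk0 hkT hκ0 hx hopt (hlama.trans haδT) hδT1.le
      hδS0 hδS1 (fun t ht => (hstate t ht.le).trans (add_le_add_left ?_ _)) hx0 hΦ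
    refine mul_le_mul_of_nonneg_left ?_ (by positivity)
    exact (mul_le_of_le_one_left (norm_nonneg _) (pow_le_one₀ ha0.le ha1.le)).trans hx0
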